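/- Conventions. $V=\mathbb R^3$ carries the Lorentzian inner product $\eta$ with $\eta_{02}=\eta_{20}=-1$, $\eta_{11}=\tfrac12$ and all other components zero, and $O(\eta)$ is its full automorphism group. On a smooth 3-dimensional Lorentzian manifold $(M,g)$, a null frame on an open set is a smooth frame $(e_0,e_1,e_2)=(\ell,m,n)$ with $g(e_a,e_b)=\eta_{ab}$; $D,\delta,\Delta$ are the derivatives along $\ell,m,n$. Write $\Gamma_{ab}=g(e_a,\nabla e_b)$ and, in the dual coframe $\omega^a$, $$\Gamma_{01}=\kappa\omega^0+\sigma\omega^1+\tau\omega^2,\quad \Gamma_{02}=2(\epsilon\omega^0+\alpha\omega^1+\gamma\omega^2),\quad \Gamma_{12}=\pi\omega^0+\lambda\omega^1+\nu\omega^2.$$ $R$ is the scalar curvature, and $\Psi_0,\dots,\Psi_4$ are the components of the trace-free Ricci tensor $S_{ab}=R_{ab}-\tfrac13Rg_{ab}$: $\Psi_0=S_{00}$, $\Psi_1=S_{01}$, $\Psi_2=S_{11}=S_{02}$, $\Psi_3=S_{12}$, $\Psi_4=S_{22}$. The curvature is of type D if at each point, in some null frame with $\Psi_4\ne0$, the quartic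 $\Psi_0+4\Psi_1z+6\Psi_2z^2+4\Psi_3z^3+\Psi_4z^4$ has two distinct real double roots. Let $R^{(p)}=(R_{abcd},\dots,R_{abcd;e_1\dots e_p})$ be the components in a null frame. A $p$-th order normalizing cross-section is a submanifold $S$ of $\bigoplus_{j\le p}\otimes^{4+j}V^*$ for which there is a subgroup $G_p\subset O(\eta)$ fixing $S$ pointwise such that $X\in O(\eta)$, $X(S)\cap S\neq\emptyset$ imply $X\in G_p$, and such that $M$ is covered by domains of null frames in which $R^{(p)}$ takes values in $S$. $(M,g)$ is curvature regular if such an $S$ exists for every $p\ge0$; the horizontal rank $t_p$ is the (constant) rank of the map $R^{(p)}$ in frames normalized by some such $S$. $(M,g)$ is properly $\mathrm{CH}_1$ if it is curvature regular, $t_1=0$ and $t_2>0$. Proposition. For real constants $T,C$ call a null frame $(T,C)$-canonical if on its domain $$\Psi_0=\Psi_1=\Psi_3=\Psi_4=0,\quad \Psi_2=-\tfrac23(C+2T^2),\quad R=4(C-T^2),$$ $$\sigma=\alpha=\gamma=\lambda=\nu=0,\quad \pi=\tau=T,\quad \kappa=1,$$ $$\delta\epsilon=-T\epsilon,\quad \Delta\epsilon=C,\quad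 \epsilon>0 .$$ (1) Let $(M,g)$ be a connected 3-dimensional Lorentzian manifold that is of type D and properly $\mathrm{CH}_1$. Then there are constants $T,C$ with $C+2T^2\neq0$ such that every point of $M$ has a neighbourhood carrying a $(T,C)$-canonical null frame. The constants are unique, and any two canonical frames agree where both are defined. Moreover the configuration is unique up to $O(\eta)$ conjugation: for every null frame on a connected open set in which all $R_{abcd}$ and $R_{abcd;e}$ are constant there is exactly one constant $X\in O(\eta)$ that carries it to a $(T,C)$-canonical frame. (2) Conversely, if $C+2T^2\ne0$ and every point of a connected 3-dimensional Lorentzian manifold has a neighbourhood with a $(T,C)$-canonical null frame, then the manifold is of type D and properly $\mathrm{CH}_1$. (3) For all real $T,C$ with $C+2T^2\neq0$ there is a connected 3-dimensional Lorentzian manifold as in (2). -/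

import Mathlib

open scoped Manifold ContDiff Matrix
open Bundle

noncomputable section

namespace Lorentz3

/-! ### The Lorentzian inner product space `(V, η)` and its automorphism group `O(η)` -/

/-- The model space for 3-dimensional manifolds. -/
abbrev E3 : Type := EuclideanSpace ℝ (Fin 3)

/-- The inner product `η_{ab}` in a null triad `(ℓ, m, n) = (e₀, e₁, e₂)`:
`η(ℓ, n) = -1`, `η(m, m) = 1/2`, all other products zero. -/
def eta : Matrix (Fin 3) (Fin 3) ℝ :=
  !![0, 0, -1; 0, 1 / 2, 0; -1, 0, 0]

/-- The inverse `η^{ab}`. -/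
def etaInv : Matrix (Fin 3) (Fin 3) ℝ :=
  !![0, 0, -1; 0, 2, 0; -1, 0, 0]

theorem eta_mul_etaInv : eta * etaInv = 1 := by
  ext i j
  fin_cases i <;> fin_cases j <;> simp [eta, etaInv, Matrix.mul_apply, Fin.sum_univ_three]

/-- The group `O(η)` of all linear automorphisms of `η`. -/
def Oeta : Subgroup (GL (Fin 3) ℝ) where
  carrier := {X | (X : Matrix (Fin 3) (Fin 3) ℝ)ᵀ * eta * (X : Matrix (Fin 3) (Fin 3) ℝ) = eta}
  mul_mem' := by
    intro X Y hX hY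
    simp only [Set.mem_ofPred_eq] at hX hY ⊢
    rw [Units.val_mul, Matrix.transpose_mul]
    calc (Y : Matrix (Fin 3) (Fin 3) ℝ)ᵀ * (X : Matrix (Fin 3) (Fin 3) ℝ)ᵀ * eta *
          ((X : Matrix (Fin 3) (Fin 3) ℝ) * (Y : Matrix (Fin 3) (Fin 3) ℝ))
        = (Y : Matrix (Fin 3) (Fin 3) ℝ)ᵀ *
          ((X : Matrix (Fin 3) (Fin 3) ℝ)ᵀ * eta * (X : Matrix (Fin 3) (Fin 3) ℝ)) *
          (Y : Matrix (Fin 3) (Fin 3) ℝ) := by simp only [Matrix.mul_assoc]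
      _ = eta := by rw [hX, hY]
  one_mem' := by simp
  inv_mem' := by
    intro X hX
    simp only [Set.mem_ofPred_eq] at hX ⊢
    have h1 : (X : Matrix (Fin 3) (Fin 3) ℝ) *
        ((X⁻¹ : GL (Fin 3) ℝ) : Matrix (Fin 3) (Fin 3) ℝ) = 1 := by
      rw [← Units.val_mul, mul_inv_cancel, Units.val_one]
    have h2 : ((X⁻¹ : GL (Fin 3) ℝ) : Matrix (Fin 3) (Fin 3) ℝ)ᵀ *
        (X : Matrix (Fin 3) (Fin 3) ℝ)ᵀ = 1 := by
      rw [← Matrix.transpose_mul, h1, Matrix.transpose_one]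
    calc ((X⁻¹ : GL (Fin 3) ℝ) : Matrix (Fin 3) (Fin 3) ℝ)ᵀ * eta *
          ((X⁻¹ : GL (Fin 3) ℝ) : Matrix (Fin 3) (Fin 3) ℝ)
        = ((X⁻¹ : GL (Fin 3) ℝ) : Matrix (Fin 3) (Fin 3) ℝ)ᵀ *
          ((X : Matrix (Fin 3) (Fin 3) ℝ)ᵀ * eta * (X : Matrix (Fin 3) (Fin 3) ℝ)) *
          ((X⁻¹ : GL (Fin 3) ℝ) : Matrix (Fin 3) (Fin 3) ℝ) := by rw [hX]
      _ = (((X⁻¹ : GL (Fin 3) ℝ) : Matrix (Fin 3) (Fin 3) ℝ)ᵀ *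
          (X : Matrix (Fin 3) (Fin 3) ℝ)ᵀ) * eta * ((X : Matrix (Fin 3) (Fin 3) ℝ) *
          ((X⁻¹ : GL (Fin 3) ℝ) : Matrix (Fin 3) (Fin 3) ℝ)) := by
            simp only [Matrix.mul_assoc]
      _ = eta := by rw [h1, h2, one_mul, mul_one]

/-- Components of a covariant tensor of rank `k` on `V`. -/
abbrev Tensor (k : ℕ) : Type := (Fin k → Fin 3) → ℝ

/-- The natural left action of a linear automorphism on covariant tensors:
`(X · t)_{a₁ … a_k} = (X⁻¹)^{b₁}_{a₁} ⋯ (X⁻¹)^{b_k}_{a_k} t_{b₁ … b_k}`. -/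
def tensorAct {k : ℕ} (X : GL (Fin 3) ℝ) (t : Tensor k) : Tensor k :=
  fun a => ∑ b : Fin k → Fin 3,
    (∏ i, ((X⁻¹ : GL (Fin 3) ℝ) : Matrix (Fin 3) (Fin 3) ℝ) (b i) (a i)) * t b

/-- The vector space `⊗⁴V* ⊕ ⋯ ⊕ ⊗^{4+p}V*`. -/
abbrev CurvJet (p : ℕ) : Type := (j : Fin (p + 1)) → Tensor (4 + (j : ℕ))

/-- The action of linear automorphisms on `⊗⁴V* ⊕ ⋯ ⊕ ⊗^{4+p}V*`. -/
def jetAct {p : ℕ} (X : GL (Fin 3) ℝ) (s : CurvJet p) : CurvJet p :=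
  fun j => tensorAct X (s j)

/-- `S` is an (embedded, smooth) submanifold of the normed space `F`: around each of its points
it is straightened, by a diffeomorphism between open sets, to a fixed linear subspace. -/
def IsSubmanifold {F : Type*} [NormedAddCommGroup F] [NormedSpace ℝ F] (S : Set F) : Prop :=
  ∃ L : Submodule ℝ F, ∀ s ∈ S, ∃ φ : OpenPartialHomeomorph F F, s ∈ φ.source ∧
    ContDiffOn ℝ ∞ φ φ.source ∧ ContDiffOn ℝ ∞ φ.symm φ.target ∧
    φ '' (S ∩ φ.source) = (L : Set F) ∩ φ.target

section Geometry

variable {M : Type*} [TopologicalSpace M] [ChartedSpace E3 M]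

/-! ### Lorentzian metrics and moving null frames -/

variable (M) in
/-- A smooth Lorentzian metric on a 3-manifold: a smooth field of symmetric bilinear forms on the
tangent spaces, each of which is isometric to `(V, η)`. -/
structure LorentzMetric [IsManifold 𝓘(ℝ, E3) ∞ M] where
  /-- The bilinear form on each tangent space. -/
  val (x : M) : TangentSpace 𝓘(ℝ, E3) x →L[ℝ] TangentSpace 𝓘(ℝ, E3) x →L[ℝ] ℝ
  symm (x : M) (v w : TangentSpace 𝓘(ℝ, E3) x) : val x v w = val x w v
  signature (x : M) : ∃ b : Module.Basis (Fin 3) ℝ (TangentSpace 𝓘(ℝ, E3) x),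
    ∀ i j, val x (b i) (b j) = eta i j
  contMDiff : ContMDiff 𝓘(ℝ, E3) (𝓘(ℝ, E3).prod 𝓘(ℝ, E3 →L[ℝ] E3 →L[ℝ] ℝ)) ∞
    (fun x => TotalSpace.mk' (E3 →L[ℝ] E3 →L[ℝ] ℝ) x (val x))

variable (M) in
/-- Triples of vector fields (only their restriction to some open set is relevant). -/
abbrev Triad : Type _ := Fin 3 → (x : M) → TangentSpace 𝓘(ℝ, E3) x

variable [IsManifold 𝓘(ℝ, E3) ∞ M]

/-- `e = (ℓ, m, n)` is a smooth moving `η`-frame (null triad) on the open set `U`. -/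
structure IsNullFrame (g : LorentzMetric M) (U : Set M) (e : Triad M) : Prop where
  isOpen : IsOpen U
  smooth : ∀ a, ContMDiffOn 𝓘(ℝ, E3) (𝓘(ℝ, E3).tangent) ∞
    (fun x => (⟨x, e a x⟩ : TangentBundle 𝓘(ℝ, E3) M)) U
  orthonormal : ∀ x ∈ U, ∀ a b, g.val x (e a x) (e b x) = eta a b

/-- The action of a constant matrix on triads, `e_b ↦ e_a X^a_b`. -/
def Triad.act (e : Triad M) (X : GL (Fin 3) ℝ) : Triad M :=
  fun b x => ∑ a, (X : Matrix (Fin 3) (Fin 3) ℝ) a b • e a x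

/-- The derivative of the function `f` along the vector field `v`. -/
def dirDeriv (v : (x : M) → TangentSpace 𝓘(ℝ, E3) x) (f : M → ℝ) (x : M) : ℝ :=
  mfderiv 𝓘(ℝ, E3) 𝓘(ℝ, ℝ) f x (v x)

/-! ### Connection and curvature components relative to a moving frame -/

/-- `g([e_a, e_b], e_c)`. -/
def brk (g : LorentzMetric M) (e : Triad M) (a b c : Fin 3) (x : M) : ℝ :=
  g.val x (VectorField.mlieBracket 𝓘(ℝ, E3) (e a) (e b) x) (e c x)

/-- The components `Γ_{abc} = g(e_a, ∇_{e_c} e_b)` of the Levi-Civita connection, by the Koszul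
formula for frames with constant inner products. The connection 1-forms are
`Γ_{ab} = Γ_{abc} ω^c`. -/
def conn (g : LorentzMetric M) (e : Triad M) (a b c : Fin 3) (x : M) : ℝ :=
  (brk g e c b a x - brk g e c a b x - brk g e b a c x) / 2

/-- `Γ^a_{bc}`, so that `∇_{e_c} e_b = Γ^a_{bc} e_a`. -/
def connUp (g : LorentzMetric M) (e : Triad M) (a b c : Fin 3) (x : M) : ℝ :=
  ∑ f, etaInv a f * conn g e f b c x

/-- The components `R^a_{bcd}` of the Riemann tensor,
`∇_{e_c}∇_{e_d} e_b - ∇_{e_d}∇_{e_c} e_b - ∇_{[e_c, e_d]} e_b = R^a_{bcd} e_a`, that is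
`dΓ^a_b + Γ^a_f ∧ Γ^f_b = ½ R^a_{bcd} ω^c ∧ ω^d`. -/
def riemUp (g : LorentzMetric M) (e : Triad M) (a b c d : Fin 3) (x : M) : ℝ :=
  dirDeriv (e c) (connUp g e a b d) x - dirDeriv (e d) (connUp g e a b c) x
    + ∑ f, (connUp g e a f c x * connUp g e f b d x - connUp g e a f d x * connUp g e f b c x)
    - ∑ f, (connUp g e f d c x - connUp g e f c d x) * connUp g e a b f x

/-- The components `R_{abcd}` of the Riemann tensor, as a field of rank 4 tensors. -/
def riem (g : LorentzMetric M) (e : Triad M) (x : M) : Tensor 4 :=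
  fun a => ∑ f, eta (a 0) f * riemUp g e f (a 1) (a 2) (a 3) x

/-- The components of the covariant derivative of a covariant tensor field, the index of
differentiation being the last one:
`t_{a₁…a_k;c} = e_c(t_{a₁…a_k}) - ∑ᵢ Γ^b_{aᵢc} t_{a₁…b…a_k}`. -/
def covDeriv (g : LorentzMetric M) (e : Triad M) {k : ℕ} (t : M → Tensor k) (x : M) :
    Tensor (k + 1) :=
  fun a => dirDeriv (e (a (Fin.last k))) (fun y => t y (Fin.init a)) x
    - ∑ i : Fin k, ∑ b, connUp g e b (a i.castSucc) (a (Fin.last k)) x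
        * t x (Function.update (Fin.init a) i b)

/-- The components `R_{abcd;e₁…e_j}` of the `j`-th covariant derivative of the Riemann tensor. -/
def nablaRiem (g : LorentzMetric M) (e : Triad M) : (j : ℕ) → M → Tensor (4 + j)
  | 0 => riem g e
  | j + 1 => covDeriv g e (nablaRiem g e j)

/-- `R^{(p)} = (R_{abcd}, …, R_{abcd;e₁…e_p})` relative to the frame `e`. -/
def curvJet (g : LorentzMetric M) (e : Triad M) (p : ℕ) (x : M) : CurvJet p :=
  fun j => nablaRiem g e j x

/-! ### Curvature regularity, horizontal rank, curvature homogeneity -/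

/-- The moving frame `e` on `U` is normalized by `S`, i.e. the image of `R^{(p)}` lies in `S`. -/
def IsNormalizedFrame (g : LorentzMetric M) (p : ℕ) (S : Set (CurvJet p)) (U : Set M)
    (e : Triad M) : Prop :=
  IsNullFrame g U e ∧ ∀ x ∈ U, curvJet g e p x ∈ S

/-- `S` is a `p`-th order normalizing cross-section: it is a submanifold, (i) fixed pointwise by
a subgroup `G_p ⊆ O(η)`, such that (ii) `X(S) ∩ S ≠ ∅` implies `X ∈ G_p` for `X ∈ O(η)`, and
(iii) `M` is covered by the domains of moving frames in which `R^{(p)}` takes values in `S`. -/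
def IsNormalizingCrossSection (g : LorentzMetric M) (p : ℕ) (S : Set (CurvJet p)) : Prop :=
  IsSubmanifold S ∧
  (∃ G : Subgroup (GL (Fin 3) ℝ), G ≤ Oeta ∧ (∀ X ∈ G, ∀ s ∈ S, jetAct X s = s) ∧
    ∀ X ∈ Oeta, (jetAct X '' S ∩ S).Nonempty → X ∈ G) ∧
  ∀ x : M, ∃ (U : Set M) (e : Triad M), x ∈ U ∧ IsNormalizedFrame g p S U e

/-- `(M, g)` is curvature regular: there are normalizing cross-sections of every order. -/
def CurvatureRegular (g : LorentzMetric M) : Prop :=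
  ∀ p : ℕ, ∃ S : Set (CurvJet p), IsNormalizingCrossSection g p S

/-- The `p`-th order horizontal rank `t_p` equals `t`: relative to some normalizing cross-section,
the map `R^{(p)}` has rank `t` at every point. -/
def HasHorizontalRank (g : LorentzMetric M) (p t : ℕ) : Prop :=
  ∃ S : Set (CurvJet p), IsNormalizingCrossSection g p S ∧
    ∀ (U : Set M) (e : Triad M), IsNormalizedFrame g p S U e → ∀ x ∈ U,
      Module.finrank ℝ (LinearMap.range
        (mfderiv 𝓘(ℝ, E3) 𝓘(ℝ, CurvJet p) (curvJet g e p) x).toLinearMap) = t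

/-- `(M, g)` is properly curvature homogeneous of order `k`: it is curvature regular, `t_k = 0`
and `t_{k+1} > 0`. -/
def ProperlyCH (g : LorentzMetric M) (k : ℕ) : Prop :=
  CurvatureRegular g ∧ HasHorizontalRank g k 0 ∧ ∃ t, 0 < t ∧ HasHorizontalRank g (k + 1) t

/-! ### Newman-Penrose scalars: `(Γ_{01}) = (κ, σ, τ)`, `(Γ_{02}) = 2(ε, α, γ)`,
`(Γ_{12}) = (π, λ, ν)` -/

section Scalars

variable (g : LorentzMetric M) (e : Triad M)

def kappa : M → ℝ := conn g e 0 1 0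
def sigma : M → ℝ := conn g e 0 1 1
def tau : M → ℝ := conn g e 0 1 2
def epsilon : M → ℝ := fun x => conn g e 0 2 0 x / 2
def alpha : M → ℝ := fun x => conn g e 0 2 1 x / 2
def gamma : M → ℝ := fun x => conn g e 0 2 2 x / 2
def varpi : M → ℝ := conn g e 1 2 0
def lam : M → ℝ := conn g e 1 2 1
def nu : M → ℝ := conn g e 1 2 2

/-- The Ricci tensor `R_{ab} = R^c_{acb}`. -/
def ricci (a b : Fin 3) (x : M) : ℝ := ∑ c, riemUp g e c a c b x

/-- The curvature scalar `R = R^a_a`. -/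
def scalarCurv (x : M) : ℝ := ∑ a, ∑ b, etaInv a b * ricci g e a b x

/-- The trace-free Ricci tensor `S_{ab} = R_{ab} - R g_{ab} / 3`. -/
def tfRicci (a b : Fin 3) (x : M) : ℝ := ricci g e a b x - scalarCurv g e x / 3 * eta a b

/-- The curvature scalars, `S = [[Ψ₀, Ψ₁, Ψ₂], [Ψ₁, Ψ₂, Ψ₃], [Ψ₂, Ψ₃, Ψ₄]]`. -/
def Psi0 : M → ℝ := tfRicci g e 0 0
def Psi1 : M → ℝ := tfRicci g e 0 1
def Psi2 : M → ℝ := tfRicci g e 1 1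
def Psi3 : M → ℝ := tfRicci g e 1 2
def Psi4 : M → ℝ := tfRicci g e 2 2

end Scalars

/-- The curvature has Petrov type D at every point: in some null triad with `Ψ₄ ≠ 0`, the quartic
`Ψ₀ + 4Ψ₁z + 6Ψ₂z² + 4Ψ₃z³ + Ψ₄z⁴` has two distinct real double roots. -/
def IsTypeD (g : LorentzMetric M) : Prop :=
  ∀ x : M, ∃ (U : Set M) (e : Triad M), x ∈ U ∧ IsNullFrame g U e ∧ Psi4 g e x ≠ 0 ∧
    ∃ a b : ℝ, a ≠ b ∧ ∀ z : ℝ,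
      Psi0 g e x + 4 * Psi1 g e x * z + 6 * Psi2 g e x * z ^ 2 + 4 * Psi3 g e x * z ^ 3
        + Psi4 g e x * z ^ 4 = Psi4 g e x * (z - a) ^ 2 * (z - b) ^ 2

/-- The moving frame `e = (ℓ, m, n)` on `U` realizes the canonical configuration with the
constants `T` and `C`; here `δ` and `Δ` are the derivatives along `m = e₁` and `n = e₂`. -/
structure IsCanonicalFrame (g : LorentzMetric M) (T C : ℝ) (U : Set M) (e : Triad M) :
    Prop where
  isNullFrame : IsNullFrame g U e
  curvature : ∀ x ∈ U, Psi0 g e x = 0 ∧ Psi1 g e x = 0 ∧ Psi3 g e x = 0 ∧ Psi4 g e x = 0 ∧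
    Psi2 g e x = -(2 / 3) * (C + 2 * T ^ 2) ∧ scalarCurv g e x = 4 * (C - T ^ 2)
  connection : ∀ x ∈ U, sigma g e x = 0 ∧ alpha g e x = 0 ∧ gamma g e x = 0 ∧
    lam g e x = 0 ∧ nu g e x = 0 ∧ varpi g e x = T ∧ tau g e x = T ∧ kappa g e x = 1
  derivatives : ∀ x ∈ U, dirDeriv (e 1) (epsilon g e) x = -T * epsilon g e x ∧
    dirDeriv (e 2) (epsilon g e) x = C ∧ 0 < epsilon g e x

/-- The moving frame `e` on `U` is normalized to first order: `R_{abcd}` and `R_{abcd;e}` are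
arrays of constants. -/
def HasConstantFirstJet (g : LorentzMetric M) (U : Set M) (e : Triad M) : Prop :=
  IsNullFrame g U e ∧ ∃ s : CurvJet 1, ∀ x ∈ U, curvJet g e 1 x = s

end Geometry

end Lorentz3

end

/-! Normal form of the curvature. The null vectors v_z = ℓ + 2z m + z² n turn the quartic into
S(v_z, v_z). Type D therefore means that S is, up to a multiple of η, a nonzero multiple of u ⊗ u,
where u is the spacelike covector with u(v_z) = (z - a)(z - b). In dimension three the Riemann
tensor is determined by the Ricci tensor, so when ℓ and n span the two double directions it becomes
`knTensor c d omega1` with d ≠ 0 (`riem_of_quartic`, `exists_riem_normal_form`). Its isotropy in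
O(η) consists of boosts, reflections and the exchange of ℓ and n (`knTensor_stabilizer`,
`monomial_of_orthogonal`).

Reduction. This tensor is boost invariant, so Γ_02 drops out of ∇R, while Γ_01 and Γ_12 can be read
off from it. Hence t_1 = 0 yields frames in which Γ_01 and Γ_12 have constant components
(`exists_isAdapted`). The structure equations for R_01cd and R_12cd are then linear algebraic
equations for Γ_02, and those for R_02cd prescribe its exterior derivative. Compatibility forces σ =
λ = 0 (`shear_free`). If κ = ν = 0, then ∇R is boost invariant too; if κ and ν are both nonzero,
Γ_02 is constant. In both cases ∇²R is constant, which t_2 > 0 excludes (`dichotomy`). So exactly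
one of κ, ν is nonzero. An exchange of ℓ and n makes it κ, the commutator [δ, Δ] gives π = τ, and a
boost with a reflection of m gives κ = 1 (`exists_isPreCanonical`). The only function left is ε.

Sign of ε and uniqueness. Only the identity and the reflection (ℓ, m, n) ↦ (-ℓ, m, -n) preserve the
canonical first order jet (`jet_stabilizer`), and the reflection reverses ε. A zero of ε would
enlarge the isotropy of the second order jet at one point. Since G_2 fixes the cross-section
pointwise, the isotropy would be enlarged nearby, ε would vanish there and ∇²R would be constant
(`IsPreCanonical.epsilon_ne_zero`). So ε ≠ 0, and ε > 0 selects one frame; this gives uniqueness and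
conjugacy.

Converse and existence. ∇²R is affine in ε with nonzero slope, and dε ≠ 0. Cross-sections are
obtained by fixing the first order jet and the sign of one component of ∇²R. For existence an
explicit triangular frame on ℝ³ realizes the required commutators.

The transformation laws behind all this are proved algebraically, over the ring of smooth functions
on a small open set with three derivations, from the uniqueness of the Levi-Civita connection. -/

noncomputable section

namespace Lorentz3

set_option linter.unusedSectionVars false

/-! ### Moving frames over a commutative algebra with derivations -/

section Algebraic

variable {A : Type*} [CommRing A] [Algebra ℝ A]

variable (A) in
/-- The inner product `η` with entries in an algebra. -/
def etaA : Matrix (Fin 3) (Fin 3) A := eta.map (algebraMap ℝ A)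

variable (A) in
/-- The inverse of `η` with entries in an algebra. -/
def etaInvA : Matrix (Fin 3) (Fin 3) A := etaInv.map (algebraMap ℝ A)

theorem etaA_mul_etaInvA : etaA A * etaInvA A = 1 := by
  rw [etaA, etaInvA, ← Matrix.map_mul, eta_mul_etaInv]; simp

theorem etaInvA_mul_etaA : etaInvA A * etaA A = 1 :=
  mul_eq_one_comm.mp etaA_mul_etaInvA

theorem eta_transpose : etaᵀ = eta := by
  ext i j; fin_cases i <;> fin_cases j <;> simp [eta]

theorem etaA_transpose : (etaA A)ᵀ = etaA A := by
  rw [etaA, ← Matrix.transpose_map, eta_transpose]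

theorem eta_comm (i j : Fin 3) : eta i j = eta j i := by
  conv_lhs => rw [← eta_transpose]
  rfl

variable (A) in
/-- Moving frames `D₀, D₁, D₂` of derivations of an algebra `A`, with the matrices
`U c = (Γ^a_{bc})` of a metric and torsion-free connection. -/
structure FrameAlg where
  /-- The derivatives along the frame. -/
  D : Fin 3 → Derivation ℝ A A
  /-- The connection matrices. -/
  U : Fin 3 → Matrix (Fin 3) (Fin 3) A
  metric : ∀ c, (etaA A * U c)ᵀ = -(etaA A * U c)
  lie : ∀ i j f, D i (D j f) - D j (D i f) = ∑ k, (U i k j - U j k i) * D k f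
  indep : ∀ h : Fin 3 → A, (∀ f, ∑ k, h k * D k f = 0) → h = 0

/-- Covariant tensors with components in `A`. -/
abbrev TensorA (A : Type*) (k : ℕ) : Type _ := (Fin k → Fin 3) → A

namespace FrameAlg

variable (F : FrameAlg A)

/-- The curvature matrices `(R^a_{bcd})`. -/
def Rm (c d : Fin 3) : Matrix (Fin 3) (Fin 3) A :=
  (F.U d).map (F.D c) - (F.U c).map (F.D d) + (F.U c * F.U d - F.U d * F.U c)
    - ∑ f, (F.U c f d - F.U d f c) • F.U f

/-- The Riemann tensor `R_{abcd}`. -/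
def riemL : TensorA A 4 := fun a => (etaA A * F.Rm (a 2) (a 3)) (a 0) (a 1)

/-- The covariant derivative of covariant tensors. -/
def covD {k : ℕ} (t : TensorA A k) : TensorA A (k + 1) := fun a =>
  F.D (a (Fin.last k)) (t (Fin.init a))
    - ∑ i : Fin k, ∑ b, F.U (a (Fin.last k)) b (a i.castSucc)
        * t (Function.update (Fin.init a) i b)

/-- The iterated covariant derivatives of the Riemann tensor. -/
def nabla : (j : ℕ) → TensorA A (4 + j)
  | 0 => F.riemL
  | j + 1 => F.covD (nabla j)

/-- The covariant derivative of vectors. -/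
def nab (c : Fin 3) (ξ : Fin 3 → A) : Fin 3 → A := fun p => F.D c (ξ p) + (F.U c *ᵥ ξ) p

theorem D_sum_mul {ι : Type*} [Fintype ι] (c : Fin 3) (x y : ι → A) :
    F.D c (∑ i, x i * y i) = ∑ i, (F.D c (x i) * y i + x i * F.D c (y i)) := by
  rw [map_sum]
  refine Finset.sum_congr rfl fun i _ => ?_
  rw [Derivation.leibniz]; simp only [smul_eq_mul]; ring

theorem map_D_mul (c : Fin 3) (X Y : Matrix (Fin 3) (Fin 3) A) :
    (X * Y).map (F.D c) = X.map (F.D c) * Y + X * Y.map (F.D c) := by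
  ext i j
  simp only [Matrix.map_apply, Matrix.mul_apply, Matrix.add_apply, D_sum_mul,
    Finset.sum_add_distrib]

theorem map_D_etaA (c : Fin 3) : (etaA A).map (F.D c) = 0 := by
  ext i j; simp [etaA]

theorem nab_add (c : Fin 3) (ξ ζ : Fin 3 → A) : F.nab c (ξ + ζ) = F.nab c ξ + F.nab c ζ := by
  funext p; simp [nab, Matrix.mulVec_add]; ring

theorem nab_smul (c : Fin 3) (h : A) (ξ : Fin 3 → A) :
    F.nab c (h • ξ) = F.D c h • ξ + h • F.nab c ξ := by
  funext p; simp [nab, Matrix.mulVec_smul]; ring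

theorem nab_sum {ι : Type*} (s : Finset ι) (c : Fin 3) (ξ : ι → Fin 3 → A) :
    F.nab c (∑ i ∈ s, ξ i) = ∑ i ∈ s, F.nab c (ξ i) := by
  classical
  induction s using Finset.induction_on with
  | empty => funext p; simp [nab]
  | insert i s hi ih => rw [Finset.sum_insert hi, Finset.sum_insert hi, nab_add, ih]

theorem D_mulVec (c : Fin 3) (X : Matrix (Fin 3) (Fin 3) A) (ξ : Fin 3 → A) (p : Fin 3) :
    F.D c ((X *ᵥ ξ) p) = (X.map (F.D c) *ᵥ ξ) p + (X *ᵥ fun q => F.D c (ξ q)) p := by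
  simp only [Matrix.mulVec, dotProduct, D_sum_mul, Finset.sum_add_distrib, Matrix.map_apply]

/-- The curvature is the commutator of covariant derivatives. -/
theorem Rm_mulVec (c d : Fin 3) (ξ : Fin 3 → A) :
    F.Rm c d *ᵥ ξ = F.nab c (F.nab d ξ) - F.nab d (F.nab c ξ)
      - ∑ f, (F.U c f d - F.U d f c) • F.nab f ξ := by
  have hs : ∀ (w : Fin 3 → A), (∑ f, w f • F.U f) *ᵥ ξ = ∑ f, w f • (F.U f *ᵥ ξ) := by
    intro w; rw [Matrix.sum_mulVec]; simp [Matrix.smul_mulVec]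
  have h1 : ∀ c d, F.nab c (F.nab d ξ) = fun p => F.D c (F.D d (ξ p))
      + ((F.U d).map (F.D c) *ᵥ ξ) p + (F.U d *ᵥ fun q => F.D c (ξ q)) p
      + (F.U c *ᵥ fun q => F.D d (ξ q)) p + (F.U c *ᵥ (F.U d *ᵥ ξ)) p := by
    intro c d; funext p
    have h2 : F.nab d ξ = (fun q => F.D d (ξ q)) + F.U d *ᵥ ξ := rfl
    rw [h2]
    simp only [nab, Pi.add_apply, map_add, D_mulVec, Matrix.mulVec_add]; ring
  have h3 : ∑ f, (F.U c f d - F.U d f c) • F.nab f ξ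
      = (fun p => F.D c (F.D d (ξ p)) - F.D d (F.D c (ξ p)))
        + ∑ f, (F.U c f d - F.U d f c) • (F.U f *ᵥ ξ) := by
    funext p
    simp only [nab, F.lie, Finset.sum_apply, Pi.add_apply, Pi.smul_apply, smul_eq_mul, mul_add,
      Finset.sum_add_distrib]
  rw [h1, h1, h3, Rm, Matrix.sub_mulVec, hs, Matrix.add_mulVec, Matrix.sub_mulVec,
    Matrix.sub_mulVec, ← Matrix.mulVec_mulVec, ← Matrix.mulVec_mulVec]
  funext p
  simp only [Pi.sub_apply, Pi.add_apply]
  ring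

/-- 2 is invertible in an ℝ-algebra, even though A may have zero divisors. -/
theorem two_cancel {x : A} (h : x + x = 0) : x = 0 := by
  have : x = (1 / 2 : ℝ) • (x + x) := by
    rw [← two_smul ℝ x, smul_smul]; norm_num
  rw [this, h, smul_zero]

/-- An array that is antisymmetric in the first two and symmetric in the last two indices
vanishes. -/
theorem eq_zero_of_antisymm_symm {w : Fin 3 → Fin 3 → Fin 3 → A}
    (h1 : ∀ a b c, w a b c = -w b a c) (h2 : ∀ a b c, w a b c = w a c b) (a b c : Fin 3) :
    w a b c = 0 := by
  apply two_cancel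
  have e : w a b c = -w a b c := by
    calc w a b c = -w b a c := h1 _ _ _
      _ = -w b c a := by rw [h2]
      _ = w c b a := by rw [h1 b c a]; ring
      _ = w c a b := by rw [h2]
      _ = -w a c b := h1 _ _ _
      _ = -w a b c := by rw [h2 a c b]
  nth_rewrite 2 [e]; ring

/-- A metric torsion-free connection is determined by the frame. -/
theorem connection_unique {V : Fin 3 → Matrix (Fin 3) (Fin 3) A}
    (hm : ∀ c, (etaA A * V c)ᵀ = -(etaA A * V c))
    (ht : ∀ i j f, F.D i (F.D j f) - F.D j (F.D i f) = ∑ k, (V i k j - V j k i) * F.D k f)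
    (c : Fin 3) : V c = F.U c := by
  -- Both connections have the same torsion-free commutators, and independence of the derivations
  -- allows coefficients to be compared. The lowered difference is then antisymmetric in its first
  -- two indices and symmetric in its last two.
  have h1 : ∀ i j k, V i k j - V j k i = F.U i k j - F.U j k i := by
    intro i j k
    have := F.indep (fun k => (V i k j - V j k i) - (F.U i k j - F.U j k i)) (by
      intro f
      simp only [sub_mul _ (F.U i _ j - F.U j _ i), Finset.sum_sub_distrib]
      rw [← ht, ← F.lie, sub_self])
    exact sub_eq_zero.mp (congrFun this k)
  have h2 := eq_zero_of_antisymm_symm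
    (w := fun a b c => (etaA A * (V c - F.U c)) a b) (by
      intro a b c
      have e1 := congrFun (congrFun (hm c) a) b
      have e2 := congrFun (congrFun (F.metric c) a) b
      simp only [Matrix.mul_sub, Matrix.sub_apply, Matrix.transpose_apply, Matrix.neg_apply]
        at e1 e2 ⊢
      rw [e1, e2]; ring) (by
      intro a b c
      simp only [Matrix.mul_apply, Matrix.sub_apply]
      refine Finset.sum_congr rfl fun k _ => ?_
      congr 1
      linear_combination h1 c b k)
  have h3 : etaA A * (V c - F.U c) = 0 := by ext a b; exact h2 a b c
  have h4 : V c - F.U c = etaInvA A * (etaA A * (V c - F.U c)) := by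
    rw [← Matrix.mul_assoc, etaInvA_mul_etaA, Matrix.one_mul]
  rw [h3, Matrix.mul_zero] at h4
  exact sub_eq_zero.mp h4

/-! ### Change of frame: connection and curvature -/

section Change

variable (F' : FrameAlg A) {X : Matrix (Fin 3) (Fin 3) A}

theorem inv_of_orthogonal (hX : Xᵀ * etaA A * X = etaA A) :
    X * (etaInvA A * Xᵀ * etaA A) = 1 := by
  rw [mul_eq_one_comm]
  rw [Matrix.mul_assoc, Matrix.mul_assoc, ← Matrix.mul_assoc Xᵀ, hX, etaInvA_mul_etaA]

/-- The transformation law of the connection. -/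
theorem connection_change (hX : Xᵀ * etaA A * X = etaA A)
    (hD : ∀ b f, F'.D b f = ∑ a, X a b * F.D a f) (c : Fin 3) :
    X * F'.U c = (∑ d, X d c • F.U d) * X + X.map (F'.D c) := by
  set N : Fin 3 → Matrix (Fin 3) (Fin 3) A :=
    fun c => (∑ d, X d c • F.U d) * X + X.map (F'.D c) with hN
  set V : Fin 3 → Matrix (Fin 3) (Fin 3) A := fun c => (etaInvA A * Xᵀ * etaA A) * N c with hV
  have hXV : ∀ c, X * V c = N c := by
    intro c; rw [hV]; simp only
    rw [← Matrix.mul_assoc, inv_of_orthogonal hX, Matrix.one_mul]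
  -- V = X⁻¹N, with X⁻¹ = η⁻¹Xᵀη, is the expected connection of the new frame. It suffices that V is
  -- metric and torsion-free there, by uniqueness.
  have key : V c = F'.U c := by
    refine F'.connection_unique (V := V) ?_ ?_ c
    · intro c
      have h1 : etaA A * V c = Xᵀ * (etaA A * N c) := by
        rw [hV]; simp only
        rw [← Matrix.mul_assoc, ← Matrix.mul_assoc, ← Matrix.mul_assoc, etaA_mul_etaInvA,
          Matrix.one_mul, Matrix.mul_assoc]
      have h2 : etaA A * N c = (etaA A * ∑ d, X d c • F.U d) * X + etaA A * X.map (F'.D c) := by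
        rw [hN]; simp only
        rw [Matrix.mul_add, Matrix.mul_assoc]
      have h3 : (etaA A * ∑ d, X d c • F.U d)ᵀ = -(etaA A * ∑ d, X d c • F.U d) := by
        rw [Matrix.mul_sum, Matrix.transpose_sum, ← Finset.sum_neg_distrib]
        refine Finset.sum_congr rfl fun d _ => ?_
        rw [Matrix.mul_smul, Matrix.transpose_smul, F.metric, smul_neg]
      have h4 : (X.map (F'.D c))ᵀ * etaA A * X + Xᵀ * etaA A * X.map (F'.D c) = 0 := by
        have := congrArg (fun Y => Matrix.map Y (F'.D c)) hX
        simp only [map_D_mul, map_D_etaA, Matrix.mul_zero, add_zero, Matrix.transpose_map] at this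
        exact this
      rw [h1, h2, Matrix.mul_add, Matrix.transpose_add, Matrix.transpose_mul, Matrix.transpose_mul,
        h3, Matrix.transpose_transpose, Matrix.transpose_mul, Matrix.transpose_mul,
        Matrix.transpose_transpose, etaA_transpose]
      have h5 := eq_neg_of_add_eq_zero_left h4
      rw [h5]
      simp only [Matrix.mul_neg, Matrix.neg_mul, Matrix.mul_assoc]
      abel
    · intro i j f
      have e0 : ∀ i j, ∑ k, V i k j * F'.D k f = ∑ p, N i p j * F.D p f := by
        intro i j
        simp only [hD, Finset.mul_sum]
        rw [Finset.sum_comm]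
        refine Finset.sum_congr rfl fun p _ => ?_
        rw [← hXV i, Matrix.mul_apply, Finset.sum_mul]
        exact Finset.sum_congr rfl fun k _ => by ring
      have e1 : ∀ i j, F'.D i (F'.D j f)
          = ∑ q, F'.D i (X q j) * F.D q f + ∑ q, ∑ d, X d i * X q j * F.D d (F.D q f) := by
        intro i j
        rw [hD j f, F'.D_sum_mul, Finset.sum_add_distrib]
        congr 1
        refine Finset.sum_congr rfl fun q _ => ?_
        rw [hD i (F.D q f), Finset.mul_sum]
        exact Finset.sum_congr rfl fun d _ => by ring
      have e2 : ∀ i j, ∑ p, N i p j * F.D p f = ∑ q, F'.D i (X q j) * F.D q f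
          + ∑ p, (∑ d, ∑ q, X d i * X q j * F.U d p q) * F.D p f := by
        intro i j
        rw [← Finset.sum_add_distrib]
        refine Finset.sum_congr rfl fun p _ => ?_
        rw [hN]
        simp only [Matrix.add_apply, Matrix.mul_apply, Matrix.sum_apply, Matrix.smul_apply,
          Matrix.map_apply, smul_eq_mul, add_mul]
        rw [add_comm]
        congr 2
        simp only [Finset.sum_mul]
        rw [Finset.sum_comm]
        exact Finset.sum_congr rfl fun d _ => Finset.sum_congr rfl fun q _ => by ring
      -- The second derivatives enter only antisymmetrized, so they are commutators of the old frame
      -- and reduce to first derivatives.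
      have e3 : ∑ q, ∑ d, X d i * X q j * F.D d (F.D q f)
          - ∑ q, ∑ d, X d j * X q i * F.D d (F.D q f)
          = ∑ p, (∑ d, ∑ q, X d i * X q j * F.U d p q) * F.D p f
          - ∑ p, (∑ d, ∑ q, X d j * X q i * F.U d p q) * F.D p f := by
        have l1 : ∑ q, ∑ d, X d i * X q j * F.D d (F.D q f)
            - ∑ q, ∑ d, X d j * X q i * F.D d (F.D q f)
            = ∑ d, ∑ q, X d i * X q j * (F.D d (F.D q f) - F.D q (F.D d f)) := by
          simp only [mul_sub, Finset.sum_sub_distrib]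
          rw [Finset.sum_comm]
          congr 1
          exact Finset.sum_congr rfl fun d _ => Finset.sum_congr rfl fun q _ => by ring
        have l2 : ∑ p, (∑ d, ∑ q, X d i * X q j * F.U d p q) * F.D p f
            - ∑ p, (∑ d, ∑ q, X d j * X q i * F.U d p q) * F.D p f
            = ∑ p, ∑ d, ∑ q, X d i * X q j * ((F.U d p q - F.U q p d) * F.D p f) := by
          rw [← Finset.sum_sub_distrib]
          refine Finset.sum_congr rfl fun p _ => ?_
          rw [← sub_mul]
          nth_rewrite 2 [Finset.sum_comm]
          simp only [← Finset.sum_sub_distrib, Finset.sum_mul]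
          exact Finset.sum_congr rfl fun d _ => Finset.sum_congr rfl fun q _ => by ring
        rw [l1, l2]
        rw [Finset.sum_comm]
        nth_rewrite 2 [Finset.sum_comm]
        rw [Finset.sum_comm]
        refine Finset.sum_congr rfl fun d _ => ?_
        rw [Finset.sum_comm]
        refine Finset.sum_congr rfl fun q _ => ?_
        rw [F.lie, Finset.mul_sum]
      simp only [sub_mul, Finset.sum_sub_distrib]
      rw [e0, e0, e1, e1, e2, e2]
      linear_combination e3
  rw [← key, hXV]

/-- The transformation law of the covariant derivative of vectors. -/
theorem nab_change (hX : Xᵀ * etaA A * X = etaA A)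
    (hD : ∀ b f, F'.D b f = ∑ a, X a b * F.D a f) (c : Fin 3) (ξ : Fin 3 → A) :
    X *ᵥ F'.nab c ξ = ∑ d, X d c • F.nab d (X *ᵥ ξ) := by
  have h1 : F'.nab c ξ = (fun q => F'.D c (ξ q)) + F'.U c *ᵥ ξ := rfl
  have hs : ∀ (w : Fin 3 → A) ζ, (∑ f, w f • F.U f) *ᵥ ζ = ∑ f, w f • (F.U f *ᵥ ζ) := by
    intro w ζ; rw [Matrix.sum_mulVec]; simp [Matrix.smul_mulVec]
  rw [h1, Matrix.mulVec_add, Matrix.mulVec_mulVec, connection_change F F' hX hD,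
    Matrix.add_mulVec, ← Matrix.mulVec_mulVec, hs]
  have h2 : ∑ d, X d c • F.nab d (X *ᵥ ξ) = (fun p => F'.D c ((X *ᵥ ξ) p))
      + ∑ d, X d c • (F.U d *ᵥ (X *ᵥ ξ)) := by
    funext p
    simp only [nab, hD, Finset.sum_apply, Pi.add_apply, Pi.smul_apply, smul_eq_mul, mul_add,
      Finset.sum_add_distrib]
  rw [h2]
  funext p
  simp only [Pi.add_apply, D_mulVec]
  ring

/-- The transformation law of the curvature. -/
theorem Rm_change (hX : Xᵀ * etaA A * X = etaA A)
    (hD : ∀ b f, F'.D b f = ∑ a, X a b * F.D a f) (c d : Fin 3) :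
    X * F'.Rm c d = ∑ h, ∑ k, (X h c * X k d) • (F.Rm h k * X) := by
  -- Tested on vectors, the curvature is a commutator of covariant derivatives, and `nab_change` can
  -- be applied twice.
  apply Matrix.ext_of_mulVec_single
  intro i
  generalize (Pi.single i 1 : Fin 3 → A) = ξ
  have hs : ∀ (w : Fin 3 → Fin 3 → A), (∑ h, ∑ k, w h k • (F.Rm h k * X)) *ᵥ ξ
      = ∑ h, ∑ k, w h k • (F.Rm h k *ᵥ (X *ᵥ ξ)) := by
    intro w; simp only [Matrix.sum_mulVec, Matrix.smul_mulVec, Matrix.mulVec_mulVec]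
  rw [hs, ← Matrix.mulVec_mulVec, Rm_mulVec, Matrix.mulVec_sub, Matrix.mulVec_sub]
  set ζ := X *ᵥ ξ with hζ
  have h1 : ∀ c d, X *ᵥ F'.nab c (F'.nab d ξ)
      = ∑ k, F'.D c (X k d) • F.nab k ζ
        + ∑ h, ∑ k, (X h c * X k d) • F.nab h (F.nab k ζ) := by
    intro c d
    rw [nab_change F F' hX hD, nab_change F F' hX hD, ← hζ]
    simp only [nab_sum, nab_smul, smul_add, Finset.smul_sum, Finset.sum_add_distrib, smul_smul]
    congr 1
    rw [Finset.sum_comm]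
    refine Finset.sum_congr rfl fun k _ => ?_
    rw [hD, Finset.sum_smul]
  have h2 : X *ᵥ (∑ f, (F'.U c f d - F'.U d f c) • F'.nab f ξ)
      = ∑ k, ((X * F'.U c) k d - (X * F'.U d) k c) • F.nab k ζ := by
    rw [Matrix.mulVec_sum]
    simp only [Matrix.mulVec_smul, nab_change F F' hX hD, ← hζ, Finset.smul_sum, smul_smul]
    rw [Finset.sum_comm]
    refine Finset.sum_congr rfl fun k _ => ?_
    rw [Matrix.mul_apply, Matrix.mul_apply, ← Finset.sum_sub_distrib, Finset.sum_smul]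
    exact Finset.sum_congr rfl fun f _ => by congr 1; ring
  have h3 : ∀ c d k, (X * F'.U c) k d
      = F'.D c (X k d) + ∑ h, ∑ l, X h c * X l d * F.U h k l := by
    intro c d k
    rw [connection_change F F' hX hD]
    simp only [Matrix.add_apply, Matrix.mul_apply, Matrix.sum_apply, Matrix.smul_apply,
      Matrix.map_apply, smul_eq_mul]
    rw [add_comm]
    congr 1
    simp only [Finset.sum_mul]
    rw [Finset.sum_comm]
    exact Finset.sum_congr rfl fun d _ => Finset.sum_congr rfl fun q _ => by ring
  -- The structure functions of the new frame carry the same inhomogeneous terms D'X as the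
  -- commutator of second covariant derivatives; the two cancel.
  have h4 : ∀ k, (X * F'.U c) k d - (X * F'.U d) k c = F'.D c (X k d) - F'.D d (X k c)
      + ∑ h, ∑ l, X h c * X l d * (F.U h k l - F.U l k h) := by
    intro k
    rw [h3, h3]
    have : ∑ h, ∑ l, X h d * X l c * F.U h k l = ∑ h, ∑ l, X h c * X l d * F.U l k h := by
      rw [Finset.sum_comm]
      exact Finset.sum_congr rfl fun d _ => Finset.sum_congr rfl fun q _ => by ring
    rw [this]
    simp only [mul_sub, Finset.sum_sub_distrib]; ring
  have h5 : ∑ h, ∑ k, (X h d * X k c) • F.nab h (F.nab k ζ)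
      = ∑ h, ∑ k, (X h c * X k d) • F.nab k (F.nab h ζ) := by
    rw [Finset.sum_comm]
    exact Finset.sum_congr rfl fun d _ => Finset.sum_congr rfl fun q _ => by rw [mul_comm]
  have h6 : ∑ k, (∑ h, ∑ l, X h c * X l d * (F.U h k l - F.U l k h)) • F.nab k ζ
      = ∑ h, ∑ l, (X h c * X l d) • ∑ k, (F.U h k l - F.U l k h) • F.nab k ζ := by
    simp only [Finset.sum_smul, Finset.smul_sum, smul_smul]
    rw [Finset.sum_comm]
    exact Finset.sum_congr rfl fun d _ => Finset.sum_comm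
  rw [h1, h1, h2, h5]
  simp only [h4, Rm_mulVec, add_smul, sub_smul, smul_sub, Finset.sum_add_distrib,
    Finset.sum_sub_distrib] at h6 ⊢
  rw [h6]
  abel

end Change

end FrameAlg

end Algebraic

/-! ### Covariant tensors: pullback and covariant derivative -/

section Algebraic

variable {A : Type*} [CommRing A]

/-- The pullback of a covariant tensor by a matrix. -/
def pullTensor {k : ℕ} (X : Matrix (Fin 3) (Fin 3) A) (t : TensorA A k) :
    TensorA A k :=
  fun a => ∑ b : Fin k → Fin 3, (∏ i, X (b i) (a i)) * t b

theorem sum_fin_succ_fun {α M : Type*} [Fintype α] [AddCommMonoid M] {k : ℕ}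
    (f : (Fin (k + 1) → α) → M) :
    ∑ b, f b = ∑ x, ∑ b : Fin k → α, f (Fin.cons x b) := by
  rw [← (Fin.consEquiv fun _ => α).sum_comp, Fintype.sum_prod_type]
  rfl

theorem sum_fin_succ_fun' {α M : Type*} [Fintype α] [AddCommMonoid M] {k : ℕ}
    (f : (Fin (k + 1) → α) → M) :
    ∑ b, f b = ∑ x, ∑ b : Fin k → α, f (Fin.snoc b x) := by
  rw [← (Fin.snocEquiv fun _ => α).sum_comp, Fintype.sum_prod_type]
  rfl

/-- The map (b, q) ↦ (`update b i q`, `b i`) is an involution. It transfers a connection matrix from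
the factor X in slot i to the tensor itself. -/
theorem sum_update_comm {α M : Type*} [Fintype α] [AddCommMonoid M] {k : ℕ}
    (i : Fin k) (f : (Fin k → α) → α → M) :
    ∑ b, ∑ q, f b q = ∑ b, ∑ q, f (Function.update b i q) (b i) := by
  rw [← Fintype.sum_prod_type', ← Fintype.sum_prod_type']
  refine Fintype.sum_equiv
    ⟨fun p => (Function.update p.1 i p.2, p.1 i), fun p => (Function.update p.1 i p.2, p.1 i),
      fun p => by simp, fun p => by simp⟩ _ _ ?_
  intro p; simp

/-- The index of differentiation comes last, so splitting it off exposes the sum over old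
derivatives. -/
theorem pullTensor_snoc {k : ℕ} (X : Matrix (Fin 3) (Fin 3) A) (t : TensorA A (k + 1))
    (a : Fin (k + 1) → Fin 3) :
    pullTensor X t a
      = ∑ d, X d (a (Fin.last k)) * pullTensor X (fun b => t (Fin.snoc b d)) (Fin.init a) := by
  rw [pullTensor, sum_fin_succ_fun']
  refine Finset.sum_congr rfl fun d _ => ?_
  rw [pullTensor, Finset.mul_sum]
  refine Finset.sum_congr rfl fun b _ => ?_
  rw [Fin.prod_univ_castSucc]
  simp only [Fin.snoc_castSucc, Fin.snoc_last, Fin.init]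
  ring

theorem pullTensor_sum {k : ℕ} {ι : Type*} (s : Finset ι) (X : Matrix (Fin 3) (Fin 3) A)
    (t : ι → TensorA A k) (a) :
    pullTensor X (fun b => ∑ i ∈ s, t i b) a = ∑ i ∈ s, pullTensor X (t i) a := by
  simp only [pullTensor, Finset.mul_sum]
  rw [Finset.sum_comm]

theorem pullTensor_sub {k : ℕ} (X : Matrix (Fin 3) (Fin 3) A)
    (t t' : TensorA A k) (a) :
    pullTensor X (fun b => t b - t' b) a = pullTensor X t a - pullTensor X t' a := by
  simp only [pullTensor, mul_sub, Finset.sum_sub_distrib]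

theorem pullTensor_four (X : Matrix (Fin 3) (Fin 3) A) (t : TensorA A 4) (a : Fin 4 → Fin 3) :
    pullTensor X t a = ∑ p, ∑ q, ∑ r, ∑ s,
      X p (a 0) * X q (a 1) * X r (a 2) * X s (a 3) * t ![p, q, r, s] := by
  rw [pullTensor]
  simp only [sum_fin_succ_fun, Fintype.sum_unique]
  refine Finset.sum_congr rfl fun p _ => Finset.sum_congr rfl fun q _ =>
    Finset.sum_congr rfl fun r _ => Finset.sum_congr rfl fun s _ => ?_
  rw [Fin.prod_univ_four]
  congr 1

variable [Algebra ℝ A]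

theorem derivation_prod {ι : Type*} [DecidableEq ι] (D : Derivation ℝ A A) (s : Finset ι)
    (f : ι → A) : D (∏ i ∈ s, f i) = ∑ i ∈ s, D (f i) * ∏ j ∈ s.erase i, f j := by
  induction s using Finset.induction_on with
  | empty => simp
  | insert i s hi ih =>
    rw [Finset.prod_insert hi, D.leibniz, Finset.sum_insert hi, Finset.erase_insert hi, ih]
    simp only [smul_eq_mul, Finset.mul_sum]
    rw [add_comm]
    congr 1
    · ring
    · refine Finset.sum_congr rfl fun j hj => ?_
      rw [Finset.erase_insert_of_ne (by rintro rfl; exact hi hj), Finset.prod_insert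
        (by simp [hi])]
      ring

namespace FrameAlg

variable (F F' : FrameAlg A) {X : Matrix (Fin 3) (Fin 3) A}

/-- The transformation law of the covariant derivative of tensors. -/
theorem covD_change (hX : Xᵀ * etaA A * X = etaA A)
    (hD : ∀ b f, F'.D b f = ∑ a, X a b * F.D a f) {k : ℕ} (t : TensorA A k) :
    F'.covD (pullTensor X t) = pullTensor X (F.covD t) := by
  funext a
  set c := a (Fin.last k) with hc
  set a' : Fin k → Fin 3 := Fin.init a with ha'
  -- `connection_change` solved for the derivative of X.
  have hlaw : ∀ p q, F'.D c (X p q) = ∑ r, X p r * F'.U c r q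
      - ∑ d, ∑ r, X d c * F.U d p r * X r q := by
    intro p q
    have := congrFun (congrFun (connection_change F F' hX hD c) p) q
    simp only [Matrix.add_apply, Matrix.mul_apply, Matrix.sum_apply, Matrix.smul_apply,
      Matrix.map_apply, smul_eq_mul, Finset.sum_mul] at this
    rw [this, Finset.sum_comm]
    ring
  have hfull : ∀ (i : Fin k) (b e : Fin k → Fin 3),
      ∏ j, X (b j) (e j) = X (b i) (e i) * ∏ j ∈ Finset.univ.erase i, X (b j) (e j) :=
    fun i b e => (Finset.mul_prod_erase _ _ (Finset.mem_univ i)).symm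
  -- the derivative of the pulled back tensor
  have hder : F'.D c (pullTensor X t a')
      = ∑ i, ∑ b : Fin k → Fin 3, F'.D c (X (b i) (a' i))
          * (∏ j ∈ Finset.univ.erase i, X (b j) (a' j)) * t b
        + ∑ b : Fin k → Fin 3, (∏ i, X (b i) (a' i)) * F'.D c (t b) := by
    rw [pullTensor, D_sum_mul]
    rw [Finset.sum_add_distrib]
    congr 1
    rw [Finset.sum_comm]
    refine Finset.sum_congr rfl fun b _ => ?_
    rw [derivation_prod, Finset.sum_mul]
  -- The two parts of `hlaw` give the correction terms of the new connection acting on the pulled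
  -- back tensor, and those of the old connection acting before the pullback.
  have h1 : ∀ i : Fin k, ∑ b : Fin k → Fin 3, F'.D c (X (b i) (a' i))
          * (∏ j ∈ Finset.univ.erase i, X (b j) (a' j)) * t b
      = ∑ r, F'.U c r (a' i) * pullTensor X t (Function.update a' i r)
        - ∑ d, X d c * pullTensor X
            (fun b => ∑ r, F.U d r (b i) * t (Function.update b i r)) a' := by
    intro i
    simp only [hlaw, sub_mul, Finset.sum_sub_distrib]
    congr 1
    · simp only [pullTensor, Finset.mul_sum, Finset.sum_mul]
      rw [Finset.sum_comm]
      refine Finset.sum_congr rfl fun r _ => Finset.sum_congr rfl fun b _ => ?_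
      rw [hfull i b (Function.update a' i r), Function.update_self]
      have : ∏ j ∈ Finset.univ.erase i, X (b j) (Function.update a' i r j)
          = ∏ j ∈ Finset.univ.erase i, X (b j) (a' j) :=
        Finset.prod_congr rfl fun j hj => by
          rw [Function.update_of_ne (Finset.ne_of_mem_erase hj)]
      rw [this]; ring
    · simp only [pullTensor, Finset.mul_sum, Finset.sum_mul]
      rw [Finset.sum_comm]
      refine Finset.sum_congr rfl fun d _ => ?_
      rw [sum_update_comm i]
      refine Finset.sum_congr rfl fun b _ => Finset.sum_congr rfl fun r _ => ?_
      rw [hfull i b a']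
      have : ∏ j ∈ Finset.univ.erase i, X (Function.update b i r j) (a' j)
          = ∏ j ∈ Finset.univ.erase i, X (b j) (a' j) :=
        Finset.prod_congr rfl fun j hj => by
          rw [Function.update_of_ne (Finset.ne_of_mem_erase hj)]
      rw [this, Function.update_self]; ring
  have h2 : ∑ b : Fin k → Fin 3, (∏ i, X (b i) (a' i)) * F'.D c (t b)
      = ∑ d, X d c * pullTensor X (fun b => F.D d (t b)) a' := by
    simp only [hD, pullTensor, Finset.mul_sum]
    rw [Finset.sum_comm]
    exact Finset.sum_congr rfl fun r _ => Finset.sum_congr rfl fun b _ => by ring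
  have h3 : pullTensor X (F.covD t) a
      = ∑ d, X d c * pullTensor X (fun b => F.D d (t b)) a'
        - ∑ i, ∑ d, X d c * pullTensor X
            (fun b => ∑ r, F.U d r (b i) * t (Function.update b i r)) a' := by
    rw [pullTensor_snoc, Finset.sum_comm, ← Finset.sum_sub_distrib]
    refine Finset.sum_congr rfl fun d _ => ?_
    rw [← Finset.mul_sum, ← mul_sub, ← pullTensor_sum, ← pullTensor_sub]
    congr 1
    congr 1
    funext b
    simp only [covD, Fin.init_snoc, Fin.snoc_last, Fin.snoc_castSucc]
  have h4 : F'.covD (pullTensor X t) a = F'.D c (pullTensor X t a')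
      - ∑ i, ∑ r, F'.U c r (a' i) * pullTensor X t (Function.update a' i r) := rfl
  rw [h4, hder, h2, h3]
  simp only [h1, Finset.sum_sub_distrib]
  ring

/-- The transformation law of the Riemann tensor. -/
theorem riemL_change (hX : Xᵀ * etaA A * X = etaA A)
    (hD : ∀ b f, F'.D b f = ∑ a, X a b * F.D a f) :
    F'.riemL = pullTensor X F.riemL := by
  funext a
  have h1 : etaA A * F'.Rm (a 2) (a 3)
      = ∑ h, ∑ k, (X h (a 2) * X k (a 3)) • (Xᵀ * (etaA A * F.Rm h k) * X) := by
    conv_lhs => rw [← hX]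
    rw [Matrix.mul_assoc, Rm_change F F' hX hD]
    simp only [Matrix.mul_sum, Matrix.mul_smul, Matrix.mul_assoc]
  rw [riemL, h1, pullTensor_four]
  simp only [riemL, Matrix.sum_apply, Matrix.smul_apply, smul_eq_mul]
  have h2 : ∀ (N : Matrix (Fin 3) (Fin 3) A) i j,
      (Xᵀ * N * X) i j = ∑ p, ∑ q, X p i * X q j * N p q := by
    intro N i j
    simp only [Matrix.mul_apply, Matrix.transpose_apply, Finset.sum_mul]
    rw [Finset.sum_comm]
    exact Finset.sum_congr rfl fun p _ => Finset.sum_congr rfl fun q _ => by ring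
  simp only [h2, Finset.mul_sum]
  calc _ = ∑ h, ∑ p, ∑ k, ∑ q, X h (a 2) * X k (a 3) *
          (X p (a 0) * X q (a 1) * (etaA A * F.Rm h k) p q) :=
        Finset.sum_congr rfl fun h _ => Finset.sum_comm
    _ = ∑ p, ∑ h, ∑ q, ∑ k, X h (a 2) * X k (a 3) *
          (X p (a 0) * X q (a 1) * (etaA A * F.Rm h k) p q) := by
        rw [Finset.sum_comm]
        exact Finset.sum_congr rfl fun h _ => Finset.sum_congr rfl fun p _ => Finset.sum_comm
    _ = ∑ p, ∑ q, ∑ h, ∑ k, X h (a 2) * X k (a 3) *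
          (X p (a 0) * X q (a 1) * (etaA A * F.Rm h k) p q) :=
        Finset.sum_congr rfl fun h _ => Finset.sum_comm
    _ = _ := by
        refine Finset.sum_congr rfl fun p _ => Finset.sum_congr rfl fun q _ =>
          Finset.sum_congr rfl fun r _ => Finset.sum_congr rfl fun s _ => ?_
        simp only [Matrix.cons_val]
        ring

theorem nabla_change (hX : Xᵀ * etaA A * X = etaA A)
    (hD : ∀ b f, F'.D b f = ∑ a, X a b * F.D a f) (j : ℕ) :
    F'.nabla j = pullTensor X (F.nabla j) := by
  induction j with
  | zero => exact riemL_change F F' hX hD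
  | succ j ih =>
    change F'.covD (F'.nabla j) = pullTensor X (F.covD (F.nabla j))
    rw [ih, covD_change F F' hX hD]

end FrameAlg

end Algebraic

/-! ### Smooth functions and vector fields on open sets -/

section Analysis

variable {M : Type*} [TopologicalSpace M] [ChartedSpace E3 M] [IsManifold 𝓘(ℝ, E3) ∞ M]

theorem contMDiffOn_dirDeriv {W : Set M} (hW : IsOpen W)
    {v : (x : M) → TangentSpace 𝓘(ℝ, E3) x}
    (hv : ContMDiffOn 𝓘(ℝ, E3) 𝓘(ℝ, E3).tangent ∞
      (fun x => (⟨x, v x⟩ : TangentBundle 𝓘(ℝ, E3) M)) W)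
    {f : M → ℝ} (hf : ContMDiffOn 𝓘(ℝ, E3) 𝓘(ℝ, ℝ) ∞ f W) :
    ContMDiffOn 𝓘(ℝ, E3) 𝓘(ℝ, ℝ) ∞ (dirDeriv v f) W := by
  have h1 := hf.contMDiffOn_tangentMapWithin (m := ∞) (by simp) hW.uniqueMDiffOn
  have h2 := h1.comp hv (fun x hx => hx)
  have h3 := (contMDiff_snd_tangentBundle_modelSpace ℝ 𝓘(ℝ, ℝ) (n := ∞)).comp_contMDiffOn h2
  refine h3.congr fun x hx => ?_
  simp only [Function.comp, tangentMapWithin, dirDeriv, mfderivWithin_of_isOpen hW hx]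
  rfl

theorem fderiv_comp_extChartAt_symm_apply (x : M)
    {h : M → ℝ} {y : E3} (hy : y ∈ (extChartAt 𝓘(ℝ, E3) x).target)
    (hh : MDifferentiableAt 𝓘(ℝ, E3) 𝓘(ℝ, ℝ) h ((extChartAt 𝓘(ℝ, E3) x).symm y)) (ξ : E3) :
    fderiv ℝ (h ∘ (extChartAt 𝓘(ℝ, E3) x).symm) y ξ
      = mfderiv 𝓘(ℝ, E3) 𝓘(ℝ, ℝ) h ((extChartAt 𝓘(ℝ, E3) x).symm y)
        (mfderivWithin 𝓘(ℝ, E3) 𝓘(ℝ, E3) (extChartAt 𝓘(ℝ, E3) x).symm (Set.range 𝓘(ℝ, E3)) y ξ)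
      := by
  have hd := mdifferentiableWithinAt_extChartAt_symm (I := 𝓘(ℝ, E3)) hy
  rw [← mfderiv_eq_fderiv]
  simp only [modelWithCornersSelf_coe, Set.range_id, mfderivWithin_univ,
    mdifferentiableWithinAt_univ] at hd ⊢
  rw [mfderiv_comp y hh hd]
  rfl

/-- The pullback of a field to the chart applies the inverse of the derivative of φ⁻¹, which cancels
against the chain rule. -/
theorem fderiv_comp_extChartAt_symm (x : M) (v : (x : M) → TangentSpace 𝓘(ℝ, E3) x)
    {h : M → ℝ} {y : E3} (hy : y ∈ (extChartAt 𝓘(ℝ, E3) x).target)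
    (hh : MDifferentiableAt 𝓘(ℝ, E3) 𝓘(ℝ, ℝ) h ((extChartAt 𝓘(ℝ, E3) x).symm y)) :
    fderiv ℝ (h ∘ (extChartAt 𝓘(ℝ, E3) x).symm) y
      (VectorField.mpullbackWithin 𝓘(ℝ, E3) 𝓘(ℝ, E3) (extChartAt 𝓘(ℝ, E3) x).symm v
        (Set.range 𝓘(ℝ, E3)) y)
      = dirDeriv v h ((extChartAt 𝓘(ℝ, E3) x).symm y) := by
  refine (fderiv_comp_extChartAt_symm_apply x hy hh _).trans ?_
  rw [VectorField.mpullbackWithin_apply]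
  obtain ⟨L, hL⟩ := isInvertible_mfderivWithin_extChartAt_symm (I := 𝓘(ℝ, E3)) hy
  rw [← hL, ContinuousLinearMap.inverse_equiv]
  exact congrArg (mfderiv 𝓘(ℝ, E3) 𝓘(ℝ, ℝ) h ((extChartAt 𝓘(ℝ, E3) x).symm y))
    (L.apply_symm_apply _)

/-- `mlieBracket` is a bracket taken in the chart and carried back by the inverse derivative of the
chart. This evaluates df on such a vector. -/
theorem mfderiv_inverse_extChartAt (x : M) {h : M → ℝ} (ξ : E3)
    (hh : MDifferentiableAt 𝓘(ℝ, E3) 𝓘(ℝ, ℝ) h x) :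
    mfderiv 𝓘(ℝ, E3) 𝓘(ℝ, ℝ) h x
      ((mfderiv 𝓘(ℝ, E3) 𝓘(ℝ, E3) (extChartAt 𝓘(ℝ, E3) x) x).inverse ξ)
      = fderiv ℝ (h ∘ (extChartAt 𝓘(ℝ, E3) x).symm) (extChartAt 𝓘(ℝ, E3) x x) ξ := by
  have hxx := extChartAt_to_inv (I := 𝓘(ℝ, E3)) x
  rw [fderiv_comp_extChartAt_symm_apply x (mem_extChartAt_target x) (by rw [hxx]; exact hh)]
  have h3 := mfderivWithin_extChartAt_symm_comp_mfderiv_extChartAt' (I := 𝓘(ℝ, E3))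
      (mem_extChartAt_source (I := 𝓘(ℝ, E3)) x)
  obtain ⟨L, hL⟩ := isInvertible_mfderiv_extChartAt (I := 𝓘(ℝ, E3))
    (mem_extChartAt_source (I := 𝓘(ℝ, E3)) x)
  rw [← hL] at h3 ⊢
  rw [ContinuousLinearMap.inverse_equiv]
  have h4 : ∀ ζ, mfderivWithin 𝓘(ℝ, E3) 𝓘(ℝ, E3) (extChartAt 𝓘(ℝ, E3) x).symm
      (Set.range 𝓘(ℝ, E3)) (extChartAt 𝓘(ℝ, E3) x x) (L ζ) = ζ := fun ζ =>
    congrArg (fun (T : E3 →L[ℝ] E3) => T ζ) h3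
  have h5 := h4 (L.symm ξ)
  have h6 : L (L.symm ξ) = ξ := L.apply_symm_apply ξ
  rw [h6] at h5
  let G : M → (E3 →L[ℝ] ℝ) := fun z => mfderiv 𝓘(ℝ, E3) 𝓘(ℝ, ℝ) h z
  have h8 := congrArg (fun T : E3 →L[ℝ] ℝ => T (L.symm ξ)) (congrArg G hxx.symm)
  refine h8.trans ?_
  exact congrArg (G ((extChartAt 𝓘(ℝ, E3) x).symm (extChartAt 𝓘(ℝ, E3) x x))) h5.symm

/-- The derivative along a Lie bracket is the commutator of the derivatives. -/
theorem dirDeriv_mlieBracket {W : Set M} (hW : IsOpen W)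
    {v w : (x : M) → TangentSpace 𝓘(ℝ, E3) x}
    (hv : ContMDiffOn 𝓘(ℝ, E3) 𝓘(ℝ, E3).tangent ∞
      (fun x => (⟨x, v x⟩ : TangentBundle 𝓘(ℝ, E3) M)) W)
    (hw : ContMDiffOn 𝓘(ℝ, E3) 𝓘(ℝ, E3).tangent ∞
      (fun x => (⟨x, w x⟩ : TangentBundle 𝓘(ℝ, E3) M)) W)
    {f : M → ℝ} (hf : ContMDiffOn 𝓘(ℝ, E3) 𝓘(ℝ, ℝ) ∞ f W) {x : M} (hx : x ∈ W) :
    dirDeriv (VectorField.mlieBracket 𝓘(ℝ, E3) v w) f x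
      = dirDeriv v (dirDeriv w f) x - dirDeriv w (dirDeriv v f) x := by
  set φ := extChartAt 𝓘(ℝ, E3) x with hφ
  have : IsManifold 𝓘(ℝ, E3) 2 M := .of_le (n := ∞) (by norm_cast)
  have hdiff : ∀ {h : M → ℝ}, ContMDiffOn 𝓘(ℝ, E3) 𝓘(ℝ, ℝ) ∞ h W → ∀ y ∈ W,
      MDifferentiableAt 𝓘(ℝ, E3) 𝓘(ℝ, ℝ) h y := fun hh y hy =>
    ((hh y hy).contMDiffAt (hW.mem_nhds hy)).mdifferentiableAt (by simp)
  have hVd : ∀ {u : (x : M) → TangentSpace 𝓘(ℝ, E3) x},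
      ContMDiffOn 𝓘(ℝ, E3) 𝓘(ℝ, E3).tangent ∞
      (fun x => (⟨x, u x⟩ : TangentBundle 𝓘(ℝ, E3) M)) W →
      DifferentiableAt ℝ (VectorField.mpullbackWithin 𝓘(ℝ, E3) 𝓘(ℝ, E3) φ.symm u
        (Set.range 𝓘(ℝ, E3))) (φ x) := by
    intro u hu
    have h0 : MDifferentiableWithinAt 𝓘(ℝ, E3) 𝓘(ℝ, E3).tangent
        (fun x => (⟨x, u x⟩ : TangentBundle 𝓘(ℝ, E3) M)) Set.univ x :=
      (((hu x hx).contMDiffAt (hW.mem_nhds hx)).mdifferentiableAt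
        (by simp)).mdifferentiableWithinAt
    have := h0.differentiableWithinAt_mpullbackWithin_vectorField
    rw [modelWithCornersSelf_coe, Set.range_id, Set.preimage_univ, Set.univ_inter] at this
    rw [modelWithCornersSelf_coe, Set.range_id]
    exact differentiableWithinAt_univ.1 this
  have hU : φ.target ∩ φ.symm ⁻¹' W ∈ nhds (φ x) := by
    refine (((continuousOn_extChartAt_symm x).isOpen_inter_preimage
      (isOpen_extChartAt_target x) hW)).mem_nhds ⟨mem_extChartAt_target x, ?_⟩
    simpa [hφ] using hx
  -- An identity on a neighbourhood is needed, because the derivative along u is differentiated once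
  -- more.
  have hev : ∀ {u : (x : M) → TangentSpace 𝓘(ℝ, E3) x},
      (fun y => fderiv ℝ (f ∘ φ.symm) y (VectorField.mpullbackWithin 𝓘(ℝ, E3) 𝓘(ℝ, E3) φ.symm u
        (Set.range 𝓘(ℝ, E3)) y)) =ᶠ[nhds (φ x)] (dirDeriv u f ∘ φ.symm) := by
    intro u
    filter_upwards [hU] with y hy
    exact fderiv_comp_extChartAt_symm x u hy.1 (hdiff hf _ hy.2)
  have hxx : φ.symm (φ x) = x := extChartAt_to_inv x
  have hfin : ∀ {u : (x : M) → TangentSpace 𝓘(ℝ, E3) x} {h : M → ℝ},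
      ContMDiffOn 𝓘(ℝ, E3) 𝓘(ℝ, ℝ) ∞ h W →
      fderiv ℝ (h ∘ φ.symm) (φ x) (VectorField.mpullbackWithin 𝓘(ℝ, E3) 𝓘(ℝ, E3) φ.symm u
        (Set.range 𝓘(ℝ, E3)) (φ x)) = dirDeriv u h x := by
    intro u h hh
    rw [fderiv_comp_extChartAt_symm x u (mem_extChartAt_target x)
      (by rw [← hφ, hxx]; exact hdiff hh _ hx), ← hφ, hxx]
  have hf2 : ContDiffAt ℝ 2 (f ∘ φ.symm) (φ x) := by
    have h1 : ContMDiffAt 𝓘(ℝ, E3) 𝓘(ℝ, E3) 2 φ.symm (φ x) := by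
      have := contMDiffOn_extChartAt_symm (I := 𝓘(ℝ, E3)) (n := 2) x
      exact (this _ (mem_extChartAt_target x)).contMDiffAt
        ((isOpen_extChartAt_target x).mem_nhds (mem_extChartAt_target x))
    have h2 : ContMDiffAt 𝓘(ℝ, E3) 𝓘(ℝ, ℝ) 2 f (φ.symm (φ x)) := by
      rw [hxx]
      exact ((hf x hx).contMDiffAt (hW.mem_nhds hx)).of_le (by norm_cast)
    exact (h2.comp _ h1).contDiffAt
  have hLHS : dirDeriv (VectorField.mlieBracket 𝓘(ℝ, E3) v w) f x
      = fderiv ℝ (f ∘ φ.symm) (φ x) (VectorField.lieBracket ℝ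
        (VectorField.mpullbackWithin 𝓘(ℝ, E3) 𝓘(ℝ, E3) φ.symm v (Set.range 𝓘(ℝ, E3)))
        (VectorField.mpullbackWithin 𝓘(ℝ, E3) 𝓘(ℝ, E3) φ.symm w (Set.range 𝓘(ℝ, E3))) (φ x)) := by
    rw [← mfderiv_inverse_extChartAt x _ (hdiff hf x hx)]
    have hlb : ∀ (p q : E3 → E3) (s : Set E3), s = Set.univ →
        VectorField.lieBracketWithin ℝ p q s (φ x) = VectorField.lieBracket ℝ p q (φ x) := by
      rintro p q s rfl
      rw [VectorField.lieBracketWithin_univ]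
    exact congrArg (fun ζ : E3 => mfderiv 𝓘(ℝ, E3) 𝓘(ℝ, ℝ) f x
      ((mfderiv 𝓘(ℝ, E3) 𝓘(ℝ, E3) φ x).inverse ζ))
      (hlb _ _ ((extChartAt 𝓘(ℝ, E3) x).symm ⁻¹' Set.univ ∩ Set.range 𝓘(ℝ, E3)) (by simp))
  rw [hLHS, VectorField.fderiv_apply_lieBracket hf2 (by simp) (hVd hw) (hVd hv),
    hev.fderiv_eq, hev.fderiv_eq, hfin (contMDiffOn_dirDeriv hW hw hf),
    hfin (contMDiffOn_dirDeriv hW hv hf)]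

end Analysis

/-! ### The algebra of smooth functions on an open set -/

section SmoothAlgebra

variable {M : Type*} [TopologicalSpace M] [ChartedSpace E3 M]

/-- The extension by zero of a function on a subset. -/
def extZero {W : Set M} (f : W → ℝ) : M → ℝ := Function.extend Subtype.val f 0

theorem extZero_apply {W : Set M} (f : W → ℝ) {x : M} (hx : x ∈ W) : extZero f x = f ⟨x, hx⟩ :=
  Subtype.val_injective.extend_apply f 0 ⟨x, hx⟩

theorem eqOn_extZero {W : Set M} {f : W → ℝ} {h : M → ℝ} (hh : ∀ x : W, f x = h x) :
    Set.EqOn (extZero f) h W := fun x hx => (extZero_apply f hx).trans (hh ⟨x, hx⟩)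

/-- The algebra of smooth functions on `W`. -/
def smoothFun (W : Set M) : Subalgebra ℝ (W → ℝ) where
  carrier := {f | ContMDiffOn 𝓘(ℝ, E3) 𝓘(ℝ, ℝ) ∞ (extZero f) W}
  mul_mem' {f h} hf hh := (hf.mul hh).congr fun x hx => by
    simp [extZero_apply _ hx]
  add_mem' {f h} hf hh := (hf.add hh).congr fun x hx => by
    simp [extZero_apply _ hx]
  algebraMap_mem' r := (contMDiffOn_const (c := r)).congr fun x hx => by
    rw [extZero_apply _ hx]; rfl

/-- The restriction to `W` of a function that is smooth on `W`. -/
def toSmoothFun {W : Set M} (f : M → ℝ) (hf : ContMDiffOn 𝓘(ℝ, E3) 𝓘(ℝ, ℝ) ∞ f W) :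
    smoothFun W :=
  ⟨fun x => f x, hf.congr fun _ hx => extZero_apply _ hx⟩

@[simp] theorem toSmoothFun_apply {W : Set M} (f : M → ℝ)
    (hf : ContMDiffOn 𝓘(ℝ, E3) 𝓘(ℝ, ℝ) ∞ f W) (x : W) : (toSmoothFun f hf).1 x = f x := rfl

theorem smoothFun_ext {W : Set M} {f h : smoothFun W} (H : ∀ x : W, f.1 x = h.1 x) : f = h :=
  Subtype.ext (funext H)

theorem dirDeriv_congr {W : Set M} (hW : IsOpen W) (v : (x : M) → TangentSpace 𝓘(ℝ, E3) x)
    {f h : M → ℝ} (H : Set.EqOn f h W) {x : M} (hx : x ∈ W) :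
    dirDeriv v f x = dirDeriv v h x := by
  have : f =ᶠ[nhds x] h := Filter.eventuallyEq_of_mem (hW.mem_nhds hx) H
  rw [dirDeriv, dirDeriv, this.mfderiv_eq]
  rfl

theorem smoothFun_mdifferentiableAt {W : Set M} (hW : IsOpen W) {f : M → ℝ}
    (hf : ContMDiffOn 𝓘(ℝ, E3) 𝓘(ℝ, ℝ) ∞ f W) {x : M} (hx : x ∈ W) :
    MDifferentiableAt 𝓘(ℝ, E3) 𝓘(ℝ, ℝ) f x :=
  ((hf x hx).contMDiffAt (hW.mem_nhds hx)).mdifferentiableAt (by simp)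

/-- The smooth function, as an element of an algebra, with given values. -/
theorem smoothFun_smooth {W : Set M} (f : smoothFun W) :
    ContMDiffOn 𝓘(ℝ, E3) 𝓘(ℝ, ℝ) ∞ (extZero f.1) W := f.2

variable [IsManifold 𝓘(ℝ, E3) ∞ M]

theorem dirDeriv_mul {W : Set M} (hW : IsOpen W) (v : (x : M) → TangentSpace 𝓘(ℝ, E3) x)
    {f h : M → ℝ} (hf : ContMDiffOn 𝓘(ℝ, E3) 𝓘(ℝ, ℝ) ∞ f W)
    (hh : ContMDiffOn 𝓘(ℝ, E3) 𝓘(ℝ, ℝ) ∞ h W) {x : M} (hx : x ∈ W) :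
    dirDeriv v (f * h) x = f x * dirDeriv v h x + h x * dirDeriv v f x := by
  have := ((smoothFun_mdifferentiableAt hW hf hx).hasMFDerivAt.mul
    (smoothFun_mdifferentiableAt hW hh hx).hasMFDerivAt).mfderiv
  rw [dirDeriv, this]
  rfl

theorem dirDeriv_add {W : Set M} (hW : IsOpen W) (v : (x : M) → TangentSpace 𝓘(ℝ, E3) x)
    {f h : M → ℝ} (hf : ContMDiffOn 𝓘(ℝ, E3) 𝓘(ℝ, ℝ) ∞ f W)
    (hh : ContMDiffOn 𝓘(ℝ, E3) 𝓘(ℝ, ℝ) ∞ h W) {x : M} (hx : x ∈ W) :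
    dirDeriv v (f + h) x = dirDeriv v f x + dirDeriv v h x := by
  have := ((smoothFun_mdifferentiableAt hW hf hx).hasMFDerivAt.add
    (smoothFun_mdifferentiableAt hW hh hx).hasMFDerivAt).mfderiv
  rw [dirDeriv, this]
  rfl

theorem dirDeriv_const (v : (x : M) → TangentSpace 𝓘(ℝ, E3) x) (r : ℝ) (x : M) :
    dirDeriv v (fun _ => r) x = 0 := by
  rw [dirDeriv, mfderiv_const]; rfl

/-- The derivation of the algebra of smooth functions defined by a smooth vector field. -/
def fieldDerivation {W : Set M} (hW : IsOpen W) (v : (x : M) → TangentSpace 𝓘(ℝ, E3) x)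
    (hv : ContMDiffOn 𝓘(ℝ, E3) 𝓘(ℝ, E3).tangent ∞
      (fun x => (⟨x, v x⟩ : TangentBundle 𝓘(ℝ, E3) M)) W) :
    Derivation ℝ (smoothFun W) (smoothFun W) :=
  Derivation.mk'
    { toFun := fun f => toSmoothFun (dirDeriv v (extZero f.1)) (contMDiffOn_dirDeriv hW hv f.2)
      map_add' := fun f h => smoothFun_ext fun x => by
        have e : Set.EqOn (extZero (f + h).1) (extZero f.1 + extZero h.1) W :=
          eqOn_extZero fun x => by simp [extZero_apply _ x.2]
        rw [toSmoothFun_apply, dirDeriv_congr hW v e x.2, dirDeriv_add hW v f.2 h.2 x.2]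
        rfl
      map_smul' := fun r f => smoothFun_ext fun x => by
        have e : Set.EqOn (extZero (r • f).1) ((fun _ => r) * extZero f.1) W :=
          eqOn_extZero fun x => by simp [extZero_apply _ x.2]
        rw [toSmoothFun_apply, dirDeriv_congr hW v e x.2,
          dirDeriv_mul hW v contMDiffOn_const f.2 x.2, dirDeriv_const]
        simp }
    fun f h => smoothFun_ext fun x => by
      have e : Set.EqOn (extZero (f * h).1) (extZero f.1 * extZero h.1) W :=
        eqOn_extZero fun x => by simp [extZero_apply _ x.2]
      simp only [LinearMap.coe_mk, AddHom.coe_mk]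
      rw [toSmoothFun_apply, dirDeriv_congr hW v e x.2, dirDeriv_mul hW v f.2 h.2 x.2]
      simp [extZero_apply _ x.2]

theorem fieldDerivation_apply {W : Set M} (hW : IsOpen W)
    {v : (x : M) → TangentSpace 𝓘(ℝ, E3) x}
    (hv : ContMDiffOn 𝓘(ℝ, E3) 𝓘(ℝ, E3).tangent ∞
      (fun x => (⟨x, v x⟩ : TangentBundle 𝓘(ℝ, E3) M)) W) (f : smoothFun W) {h : M → ℝ}
    (hf : ∀ x : W, f.1 x = h x) (x : W) :
    (fieldDerivation hW v hv f).1 x = dirDeriv v h x :=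
  dirDeriv_congr hW v (eqOn_extZero hf) x.2

end SmoothAlgebra

/-! ### Connection components and expansions in a null frame -/

section Geometry

variable {M : Type*} [TopologicalSpace M] [ChartedSpace E3 M] [IsManifold 𝓘(ℝ, E3) ∞ M]

theorem LorentzMetric.contMDiffOn_apply (g : LorentzMetric M) {W : Set M}
    {v w : (x : M) → TangentSpace 𝓘(ℝ, E3) x}
    (hv : ContMDiffOn 𝓘(ℝ, E3) 𝓘(ℝ, E3).tangent ∞
      (fun x => (⟨x, v x⟩ : TangentBundle 𝓘(ℝ, E3) M)) W)
    (hw : ContMDiffOn 𝓘(ℝ, E3) 𝓘(ℝ, E3).tangent ∞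
      (fun x => (⟨x, w x⟩ : TangentBundle 𝓘(ℝ, E3) M)) W) :
    ContMDiffOn 𝓘(ℝ, E3) 𝓘(ℝ, ℝ) ∞ (fun x => g.val x (v x) (w x)) W := by
  intro x hx
  have : ContMDiffWithinAt 𝓘(ℝ, E3) (𝓘(ℝ, E3).prod 𝓘(ℝ, ℝ)) ∞
      (fun m => TotalSpace.mk' ℝ (E := Bundle.Trivial M ℝ) m (g.val m (v m) (w m))) W x := by
    apply ContMDiffWithinAt.clm_bundle_apply₂ (F₁ := E3) (F₂ := E3)
    · exact g.contMDiff.contMDiffAt.contMDiffWithinAt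
    · exact hv x hx
    · exact hw x hx
  simp only [contMDiffWithinAt_totalSpace] at this
  exact this.2

theorem contMDiffOn_mlieBracket {W : Set M} (hW : IsOpen W)
    {v w : (x : M) → TangentSpace 𝓘(ℝ, E3) x}
    (hv : ContMDiffOn 𝓘(ℝ, E3) 𝓘(ℝ, E3).tangent ∞
      (fun x => (⟨x, v x⟩ : TangentBundle 𝓘(ℝ, E3) M)) W)
    (hw : ContMDiffOn 𝓘(ℝ, E3) 𝓘(ℝ, E3).tangent ∞
      (fun x => (⟨x, w x⟩ : TangentBundle 𝓘(ℝ, E3) M)) W) :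
    ContMDiffOn 𝓘(ℝ, E3) 𝓘(ℝ, E3).tangent ∞
      (fun x => (⟨x, VectorField.mlieBracket 𝓘(ℝ, E3) v w x⟩ : TangentBundle 𝓘(ℝ, E3) M)) W := by
  have : IsManifold 𝓘(ℝ, E3) (minSmoothness ℝ 3) M := .of_le (n := ∞) (by simp; norm_cast)
  have : IsManifold 𝓘(ℝ, E3) ((⊤ : ℕ∞) + 1) M := .of_le (n := ∞) (by simp)
  intro x hx
  exact (((hv x hx).contMDiffAt (hW.mem_nhds hx)).mlieBracket_vectorField (m := ⊤) (n := ⊤)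
    ((hw x hx).contMDiffAt (hW.mem_nhds hx)) (by simp)).contMDiffWithinAt

variable {g : LorentzMetric M} {U : Set M} {e : Triad M}

theorem IsNullFrame.mono (h : IsNullFrame g U e) {W : Set M} (hW : IsOpen W) (hWU : W ⊆ U) :
    IsNullFrame g W e :=
  ⟨hW, fun a => (h.smooth a).mono hWU, fun x hx => h.orthonormal x (hWU hx)⟩

theorem IsNullFrame.contMDiffOn_brk (h : IsNullFrame g U e) (a b c : Fin 3) :
    ContMDiffOn 𝓘(ℝ, E3) 𝓘(ℝ, ℝ) ∞ (brk g e a b c) U :=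
  g.contMDiffOn_apply (contMDiffOn_mlieBracket h.isOpen (h.smooth a) (h.smooth b)) (h.smooth c)

theorem IsNullFrame.contMDiffOn_conn (h : IsNullFrame g U e) (a b c : Fin 3) :
    ContMDiffOn 𝓘(ℝ, E3) 𝓘(ℝ, ℝ) ∞ (conn g e a b c) U := by
  have := ((((h.contMDiffOn_brk c b a).sub (h.contMDiffOn_brk c a b)).sub
    (h.contMDiffOn_brk b a c)).mul (contMDiffOn_const (c := (2 : ℝ)⁻¹)))
  exact this.congr fun x _ => by simp [conn, div_eq_mul_inv]

theorem IsNullFrame.contMDiffOn_connUp (h : IsNullFrame g U e) (a b c : Fin 3) :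
    ContMDiffOn 𝓘(ℝ, E3) 𝓘(ℝ, ℝ) ∞ (connUp g e a b c) U := by
  have := contMDiffOn_finsetSum (t := Finset.univ) (f := fun f x => etaInv a f * conn g e f b c x)
    (fun f _ => (contMDiffOn_const (c := etaInv a f)).mul (h.contMDiffOn_conn f b c))
  exact this

/-- Metricity: the inner products of the frame are constant, so the Koszul formula contains only
brackets, and their antisymmetry suffices. -/
theorem conn_antisymm (g : LorentzMetric M) (e : Triad M) (a b c : Fin 3) (x : M) :
    conn g e a b c x = -conn g e b a c x := by
  have : brk g e b a c x = -brk g e a b c x := by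
    simp only [brk, VectorField.mlieBracket_swap_apply (V := e b), map_neg,
      neg_apply]
  simp only [conn]
  rw [this]; ring

/-- Vanishing torsion, in lowered indices. -/
theorem conn_sub_conn (g : LorentzMetric M) (e : Triad M) (a b c : Fin 3) (x : M) :
    conn g e a b c x - conn g e a c b x = brk g e c b a x := by
  have : ∀ a b c, brk g e b a c x = -brk g e a b c x := by
    intro a b c
    simp only [brk, VectorField.mlieBracket_swap_apply (V := e b), map_neg,
      neg_apply]
  simp only [conn]
  rw [this c b a]; ring

theorem IsNullFrame.eq_zero_of_sum (h : IsNullFrame g U e) {x : M} (hx : x ∈ U) {c : Fin 3 → ℝ}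
    (hc : ∑ k, c k • e k x = 0) : c = 0 := by
  have h1 : ∀ l, ∑ k, c k * eta k l = 0 := by
    intro l
    have := congrArg (fun v => g.val x v (e l x)) hc
    simpa [map_sum, h.orthonormal x hx] using this
  have h2 := h1 0
  have h3 := h1 1
  have h4 := h1 2
  simp [Fin.sum_univ_three, eta] at h2 h3 h4
  funext i; fin_cases i <;> simp [h2, h3, h4]

/-- The expansion of a tangent vector in a null frame. -/
theorem IsNullFrame.expand (h : IsNullFrame g U e) {x : M} (hx : x ∈ U)
    (v : TangentSpace 𝓘(ℝ, E3) x) :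
    v = ∑ k, (∑ l, etaInv k l * g.val x v (e l x)) • e k x := by
  have hli : LinearIndependent ℝ fun k => e k x := by
    rw [Fintype.linearIndependent_iff]
    intro c hc
    exact congrFun (h.eq_zero_of_sum hx hc)
  have : FiniteDimensional ℝ (TangentSpace 𝓘(ℝ, E3) x) :=
    inferInstanceAs (FiniteDimensional ℝ E3)
  have hcard : Fintype.card (Fin 3) = Module.finrank ℝ (TangentSpace 𝓘(ℝ, E3) x) :=
    (finrank_euclideanSpace_fin (𝕜 := ℝ) (n := 3)).symm ▸ Fintype.card_fin 3
  have hspan := hli.span_eq_top_of_card_eq_finrank' hcard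
  have hv : v ∈ Submodule.span ℝ (Set.range fun k => e k x) := by rw [hspan]; trivial
  obtain ⟨c, hc⟩ := (Submodule.mem_span_range_iff_exists_fun ℝ).1 hv
  have h1 : ∀ l, g.val x v (e l x) = ∑ k, c k * eta k l := by
    intro l
    rw [← hc]
    simp [map_sum, h.orthonormal x hx]
  have : ∀ k, ∑ l, etaInv k l * g.val x v (e l x) = c k := by
    intro k
    simp only [h1, Fin.sum_univ_three]
    fin_cases k <;> simp [eta, etaInv]
    ring
  simp only [this, hc]

end Geometry

/-! ### Null frames as algebraic frames -/

section Geometry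

variable {M : Type*} [TopologicalSpace M] [ChartedSpace E3 M] 

/-- Evaluation of smooth functions at a point. -/
def evalAt {W : Set M} (x : W) : smoothFun W →ₐ[ℝ] ℝ :=
  (Pi.evalAlgHom ℝ (fun _ : W => ℝ) x).comp (smoothFun W).val

theorem evalAt_apply {W : Set M} (x : W) (f : smoothFun W) : evalAt x f = f.1 x := rfl

theorem evalAt_algebraMap {W : Set M} (x : W) (r : ℝ) :
    evalAt x (algebraMap ℝ (smoothFun W) r) = r := (evalAt x).commutes r

theorem eq_of_evalAt {W : Set M} {f h : smoothFun W} (H : ∀ x : W, evalAt x f = evalAt x h) :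
    f = h := smoothFun_ext H

variable [IsManifold 𝓘(ℝ, E3) ∞ M]

/-- Coordinate functions separate tangent vectors. They are available as smooth functions on W
because W lies in one chart domain; this is why algebraic frames are built only on such sets. -/
theorem eq_zero_of_dirDeriv_eq_zero {W : Set M} (hW : IsOpen W) {x₀ : M}
    (hs : W ⊆ (chartAt E3 x₀).source) {x : M} (hx : x ∈ W) (v : TangentSpace 𝓘(ℝ, E3) x)
    (hv : ∀ f : M → ℝ, ContMDiffOn 𝓘(ℝ, E3) 𝓘(ℝ, ℝ) ∞ f W → mfderiv 𝓘(ℝ, E3) 𝓘(ℝ, ℝ) f x v = 0) :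
    v = 0 := by
  set φ := extChartAt 𝓘(ℝ, E3) x₀ with hφ
  have hφs : ContMDiffOn 𝓘(ℝ, E3) 𝓘(ℝ, E3) ∞ φ W := (contMDiffOn_extChartAt (x := x₀)).mono hs
  have hxs : x ∈ φ.source := by rw [hφ, extChartAt_source]; exact hs hx
  obtain ⟨L, hL⟩ := isInvertible_mfderiv_extChartAt (I := 𝓘(ℝ, E3)) hxs
  have hd : MDifferentiableAt 𝓘(ℝ, E3) 𝓘(ℝ, E3) φ x :=
    ((hφs x hx).contMDiffAt (hW.mem_nhds hx)).mdifferentiableAt (by simp)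
  have h0 : (L v : E3) = 0 := by
    refine PiLp.ext fun i => ?_
    have hp : ContMDiff 𝓘(ℝ, E3) 𝓘(ℝ, ℝ) ∞ (EuclideanSpace.proj i : E3 →L[ℝ] ℝ) :=
      (EuclideanSpace.proj i : E3 →L[ℝ] ℝ).contMDiff
    have h1 := hv ((EuclideanSpace.proj i : E3 →L[ℝ] ℝ) ∘ φ) (hp.comp_contMDiffOn hφs)
    rw [mfderiv_comp x (hp.mdifferentiable (by simp) _) hd, ← hL] at h1
    rw [mfderiv_eq_fderiv, ContinuousLinearMap.fderiv] at h1
    exact h1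
  exact (L.map_eq_zero_iff).1 h0

variable {g : LorentzMetric M} {W : Set M} {e : Triad M}

/-- The algebraic frame over the algebra of smooth functions defined by a null frame. -/
def IsNullFrame.frameAlg (h : IsNullFrame g W e) {x₀ : M} (hs : W ⊆ (chartAt E3 x₀).source) :
    FrameAlg (smoothFun W) where
  D a := fieldDerivation h.isOpen (e a) (h.smooth a)
  U c := Matrix.of fun a b => toSmoothFun (connUp g e a b c) (h.contMDiffOn_connUp a b c)
  metric c := by
    have hlow : ∀ a b, ∀ x : W, evalAt x ((etaA (smoothFun W) * Matrix.of fun a b =>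
        toSmoothFun (connUp g e a b c) (h.contMDiffOn_connUp a b c)) a b)
        = conn g e a b c x := by
      intro a b x
      simp only [Matrix.mul_apply, etaA, Matrix.map_apply, Matrix.of_apply, map_sum, map_mul,
        evalAt_algebraMap, evalAt_apply x (toSmoothFun _ _), toSmoothFun_apply, connUp,
        Finset.mul_sum]
      rw [Finset.sum_comm]
      simp only [← mul_assoc, ← Finset.sum_mul]
      have : ∀ f, ∑ i, eta a i * etaInv i f = (1 : Matrix (Fin 3) (Fin 3) ℝ) a f := by
        intro f; rw [← eta_mul_etaInv, Matrix.mul_apply]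
      simp [this, Matrix.one_apply]
    refine Matrix.ext fun a b => ?_
    refine eq_of_evalAt (M := M) (W := W) fun x => ?_
    rw [Matrix.transpose_apply, Matrix.neg_apply, map_neg, hlow, hlow, conn_antisymm]
  lie i j f := eq_of_evalAt fun x => by
    have hf := f.2
    rw [map_sub, evalAt_apply, evalAt_apply,
      fieldDerivation_apply h.isOpen (h.smooth i) _ (h := dirDeriv (e j) (extZero f.1))
        (fun x => rfl) x,
      fieldDerivation_apply h.isOpen (h.smooth j) _ (h := dirDeriv (e i) (extZero f.1))
        (fun x => rfl) x,
      ← dirDeriv_mlieBracket h.isOpen (h.smooth i) (h.smooth j) f.2 x.2]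
    have hx := h.expand x.2 (VectorField.mlieBracket 𝓘(ℝ, E3) (e i) (e j) x)
    rw [dirDeriv, hx, map_sum, map_sum]
    refine Finset.sum_congr rfl fun k _ => ?_
    rw [map_smul, map_mul]
    refine congrArg (· * dirDeriv (e k) (extZero f.1) x) ?_
    rw [map_sub]
    simp only [Matrix.of_apply, evalAt_apply, toSmoothFun_apply, connUp]
    rw [← Finset.sum_sub_distrib]
    refine Finset.sum_congr rfl fun l _ => ?_
    rw [← mul_sub, conn_sub_conn]
    rfl
  indep c hc := by
    funext k
    refine eq_of_evalAt fun x => ?_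
    have : ∑ k, evalAt x (c k) • e k x = 0 := by
      refine eq_zero_of_dirDeriv_eq_zero h.isOpen hs x.2 _ fun f hf => ?_
      have h1 := congrArg (evalAt x) (hc (toSmoothFun f hf))
      simp only [map_sum, map_mul, map_zero] at h1
      rw [map_sum]
      refine Eq.trans (Finset.sum_congr rfl fun k _ => ?_) h1
      rw [map_smul]
      exact congrArg (evalAt x (c k) * ·) (fieldDerivation_apply h.isOpen (h.smooth k)
        (toSmoothFun f hf) (h := f) (fun _ => rfl) x).symm
    have h2 := congrFun (h.eq_zero_of_sum x.2 this) k
    exact h2.trans (map_zero (evalAt x)).symm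

section Bridge

variable (h : IsNullFrame g W e) {x₀ : M} (hs : W ⊆ (chartAt E3 x₀).source)

theorem IsNullFrame.evalAt_D (a : Fin 3) (f : smoothFun W) {p : M → ℝ}
    (hf : ∀ x : W, evalAt x f = p x) (x : W) :
    evalAt x ((h.frameAlg hs).D a f) = dirDeriv (e a) p x :=
  fieldDerivation_apply h.isOpen (h.smooth a) f hf x

theorem IsNullFrame.evalAt_U (a b c : Fin 3) (x : W) :
    evalAt x ((h.frameAlg hs).U c a b) = connUp g e a b c x := rfl

theorem IsNullFrame.evalAt_Rm (a b c d : Fin 3) (x : W) :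
    evalAt x ((h.frameAlg hs).Rm c d a b) = riemUp g e a b c d x := by
  simp only [FrameAlg.Rm, Matrix.sub_apply, Matrix.add_apply, Matrix.map_apply, Matrix.mul_apply,
    Matrix.sum_apply, Matrix.smul_apply, smul_eq_mul, map_sub, map_add, map_sum, map_mul,
    h.evalAt_U hs, h.evalAt_D hs _ _ (fun x => h.evalAt_U hs _ _ _ x), riemUp,
    Finset.sum_sub_distrib]

theorem IsNullFrame.evalAt_riemL (a : Fin 4 → Fin 3) (x : W) :
    evalAt x ((h.frameAlg hs).riemL a) = riem g e x a := by
  simp only [FrameAlg.riemL, Matrix.mul_apply, map_sum, map_mul, h.evalAt_Rm hs, riem, etaA,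
    Matrix.map_apply, evalAt_algebraMap]

theorem IsNullFrame.evalAt_covD {k : ℕ} (t : TensorA (smoothFun W) k) {s : M → Tensor k}
    (hst : ∀ a (x : W), evalAt x (t a) = s x a) (a : Fin (k + 1) → Fin 3) (x : W) :
    evalAt x ((h.frameAlg hs).covD t a) = covDeriv g e s x a := by
  simp only [FrameAlg.covD, covDeriv, map_sub, map_sum, map_mul, h.evalAt_U hs, hst]
  congr 1
  exact h.evalAt_D hs _ _ (hst _) x

theorem IsNullFrame.evalAt_nabla (j : ℕ) (a : Fin (4 + j) → Fin 3) (x : W) :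
    evalAt x ((h.frameAlg hs).nabla j a) = nablaRiem g e j x a := by
  induction j generalizing x with
  | zero => exact h.evalAt_riemL hs a x
  | succ j ih => exact h.evalAt_covD hs _ (fun a x => ih a x) a x

end Bridge

end Geometry

/-! ### Change of null frame on the manifold -/

section Geometry

variable {M : Type*} [TopologicalSpace M] [ChartedSpace E3 M] [IsManifold 𝓘(ℝ, E3) ∞ M]
variable {g : LorentzMetric M} {U U' : Set M} {e e' : Triad M}

theorem mem_Oeta {X : GL (Fin 3) ℝ} : X ∈ Oeta ↔
    (X : Matrix (Fin 3) (Fin 3) ℝ)ᵀ * eta * (X : Matrix (Fin 3) (Fin 3) ℝ) = eta := Iff.rfl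

/-- The element of `GL` defined by a matrix that preserves `η`. -/
def orthogonalGL (X : Matrix (Fin 3) (Fin 3) ℝ) (hX : Xᵀ * eta * X = eta) : GL (Fin 3) ℝ :=
  have h : (etaInv * Xᵀ * eta) * X = 1 := by
    rw [Matrix.mul_assoc, Matrix.mul_assoc, ← Matrix.mul_assoc Xᵀ, hX,
      mul_eq_one_comm.mp eta_mul_etaInv]
  ⟨X, etaInv * Xᵀ * eta, mul_eq_one_comm.mp h, h⟩

theorem orthogonalGL_mem (X : Matrix (Fin 3) (Fin 3) ℝ) (hX : Xᵀ * eta * X = eta) :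
    orthogonalGL X hX ∈ Oeta := hX

variable (g e e') in
/-- The matrix of the frame `e'` relative to the frame `e`. -/
def changeMatrix (x : M) : Matrix (Fin 3) (Fin 3) ℝ :=
  Matrix.of fun a b => ∑ l, etaInv a l * g.val x (e' b x) (e l x)

theorem IsNullFrame.expand_frame (h : IsNullFrame g U e) {x : M} (hx : x ∈ U) (b : Fin 3) :
    e' b x = ∑ a, changeMatrix g e e' x a b • e a x := h.expand hx _

theorem IsNullFrame.eq_of_sum_eq (h : IsNullFrame g U e) {x : M} (hx : x ∈ U) {c d : Fin 3 → ℝ}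
    (hcd : ∑ k, c k • e k x = ∑ k, d k • e k x) : c = d := by
  have : ∑ k, (c - d) k • e k x = 0 := by
    simp only [Pi.sub_apply, sub_smul, Finset.sum_sub_distrib, hcd, sub_self]
  exact sub_eq_zero.mp (h.eq_zero_of_sum hx this)

theorem IsNullFrame.changeMatrix_eq (h : IsNullFrame g U e) {x : M} (hx : x ∈ U)
    {Y : Matrix (Fin 3) (Fin 3) ℝ} (hY : ∀ b, e' b x = ∑ a, Y a b • e a x) :
    changeMatrix g e e' x = Y := by
  ext a b
  exact congrFun (h.eq_of_sum_eq hx (c := fun a => changeMatrix g e e' x a b)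
    (d := fun a => Y a b) ((h.expand_frame hx b).symm.trans (hY b))) a

theorem matrix_orthogonal_of_frame (h : IsNullFrame g U e) (h' : IsNullFrame g U' e') {x : M}
    (hx : x ∈ U) (hx' : x ∈ U') {Y : Matrix (Fin 3) (Fin 3) ℝ}
    (hY : ∀ b, e' b x = ∑ a, Y a b • e a x) : Yᵀ * eta * Y = eta := by
  ext i j
  rw [← h'.orthonormal x hx' i j, hY i, hY j]
  simp only [map_sum, map_smul, sum_apply, smul_apply, h.orthonormal x hx, smul_eq_mul,
    Matrix.mul_apply, Matrix.transpose_apply, Finset.sum_mul]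
  refine Finset.sum_congr rfl fun p _ => ?_
  rw [Finset.mul_sum]
  exact Finset.sum_congr rfl fun q _ => by ring

theorem exists_frame_change (h : IsNullFrame g U e) (h' : IsNullFrame g U' e') {x : M}
    (hx : x ∈ U) (hx' : x ∈ U') :
    ∃ Y ∈ Oeta, ∀ b, e' b x = ∑ a, (Y : Matrix (Fin 3) (Fin 3) ℝ) a b • e a x :=
  ⟨orthogonalGL (changeMatrix g e e' x)
    (matrix_orthogonal_of_frame h h' hx hx' fun b => h.expand_frame hx b),
    orthogonalGL_mem _ _, fun b => h.expand_frame hx b⟩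

theorem contMDiffOn_changeMatrix (h : IsNullFrame g U e) (h' : IsNullFrame g U' e')
    (a b : Fin 3) :
    ContMDiffOn 𝓘(ℝ, E3) 𝓘(ℝ, ℝ) ∞ (fun x => changeMatrix g e e' x a b) (U ∩ U') := by
  have := contMDiffOn_finsetSum (t := Finset.univ)
    (f := fun l x => etaInv a l * g.val x (e' b x) (e l x))
    (fun l _ => (contMDiffOn_const (c := etaInv a l)).mul (g.contMDiffOn_apply
      ((h'.smooth b).mono (Set.inter_subset_right (s := U)))
      ((h.smooth l).mono Set.inter_subset_left)))
  exact this

/-- The algebra of functions and the two algebraic frames near a common point of the domains of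
two null frames. -/
theorem exists_frameAlg_pair (h : IsNullFrame g U e) (h' : IsNullFrame g U' e') {x : M}
    (hx : x ∈ U) (hx' : x ∈ U') :
    ∃ (W : Set M) (_ : x ∈ W) (hW : IsNullFrame g W e) (hW' : IsNullFrame g W e')
      (hs : W ⊆ (chartAt E3 x).source) (X : Matrix (Fin 3) (Fin 3) (smoothFun W)),
      Xᵀ * etaA (smoothFun W) * X = etaA (smoothFun W) ∧
      (∀ a b (y : W), evalAt y (X a b) = changeMatrix g e e' y a b) ∧
      ∀ b f, (hW'.frameAlg hs).D b f = ∑ a, X a b * (hW.frameAlg hs).D a f := by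
  set W : Set M := U ∩ U' ∩ (chartAt E3 x).source with hWdef
  have hWo : IsOpen W := (h.isOpen.inter h'.isOpen).inter (chartAt E3 x).open_source
  have hWU : W ⊆ U := fun y hy => hy.1.1
  have hWU' : W ⊆ U' := fun y hy => hy.1.2
  have hW := h.mono hWo hWU
  have hW' := h'.mono hWo hWU'
  have hs : W ⊆ (chartAt E3 x).source := fun y hy => hy.2
  refine ⟨W, ⟨⟨hx, hx'⟩, mem_chart_source E3 x⟩, hW, hW', hs,
    Matrix.of fun a b => toSmoothFun (fun y => changeMatrix g e e' y a b)
      ((contMDiffOn_changeMatrix h h' a b).mono fun y hy => hy.1), ?_, fun a b y => rfl, ?_⟩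
  · refine Matrix.ext fun a b => eq_of_evalAt (M := M) (W := W) fun y => ?_
    have := congrFun (congrFun (matrix_orthogonal_of_frame hW hW' y.2 y.2
      fun b => hW.expand_frame y.2 b) a) b
    simp only [Matrix.mul_apply, Matrix.transpose_apply] at this
    simp only [Matrix.mul_apply, Matrix.transpose_apply, map_sum, map_mul, etaA, Matrix.map_apply,
      evalAt_algebraMap]
    exact this
  · intro b f
    refine eq_of_evalAt fun y => ?_
    rw [hW'.evalAt_D hs b f (p := extZero f.1) (fun z => (extZero_apply _ z.2).symm), map_sum]
    simp only [map_mul, hW.evalAt_D hs _ f (p := extZero f.1)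
      (fun z => (extZero_apply _ z.2).symm)]
    rw [dirDeriv, hW.expand_frame (e' := e') y.2 b, map_sum]
    refine Finset.sum_congr rfl fun a _ => ?_
    rw [map_smul]
    rfl

theorem tensorAct_inv {k : ℕ} (Y : GL (Fin 3) ℝ) (t : Tensor k) :
    tensorAct Y⁻¹ t = pullTensor (Y : Matrix (Fin 3) (Fin 3) ℝ) t := by
  funext a; simp only [tensorAct, pullTensor, inv_inv]

/-- The components of the derivatives of the Riemann tensor transform as tensors. -/
theorem nablaRiem_change (h : IsNullFrame g U e) (h' : IsNullFrame g U' e') {x : M}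
    (hx : x ∈ U) (hx' : x ∈ U') {Y : Matrix (Fin 3) (Fin 3) ℝ}
    (hY : ∀ b, e' b x = ∑ a, Y a b • e a x) (j : ℕ) :
    nablaRiem g e' j x = pullTensor Y (nablaRiem g e j x) := by
  obtain ⟨W, hxW, hW, hW', hs, X, hX, hXe, hD⟩ := exists_frameAlg_pair h h' hx hx'
  funext a
  -- The algebraic law holds for the variable matrix X. Evaluated at x it involves only X(x) = Y, so
  -- the resulting law is pointwise.
  have h1 := congrArg (evalAt (⟨x, hxW⟩ : W)) (congrFun
    (FrameAlg.nabla_change (hW.frameAlg hs) (hW'.frameAlg hs) hX hD j) a)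
  rw [hW'.evalAt_nabla hs] at h1
  simp only [pullTensor, map_sum, map_mul, map_prod, hW.evalAt_nabla hs, hXe,
    h.changeMatrix_eq hx hY] at h1
  exact h1

/-- The inverse reflects that `jetAct` is a left action, whereas components of covariant tensors are
pulled back by the matrix of the new frame. -/
theorem curvJet_change (h : IsNullFrame g U e) (h' : IsNullFrame g U' e') {x : M}
    (hx : x ∈ U) (hx' : x ∈ U') {Y : GL (Fin 3) ℝ}
    (hY : ∀ b, e' b x = ∑ a, (Y : Matrix (Fin 3) (Fin 3) ℝ) a b • e a x) (p : ℕ) :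
    curvJet g e' p x = jetAct Y⁻¹ (curvJet g e p x) := by
  funext j
  rw [jetAct, tensorAct_inv]
  exact nablaRiem_change h h' hx hx' hY j

/-- Near each point the component is an element of the algebra of smooth functions, so nothing has
to be differentiated by hand. -/
theorem contMDiffOn_nablaRiem (h : IsNullFrame g U e) (j : ℕ) (a : Fin (4 + j) → Fin 3) :
    ContMDiffOn 𝓘(ℝ, E3) 𝓘(ℝ, ℝ) ∞ (fun x => nablaRiem g e j x a) U := by
  intro x hx
  set W : Set M := U ∩ (chartAt E3 x).source with hWdef
  have hWo : IsOpen W := h.isOpen.inter (chartAt E3 x).open_source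
  have hW := h.mono hWo Set.inter_subset_left
  have hs : W ⊆ (chartAt E3 x).source := Set.inter_subset_right
  have hxW : x ∈ W := ⟨hx, mem_chart_source E3 x⟩
  have h1 := smoothFun_smooth ((hW.frameAlg hs).nabla j a)
  have h2 : ContMDiffOn 𝓘(ℝ, E3) 𝓘(ℝ, ℝ) ∞ (fun x => nablaRiem g e j x a) W :=
    h1.congr fun y hy => by
      rw [extZero_apply _ hy]
      exact (hW.evalAt_nabla hs j a ⟨y, hy⟩).symm
  exact ((h2 x hxW).contMDiffAt (hWo.mem_nhds hxW)).contMDiffWithinAt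

section Act

theorem IsNullFrame.act (h : IsNullFrame g U e) {X : GL (Fin 3) ℝ} (hX : X ∈ Oeta) :
    IsNullFrame g U (e.act X) where
  isOpen := h.isOpen
  smooth b := by
    have := ContMDiffOn.sum_section (s := Finset.univ)
      (t := fun a x => (X : Matrix (Fin 3) (Fin 3) ℝ) a b • e a x)
      (fun a _ => (h.smooth a).const_smul_section (a := (X : Matrix (Fin 3) (Fin 3) ℝ) a b))
    exact this
  orthonormal x hx i j := by
    have := congrFun (congrFun hX i) j
    simp only [Triad.act, map_sum, map_smul, sum_apply, smul_apply, h.orthonormal x hx,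
      smul_eq_mul]
    rw [← this]
    simp only [Matrix.mul_apply, Matrix.transpose_apply, Finset.sum_mul]
    refine Finset.sum_congr rfl fun p _ => ?_
    rw [Finset.mul_sum]
    exact Finset.sum_congr rfl fun q _ => by ring

theorem dirDeriv_act (X : GL (Fin 3) ℝ) (b : Fin 3) (f : M → ℝ) (x : M) :
    dirDeriv (e.act X b) f x = ∑ a, (X : Matrix (Fin 3) (Fin 3) ℝ) a b * dirDeriv (e a) f x := by
  rw [dirDeriv, Triad.act, map_sum]
  refine Finset.sum_congr rfl fun a _ => ?_
  rw [map_smul]; rfl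

theorem nablaRiem_act (h : IsNullFrame g U e) {X : GL (Fin 3) ℝ} (hX : X ∈ Oeta) {x : M}
    (hx : x ∈ U) (j : ℕ) : nablaRiem g (e.act X) j x
      = pullTensor (X : Matrix (Fin 3) (Fin 3) ℝ) (nablaRiem g e j x) :=
  nablaRiem_change h (h.act hX) hx hx (fun _ => rfl) j

theorem conn_eq_sum (g : LorentzMetric M) (e : Triad M) (a b c : Fin 3) (x : M) :
    conn g e a b c x = ∑ d, eta a d * connUp g e d b c x := by
  simp only [connUp, Finset.mul_sum]
  rw [Finset.sum_comm]
  simp only [← mul_assoc, ← Finset.sum_mul]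
  have : ∀ f, ∑ i, eta a i * etaInv i f = (1 : Matrix (Fin 3) (Fin 3) ℝ) a f := by
    intro f; rw [← eta_mul_etaInv, Matrix.mul_apply]
  simp [this, Matrix.one_apply]

/-- The connection components are tensorial under constant changes of the frame. -/
theorem conn_act (h : IsNullFrame g U e) {X : GL (Fin 3) ℝ} (hX : X ∈ Oeta) {x : M}
    (hx : x ∈ U) (a b c : Fin 3) : conn g (e.act X) a b c x
      = ∑ p, ∑ q, ∑ r, (X : Matrix (Fin 3) (Fin 3) ℝ) p a * (X : Matrix (Fin 3) (Fin 3) ℝ) q b *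
        (X : Matrix (Fin 3) (Fin 3) ℝ) r c * conn g e p q r x := by
  obtain ⟨W, hxW, hW, hW', hs, Y, hY, hYe, hD⟩ := exists_frameAlg_pair h (h.act hX) hx hx
  have hc : ∀ a b (y : W), evalAt y (Y a b) = (X : Matrix (Fin 3) (Fin 3) ℝ) a b := by
    intro a b y
    rw [hYe, hW.changeMatrix_eq y.2 (Y := X) fun _ => rfl]
  -- A constant change of frame has no inhomogeneous term.
  have hc' : Y.map ((hW'.frameAlg hs).D c) = 0 := by
    refine Matrix.ext fun a b => ?_
    have : Y a b = algebraMap ℝ _ ((X : Matrix (Fin 3) (Fin 3) ℝ) a b) :=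
      eq_of_evalAt fun y => by rw [hc, evalAt_algebraMap]
    simp [this]
  have h1 := FrameAlg.connection_change (hW.frameAlg hs) (hW'.frameAlg hs) hY hD c
  rw [hc', add_zero] at h1
  have h2 : etaA (smoothFun W) * (hW'.frameAlg hs).U c
      = ∑ d, Y d c • (Yᵀ * (etaA (smoothFun W) * (hW.frameAlg hs).U d) * Y) := by
    conv_lhs => rw [← hY]
    rw [Matrix.mul_assoc, h1]
    simp only [Matrix.sum_mul, Matrix.mul_sum, Matrix.mul_smul, Matrix.smul_mul, Matrix.mul_assoc]
  have h3 := congrArg (evalAt (⟨x, hxW⟩ : W)) (congrFun (congrFun h2 a) b)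
  simp only [Matrix.mul_apply, Matrix.sum_apply, Matrix.smul_apply, smul_eq_mul, map_sum, map_mul,
    etaA, Matrix.map_apply, evalAt_algebraMap, hc, Matrix.transpose_apply, hW'.evalAt_U hs,
    hW.evalAt_U hs, ← conn_eq_sum] at h3
  rw [h3]
  simp only [Finset.mul_sum, Finset.sum_mul]
  calc _ = ∑ r, ∑ p, ∑ q, (X : Matrix (Fin 3) (Fin 3) ℝ) p a *
        (X : Matrix (Fin 3) (Fin 3) ℝ) q b *
        (X : Matrix (Fin 3) (Fin 3) ℝ) r c * conn g e p q r x := by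
        refine Finset.sum_congr rfl fun r _ => ?_
        rw [Finset.sum_comm]
        exact Finset.sum_congr rfl fun p _ => Finset.sum_congr rfl fun q _ => by ring
    _ = ∑ p, ∑ r, ∑ q, (X : Matrix (Fin 3) (Fin 3) ℝ) p a *
        (X : Matrix (Fin 3) (Fin 3) ℝ) q b *
        (X : Matrix (Fin 3) (Fin 3) ℝ) r c * conn g e p q r x := Finset.sum_comm
    _ = _ := Finset.sum_congr rfl fun p _ => Finset.sum_comm

end Act

end Geometry

/-! ### The type D curvature tensor, its isotropy and its boost weight -/

section TensorAlgebra

/-- The covector `ω¹`. -/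
def omega1 : Fin 3 → ℝ := ![0, 1, 0]

/-- The curvature tensor built from `η` and a covector `u`. -/
def knTensor (c d : ℝ) (u : Fin 3 → ℝ) : Tensor 4 := fun a =>
  c * (eta (a 0) (a 2) * eta (a 1) (a 3) - eta (a 0) (a 3) * eta (a 1) (a 2))
  + d * (eta (a 0) (a 2) * (u (a 1) * u (a 3)) - eta (a 0) (a 3) * (u (a 1) * u (a 2))
    - (u (a 0) * u (a 3)) * eta (a 1) (a 2) + (u (a 0) * u (a 2)) * eta (a 1) (a 3))

theorem sum_four_pair (Y : Matrix (Fin 3) (Fin 3) ℝ) (A B : Fin 3 → Fin 3 → ℝ)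
    (i j k l : Fin 3) :
    ∑ p, ∑ q, ∑ r, ∑ s, Y p i * Y q j * Y r k * Y s l * (A p r * B q s)
      = (∑ p, ∑ r, Y p i * Y r k * A p r) * ∑ q, ∑ s, Y q j * Y s l * B q s := by
  simp only [Finset.sum_mul_sum]
  exact Finset.sum_congr rfl fun p _ => Finset.sum_congr rfl fun r _ =>
    Finset.sum_congr rfl fun q _ => Finset.sum_congr rfl fun s _ => by ring

theorem sum_four_cross (Y : Matrix (Fin 3) (Fin 3) ℝ) (A B : Fin 3 → Fin 3 → ℝ)
    (i j k l : Fin 3) :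
    ∑ p, ∑ q, ∑ r, ∑ s, Y p i * Y q j * Y r k * Y s l * (A p s * B q r)
      = (∑ p, ∑ s, Y p i * Y s l * A p s) * ∑ q, ∑ r, Y q j * Y r k * B q r := by
  rw [← sum_four_pair]
  refine Finset.sum_congr rfl fun p _ => Finset.sum_congr rfl fun q _ => ?_
  rw [Finset.sum_comm]
  exact Finset.sum_congr rfl fun r _ => Finset.sum_congr rfl fun q _ => by ring

/-- Every term is a product of two bilinear forms and pulls back factor by factor; η is invariant,
so only the covector changes. -/
theorem pullTensor_knTensor {Y : Matrix (Fin 3) (Fin 3) ℝ} (hY : Yᵀ * eta * Y = eta) (c d : ℝ)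
    (u : Fin 3 → ℝ) : pullTensor Y (knTensor c d u) = knTensor c d (Yᵀ *ᵥ u) := by
  have h1 : ∀ i j, ∑ p, ∑ r, Y p i * Y r j * eta p r = eta i j := by
    intro i j
    conv_rhs => rw [← hY]
    simp only [Matrix.mul_apply, Matrix.transpose_apply, Finset.sum_mul]
    rw [Finset.sum_comm]
    exact Finset.sum_congr rfl fun r _ => Finset.sum_congr rfl fun q _ => by ring
  have h2 : ∀ i j, ∑ p, ∑ r, Y p i * Y r j * (u p * u r) = (Yᵀ *ᵥ u) i * (Yᵀ *ᵥ u) j := by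
    intro i j
    simp only [Matrix.mulVec, dotProduct, Matrix.transpose_apply, Finset.sum_mul_sum]
    exact Finset.sum_congr rfl fun r _ => Finset.sum_congr rfl fun q _ => by ring
  funext a
  have e1 := sum_four_pair Y eta eta (a 0) (a 1) (a 2) (a 3)
  have e2 := sum_four_cross Y eta eta (a 0) (a 1) (a 2) (a 3)
  have e3 := sum_four_pair Y eta (fun p r => u p * u r) (a 0) (a 1) (a 2) (a 3)
  have e4 := sum_four_cross Y eta (fun p r => u p * u r) (a 0) (a 1) (a 2) (a 3)
  have e5 := sum_four_cross Y (fun p r => u p * u r) eta (a 0) (a 1) (a 2) (a 3)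
  have e6 := sum_four_pair Y (fun p r => u p * u r) eta (a 0) (a 1) (a 2) (a 3)
  simp only [h1, h2] at e1 e2 e3 e4 e5 e6
  rw [pullTensor_four]
  simp only [knTensor, ← e1, ← e2, ← e3, ← e4, ← e5, ← e6, Finset.mul_sum,
    ← Finset.sum_sub_distrib, ← Finset.sum_add_distrib]
  refine Finset.sum_congr rfl fun p _ => Finset.sum_congr rfl fun q _ =>
    Finset.sum_congr rfl fun r _ => Finset.sum_congr rfl fun s _ => ?_
  simp only [Matrix.cons_val]
  ring

/-- Invariance of the curvature determines the constants, and the isometry preserves `ω¹` up to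
sign. -/
theorem knTensor_stabilizer {Y : Matrix (Fin 3) (Fin 3) ℝ} (hY : Yᵀ * eta * Y = eta)
    {c d c' d' : ℝ} (hd : d ≠ 0)
    (h : pullTensor Y (knTensor c d omega1) = knTensor c' d' omega1) :
    c = c' ∧ d = d' ∧ Y 1 0 = 0 ∧ Y 1 2 = 0 := by
  rw [pullTensor_knTensor hY] at h
  set w := Yᵀ *ᵥ omega1 with hw
  have hv : ∀ i, w i = Y 1 i := by
    intro i; simp [hw, Matrix.mulVec, dotProduct, Fin.sum_univ_three, omega1]
  -- Yᵀ preserves the inverse form, so Yᵀω¹ has the norm of ω¹.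
  have hvv : 2 * Y 1 1 ^ 2 - 2 * Y 1 0 * Y 1 2 = 2 := by
    have h1 : Y * (etaInv * Yᵀ * eta) = 1 := by
      rw [mul_eq_one_comm, Matrix.mul_assoc, Matrix.mul_assoc, ← Matrix.mul_assoc Yᵀ, hY,
        mul_eq_one_comm.mp eta_mul_etaInv]
    have h2 : Y * etaInv * Yᵀ = etaInv := by
      have := congrArg (· * etaInv) h1
      simp only [one_mul, Matrix.mul_assoc, eta_mul_etaInv, Matrix.mul_one] at this
      rw [Matrix.mul_assoc]; exact this
    have := congrFun (congrFun h2 1) 1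
    simp [Matrix.mul_apply, Fin.sum_univ_three, etaInv] at this
    linarith
  -- The first two components isolate d w₀² and d w₂². Once these vanish, the others compare c/2 + d
  -- and c.
  have k1 := congrFun h ![0, 1, 0, 1]
  have k2 := congrFun h ![1, 2, 1, 2]
  have k3 := congrFun h ![0, 1, 1, 2]
  have k4 := congrFun h ![0, 2, 0, 2]
  simp [knTensor, hv, eta, omega1] at k1 k2 k3 k4
  have a0 : Y 1 0 = 0 := by simpa [hd] using k1
  have a2 : Y 1 2 = 0 := by simpa [hd] using k2
  rw [a0, a2] at k3 k4 hvv
  have a1 : Y 1 1 * Y 1 1 = 1 := by linarith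
  simp [a1] at k3 k4
  exact ⟨k4, by linarith, a0, a2⟩

/-- Isometries that preserve `ω¹` up to sign are monomial. -/
theorem monomial_of_orthogonal {Y : Matrix (Fin 3) (Fin 3) ℝ} (hY : Yᵀ * eta * Y = eta)
    (h0 : Y 1 0 = 0) (h2 : Y 1 2 = 0) : ∃ A s : ℝ, A ≠ 0 ∧ s ^ 2 = 1 ∧
      (Y = !![A, 0, 0; 0, s, 0; 0, 0, A⁻¹] ∨ Y = !![0, 0, A⁻¹; 0, s, 0; A, 0, 0]) := by
  have E : ∀ i j, (Yᵀ * eta * Y) i j = eta i j := fun i j => by rw [hY]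
  have e00 := E 0 0
  have e01 := E 0 1
  have e02 := E 0 2
  have e11 := E 1 1
  have e12 := E 1 2
  have e22 := E 2 2
  simp [Matrix.mul_apply, Fin.sum_univ_three, eta, h0, h2] at e00 e01 e02 e11 e12 e22
  -- The images of ℓ and n are null vectors in the span of ℓ and n, hence multiples of ℓ or of n.
  have n00 : Y 0 0 * Y 2 0 = 0 := by linarith
  have n22 : Y 0 2 * Y 2 2 = 0 := by linarith
  rcases mul_eq_zero.mp n00 with h | h
  · have hA : Y 2 0 * Y 0 2 = 1 := by rw [h] at e02; linarith
    have hA0 : Y 2 0 ≠ 0 := left_ne_zero_of_mul_eq_one hA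
    have hB0 : Y 0 2 ≠ 0 := right_ne_zero_of_mul_eq_one hA
    have h22 : Y 2 2 = 0 := by simpa [hB0] using n22
    have h01 : Y 0 1 = 0 := by rw [h] at e01; simpa [hA0] using e01
    have h21 : Y 2 1 = 0 := by rw [h22] at e12; simpa [hB0] using e12
    refine ⟨Y 2 0, Y 1 1, hA0, by rw [h01, h21] at e11; linarith, Or.inr ?_⟩
    have hinv : (Y 2 0)⁻¹ = Y 0 2 := inv_eq_of_mul_eq_one_right hA
    ext i j
    fin_cases i <;> fin_cases j <;> simp [h, h0, h2, h22, h01, h21, hinv]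
  · have hA : Y 0 0 * Y 2 2 = 1 := by rw [h] at e02; linarith
    have hA0 : Y 0 0 ≠ 0 := left_ne_zero_of_mul_eq_one hA
    have hB0 : Y 2 2 ≠ 0 := right_ne_zero_of_mul_eq_one hA
    have h02 : Y 0 2 = 0 := by simpa [hB0] using n22
    have h21 : Y 2 1 = 0 := by rw [h] at e01; simpa [hA0] using e01
    have h01 : Y 0 1 = 0 := by rw [h02] at e12; simpa [hB0] using e12
    refine ⟨Y 0 0, Y 1 1, hA0, by rw [h01, h21] at e11; linarith, Or.inl ?_⟩
    have hinv : (Y 0 0)⁻¹ = Y 2 2 := inv_eq_of_mul_eq_one_right hA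
    ext i j
    fin_cases i <;> fin_cases j <;> simp [h, h0, h2, h02, h01, h21, hinv]

/-- Column q has its only possibly nonzero entry `d q` in row `f q`, so a single term of the sum
survives. -/
theorem pullTensor_monomial {k : ℕ} {Y : Matrix (Fin 3) (Fin 3) ℝ} {f : Fin 3 → Fin 3}
    {d : Fin 3 → ℝ} (hY : ∀ p q, Y p q = if p = f q then d q else 0) (t : Tensor k)
    (a : Fin k → Fin 3) : pullTensor Y t a = (∏ i, d (a i)) * t (f ∘ a) := by
  rw [pullTensor, Finset.sum_eq_single (f ∘ a)]
  · congr 1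
    exact Finset.prod_congr rfl fun i _ => by simp [hY]
  · intro b _ hb
    obtain ⟨i, hi⟩ := Function.ne_iff.mp hb
    rw [Finset.prod_eq_zero (Finset.mem_univ i), zero_mul]
    rw [hY]; exact if_neg hi
  · intro h; exact absurd (Finset.mem_univ _) h

/-- The action of connection coefficients `Γ^b_{ac}` on a constant tensor by covariant
differentiation. -/
def covAct {k : ℕ} (G : Fin 3 → Fin 3 → Fin 3 → ℝ) (t : Tensor k) : Tensor (k + 1) := fun a =>
  -∑ i : Fin k, ∑ b, G b (a i.castSucc) (a (Fin.last k)) * t (Function.update (Fin.init a) i b)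

theorem covAct_add {k : ℕ} (G H : Fin 3 → Fin 3 → Fin 3 → ℝ) (t : Tensor k) :
    covAct (G + H) t = covAct G t + covAct H t := by
  funext a
  simp only [covAct, Pi.add_apply, add_mul, Finset.sum_add_distrib]
  ring

theorem covAct_smul {k : ℕ} (r : ℝ) (G : Fin 3 → Fin 3 → Fin 3 → ℝ) (t : Tensor k) :
    covAct (r • G) t = r • covAct G t := by
  funext a
  simp only [covAct, Pi.smul_apply, smul_eq_mul, Finset.mul_sum, mul_neg, mul_assoc]

/-- The coefficients `Γ^a_{bc}` with `Γ_{01} = A`, `Γ_{02} = E`, `Γ_{12} = B`. -/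
def upConn (A E B : Fin 3 → ℝ) : Fin 3 → Fin 3 → Fin 3 → ℝ := fun a b c =>
  !![E c, B c, 0; -2 * A c, 0, 2 * B c; 0, -A c, -E c] a b

/-- The boost weight of an index. -/
def wt : Fin 3 → ℝ := ![1, 0, -1]

/-- Γ_02 generates boosts and acts diagonally on components, by the total boost weight. -/
theorem covAct_boost {k : ℕ} (E : Fin 3 → ℝ) (t : Tensor k) (a : Fin (k + 1) → Fin 3) :
    covAct (upConn 0 E 0) t a
      = -(E (a (Fin.last k)) * ∑ i, wt (Fin.init a i)) * t (Fin.init a) := by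
  have h : ∀ b c d, upConn 0 E 0 b c d = if b = c then E d * wt c else 0 := by
    intro b c d
    fin_cases b <;> fin_cases c <;> simp [upConn, wt]
  simp only [covAct, h, ite_mul, zero_mul, Finset.sum_ite_eq', Finset.mem_univ, if_true]
  have : ∀ i : Fin k, Function.update (Fin.init a) i (a i.castSucc) = Fin.init a := by
    intro i
    exact Function.update_eq_self i (Fin.init a)
  simp only [this, neg_mul, Finset.mul_sum, Finset.sum_mul]
  rfl

/-- Tensors of boost weight zero. -/
def WeightZero {k : ℕ} (t : Tensor k) : Prop := ∀ a, (∑ i, wt (a i)) * t a = 0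

theorem WeightZero.covAct_boost {k : ℕ} {t : Tensor k} (ht : WeightZero t) (E : Fin 3 → ℝ) :
    covAct (upConn 0 E 0) t = 0 := by
  funext a
  rw [Lorentz3.covAct_boost]
  have := ht (Fin.init a)
  simp only [Pi.zero_apply]
  linear_combination (-E (a (Fin.last k))) * this

theorem eta_weight (i j : Fin 3) : (wt i + wt j) * eta i j = 0 := by
  fin_cases i <;> fin_cases j <;> simp [wt, eta]

theorem omega1_weight (i : Fin 3) : wt i * omega1 i = 0 := by
  fin_cases i <;> simp [wt, omega1]

/-- η and ω¹ are boost invariant, and so is everything built from them. -/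
theorem knTensor_weightZero (c d : ℝ) : WeightZero (knTensor c d omega1) := by
  intro a
  rw [Fin.sum_univ_four, knTensor]
  have h := eta_weight
  have u := omega1_weight
  linear_combination c * eta (a 1) (a 3) * h (a 0) (a 2) + c * eta (a 0) (a 2) * h (a 1) (a 3)
    - c * eta (a 1) (a 2) * h (a 0) (a 3) - c * eta (a 0) (a 3) * h (a 1) (a 2)
    + d * (omega1 (a 1) * omega1 (a 3)) * h (a 0) (a 2)
    + d * eta (a 0) (a 2) * (omega1 (a 3) * u (a 1) + omega1 (a 1) * u (a 3))
    - d * (omega1 (a 1) * omega1 (a 2)) * h (a 0) (a 3)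
    - d * eta (a 0) (a 3) * (omega1 (a 2) * u (a 1) + omega1 (a 1) * u (a 2))
    - d * (omega1 (a 0) * omega1 (a 3)) * h (a 1) (a 2)
    - d * eta (a 1) (a 2) * (omega1 (a 3) * u (a 0) + omega1 (a 0) * u (a 3))
    + d * (omega1 (a 0) * omega1 (a 2)) * h (a 1) (a 3)
    + d * eta (a 1) (a 3) * (omega1 (a 2) * u (a 0) + omega1 (a 0) * u (a 2))

/-- The hypothesis on G says that its nonzero entries balance boost weights, so replacing an index
and appending one leaves the total weight zero. -/
theorem WeightZero.covAct {k : ℕ} {t : Tensor k} (ht : WeightZero t)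
    {G : Fin 3 → Fin 3 → Fin 3 → ℝ} (hG : ∀ b a c, (wt a + wt c - wt b) * G b a c = 0) :
    WeightZero (covAct G t) := by
  intro a
  rw [Lorentz3.covAct, mul_neg, Finset.mul_sum, neg_eq_zero]
  refine Finset.sum_eq_zero fun i _ => ?_
  rw [Finset.mul_sum]
  refine Finset.sum_eq_zero fun b _ => ?_
  have h1 := ht (Function.update (Fin.init a) i b)
  have h2 : ∑ j, wt (Function.update (Fin.init a) i b j)
      = wt b + ∑ j, wt (a (Fin.castSucc j)) - wt (a i.castSucc) := by
    rw [← Finset.add_sum_erase _ _ (Finset.mem_univ i),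
      ← Finset.add_sum_erase _ (fun j => wt (a (Fin.castSucc j))) (Finset.mem_univ i)]
    rw [Function.update_self, Finset.sum_congr rfl fun j hj => by
      rw [Function.update_of_ne (Finset.ne_of_mem_erase hj)]]
    simp only [Fin.init]; ring
  rw [h2] at h1
  rw [Fin.sum_univ_castSucc]
  linear_combination G b (a i.castSucc) (a (Fin.last k)) * h1
    + t (Function.update (Fin.init a) i b) * hG b (a i.castSucc) (a (Fin.last k))

/-- The signs of the reflection `(ℓ, m, n) ↦ (-ℓ, m, -n)`. -/
def flipSign : Fin 3 → ℝ := ![-1, 1, -1]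

theorem flipSign_mul_self (i : Fin 3) : flipSign i * flipSign i = 1 := by
  fin_cases i <;> simp [flipSign]

/-- Covariant differentiation of tensors that are invariant under the reflection. -/
theorem covAct_flip {k : ℕ} {t : Tensor k} (ht : ∀ a, (∏ i, flipSign (a i)) * t a = t a)
    {G : Fin 3 → Fin 3 → Fin 3 → ℝ} {s : ℝ}
    (hG : ∀ b a c, flipSign b * flipSign a * flipSign c * G b a c = s * G b a c)
    (a : Fin (k + 1) → Fin 3) : (∏ i, flipSign (a i)) * covAct G t a = s * covAct G t a := by
  rw [covAct, mul_neg, mul_neg, Finset.mul_sum, Finset.mul_sum, neg_inj]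
  refine Finset.sum_congr rfl fun i _ => ?_
  rw [Finset.mul_sum, Finset.mul_sum]
  refine Finset.sum_congr rfl fun b _ => ?_
  have h1 := ht (Function.update (Fin.init a) i b)
  have h2 : flipSign (a i.castSucc) * ∏ j, flipSign (Function.update (Fin.init a) i b j)
      = flipSign b * ∏ j, flipSign (a (Fin.castSucc j)) := by
    rw [← Finset.mul_prod_erase _ _ (Finset.mem_univ i),
      ← Finset.mul_prod_erase _ (fun j => flipSign (a (Fin.castSucc j))) (Finset.mem_univ i)]
    rw [Function.update_self, Finset.prod_congr rfl fun j hj => by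
      rw [Function.update_of_ne (Finset.ne_of_mem_erase hj)]]
    simp only [Fin.init]; ring
  rw [Fin.prod_univ_castSucc]
  have h3 := hG b (a i.castSucc) (a (Fin.last k))
  have h4 := flipSign_mul_self b
  have h5 := flipSign_mul_self (a i.castSucc)
  set T := t (Function.update (Fin.init a) i b)
  set P := ∏ j, flipSign (a (Fin.castSucc j))
  set Q := ∏ j, flipSign (Function.update (Fin.init a) i b j)
  set fb := flipSign b
  set fa := flipSign (a i.castSucc)
  set fc := flipSign (a (Fin.last k))
  set GG := G b (a i.castSucc) (a (Fin.last k))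
  linear_combination (fc * GG * T) * (-P * h4 - fb * h2) + (fc * fb * fa * GG) * h1 + T * h3

theorem knTensor_flip (c d : ℝ) (a : Fin 4 → Fin 3) :
    (∏ i, flipSign (a i)) * knTensor c d omega1 a = knTensor c d omega1 a := by
  have hF : (!![-1, 0, 0; 0, 1, 0; 0, 0, -1] : Matrix (Fin 3) (Fin 3) ℝ)ᵀ * eta *
      !![-1, 0, 0; 0, 1, 0; 0, 0, -1] = eta := by
    ext i j; fin_cases i <;> fin_cases j <;>
      simp [eta, Matrix.mul_apply, Fin.sum_univ_three]
  have h1 := congrFun (pullTensor_knTensor hF c d omega1) a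
  rw [pullTensor_monomial (f := id) (d := flipSign) (by
    intro p q; fin_cases p <;> fin_cases q <;> simp [flipSign])] at h1
  have h2 : (!![-1, 0, 0; 0, 1, 0; 0, 0, -1] : Matrix (Fin 3) (Fin 3) ℝ)ᵀ *ᵥ omega1 = omega1 := by
    ext i; fin_cases i <;> simp [omega1, Matrix.mulVec, dotProduct, Fin.sum_univ_three]
  rw [h2] at h1
  exact h1

/-- Components of the first derivative of the curvature. -/
theorem covAct_knTensor_01 (c d : ℝ) (A E B : Fin 3 → ℝ) (f : Fin 3) :
    covAct (upConn A E B) (knTensor c d omega1) ![2, 0, 0, 1, f] = -(2 * d) * A f := by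
  have hl : (![2, 0, 0, 1, f] : Fin 5 → Fin 3) (Fin.last 4) = f := rfl
  have hi : (Fin.init (![2, 0, 0, 1, f] : Fin 5 → Fin 3) : Fin 4 → Fin 3) = ![2, 0, 0, 1] := by
    funext i; fin_cases i <;> rfl
  rw [covAct, hl, hi]
  simp [Fin.sum_univ_four, Fin.sum_univ_three, knTensor, omega1, upConn, eta]
  ring

/-- Together with the preceding lemma this shows that ∇R determines all of Γ_01 and Γ_12 as soon as
d ≠ 0, and that these components do not see Γ_02. -/
theorem covAct_knTensor_12 (c d : ℝ) (A E B : Fin 3 → ℝ) (f : Fin 3) :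
    covAct (upConn A E B) (knTensor c d omega1) ![0, 2, 2, 1, f] = (2 * d) * B f := by
  have hl : (![0, 2, 2, 1, f] : Fin 5 → Fin 3) (Fin.last 4) = f := rfl
  have hi : (Fin.init (![0, 2, 2, 1, f] : Fin 5 → Fin 3) : Fin 4 → Fin 3) = ![0, 2, 2, 1] := by
    funext i; fin_cases i <;> rfl
  rw [covAct, hl, hi]
  simp [Fin.sum_univ_four, Fin.sum_univ_three, knTensor, omega1, upConn, eta]
  ring

end TensorAlgebra

/-! ### Curvature jets of the canonical configuration -/

section CanonicalJets

/-- The constant part of the connection in the canonical configuration. -/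
def canonConn (T : ℝ) : Fin 3 → Fin 3 → Fin 3 → ℝ := upConn ![1, 0, T] 0 ![T, 0, 0]

/-- The curvature in the canonical configuration. -/
def jet0 (T C : ℝ) : Tensor 4 := knTensor (2 * C + 2 * T ^ 2) (-(C + 2 * T ^ 2)) omega1

/-- The first derivative of the curvature in the canonical configuration. -/
def jet1 (T C : ℝ) : Tensor 5 := covAct (canonConn T) (jet0 T C)

/-- The second derivative of the curvature in the canonical configuration. -/
def jet2 (T C ε : ℝ) : Tensor 6 :=
  covAct (canonConn T) (jet1 T C) + ε • covAct (upConn 0 ![2, 0, 0] 0) (jet1 T C)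

/-- The matrix of the reflection `(ℓ, m, n) ↦ (-ℓ, m, -n)`. -/
def flipMatrix : Matrix (Fin 3) (Fin 3) ℝ := !![-1, 0, 0; 0, 1, 0; 0, 0, -1]

theorem flipMatrix_orthogonal : flipMatrixᵀ * eta * flipMatrix = eta := by
  ext i j; fin_cases i <;> fin_cases j <;>
    simp [flipMatrix, eta, Matrix.mul_apply, Fin.sum_univ_three]

/-- The reflection `(ℓ, m, n) ↦ (-ℓ, m, -n)`. -/
def flipGL : GL (Fin 3) ℝ := orthogonalGL flipMatrix flipMatrix_orthogonal

theorem flipGL_mem : flipGL ∈ Oeta := flipMatrix_orthogonal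

theorem coe_flipGL : (flipGL : Matrix (Fin 3) (Fin 3) ℝ) = flipMatrix := rfl

theorem pullTensor_flip {k : ℕ} (t : Tensor k) (a : Fin k → Fin 3) :
    pullTensor flipMatrix t a = (∏ i, flipSign (a i)) * t a := by
  rw [pullTensor_monomial (f := id) (d := flipSign)]
  · rfl
  · intro p q; fin_cases p <;> fin_cases q <;> simp [flipMatrix, flipSign]

theorem canonConn_flip (T : ℝ) (b a c : Fin 3) :
    flipSign b * flipSign a * flipSign c * canonConn T b a c = 1 * canonConn T b a c := by
  fin_cases b <;> fin_cases a <;> fin_cases c <;> simp [flipSign, canonConn, upConn]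

theorem jet0_flip (T C : ℝ) (a) : (∏ i, flipSign (a i)) * jet0 T C a = jet0 T C a :=
  knTensor_flip _ _ a

theorem jet1_flip (T C : ℝ) (a) : (∏ i, flipSign (a i)) * jet1 T C a = jet1 T C a := by
  rw [jet1, covAct_flip (jet0_flip T C) (canonConn_flip T), one_mul]

theorem pullTensor_flip_jet0 (T C : ℝ) : pullTensor flipMatrix (jet0 T C) = jet0 T C := by
  funext a; rw [pullTensor_flip, jet0_flip]

theorem pullTensor_flip_jet1 (T C : ℝ) : pullTensor flipMatrix (jet1 T C) = jet1 T C := by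
  funext a; rw [pullTensor_flip, jet1_flip]

theorem pullTensor_flip_jet2 (T C ε : ℝ) :
    pullTensor flipMatrix (jet2 T C ε) = jet2 T C (-ε) := by
  funext a
  have h1 := covAct_flip (jet1_flip T C) (canonConn_flip T) a
  have h2 := covAct_flip (jet1_flip T C) (G := upConn 0 ![2, 0, 0] 0) (s := -1) (by
    intro b a c
    fin_cases b <;> fin_cases a <;> fin_cases c <;> simp [flipSign, upConn]) a
  rw [pullTensor_flip, jet2, jet2]
  simp only [Pi.add_apply, Pi.smul_apply, smul_eq_mul]
  linear_combination h1 + ε * h2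

theorem jet1_01 (T C : ℝ) (f : Fin 3) :
    jet1 T C ![2, 0, 0, 1, f] = 2 * (C + 2 * T ^ 2) * ![1, 0, T] f := by
  rw [jet1, jet0, canonConn, covAct_knTensor_01]; ring

theorem jet1_12 (T C : ℝ) (f : Fin 3) :
    jet1 T C ![0, 2, 2, 1, f] = -2 * (C + 2 * T ^ 2) * ![T, 0, 0] f := by
  rw [jet1, jet0, canonConn, covAct_knTensor_12]; ring

/-- The component of the second derivative that detects `ε`. -/
theorem jet2_apply (T C ε : ℝ) :
    jet2 T C ε ![2, 0, 0, 1, 0, 0] = -8 * (C + 2 * T ^ 2) * ε := by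
  -- The constant part of the connection preserves parity under the reflection, and this component
  -- is odd, having five indices 0 or 2. So only the term with ε contributes: -(2ε)·2 times the
  -- component (2,0,0,1,0) of ∇R.
  have h1 := covAct_flip (jet1_flip T C) (canonConn_flip T) ![2, 0, 0, 1, 0, 0]
  have h2 : ∏ i, flipSign ((![2, 0, 0, 1, 0, 0] : Fin 6 → Fin 3) i) = -1 := by
    simp [Fin.prod_univ_succ, flipSign]
  rw [h2] at h1
  have hi : (Fin.init (![2, 0, 0, 1, 0, 0] : Fin 6 → Fin 3) : Fin 5 → Fin 3)
      = ![2, 0, 0, 1, 0] := by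
    funext i; fin_cases i <;> rfl
  have hl : (![2, 0, 0, 1, 0, 0] : Fin 6 → Fin 3) (Fin.last 5) = 0 := rfl
  have h3 : ∑ i, wt ((![2, 0, 0, 1, 0] : Fin 5 → Fin 3) i) = 2 := by
    simp [Fin.sum_univ_five, wt]; norm_num
  rw [jet2]
  simp only [Pi.add_apply, Pi.smul_apply, smul_eq_mul, covAct_boost, hi, hl, h3, jet1_01]
  simp
  linarith

/-- The isometries between the canonical first order jets. -/
theorem jet_stabilizer {Y : Matrix (Fin 3) (Fin 3) ℝ} (hY : Yᵀ * eta * Y = eta)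
    {T C T' C' : ℝ} (hne : C + 2 * T ^ 2 ≠ 0) (h0 : pullTensor Y (jet0 T C) = jet0 T' C')
    (h1 : pullTensor Y (jet1 T C) = jet1 T' C') :
    T = T' ∧ C = C' ∧ (Y = 1 ∨ Y = flipMatrix) := by
  obtain ⟨e1, e2, y0, y2⟩ := knTensor_stabilizer hY (neg_ne_zero.mpr hne) h0
  have hne' : C' + 2 * T' ^ 2 = C + 2 * T ^ 2 := by linarith
  obtain ⟨A, s, hA, hs, rfl | rfl⟩ := monomial_of_orthogonal hY y0 y2
  · have hm : ∀ p q, (!![A, 0, 0; 0, s, 0; 0, 0, A⁻¹] : Matrix (Fin 3) (Fin 3) ℝ) p q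
        = if p = id q then ![A, s, A⁻¹] q else 0 := by
      intro p q; fin_cases p <;> fin_cases q <;> simp
    have k0 := congrFun h1 ![2, 0, 0, 1, 0]
    have k2 := congrFun h1 ![2, 0, 0, 1, 2]
    rw [pullTensor_monomial hm, Function.id_comp, jet1_01, jet1_01, hne'] at k0 k2
    simp [Fin.prod_univ_succ, hA, hne] at k0 k2
    -- Preservation of κ = 1 under the boost A and the reflection s of m; it forces s = 1 and A =
    -- ±1. The other component compares τ, which is unaffected by boosts.
    have k0' : s * A ^ 2 = 1 := by linear_combination k0
    have hs1 : s = 1 := by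
      have : 0 < s := by
        by_contra hneg
        nlinarith [sq_nonneg A]
      nlinarith
    have hA1 : A ^ 2 = 1 := by rw [hs1] at k0'; linarith
    have hTT : T = T' := by
      have : (T - T') * (2 * (C + 2 * T ^ 2)) = 0 := by
        rw [hs1, one_mul, mul_inv_cancel₀ hA] at k2
        linear_combination k2
      have h3 := (mul_eq_zero.mp this).resolve_right (by simpa using hne)
      linarith
    refine ⟨hTT, by rw [hTT] at hne'; linarith, ?_⟩
    rw [hs1]
    rcases mul_self_eq_one_iff.mp ((sq A).symm.trans hA1) with rfl | rfl
    · left; ext i j; fin_cases i <;> fin_cases j <;> simp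
    · right; ext i j; fin_cases i <;> fin_cases j <;> norm_num [flipMatrix]
  -- An exchange of ℓ and n would carry the vanishing ν to κ = 1.
  · exfalso
    have hm : ∀ p q, (!![0, 0, A⁻¹; 0, s, 0; A, 0, 0] : Matrix (Fin 3) (Fin 3) ℝ) p q
        = if p = (![2, 1, 0] : Fin 3 → Fin 3) q then ![A, s, A⁻¹] q else 0 := by
      intro p q; fin_cases p <;> fin_cases q <;> simp
    have k0 := congrFun h1 ![2, 0, 0, 1, 0]
    have hc : (![2, 1, 0] : Fin 3 → Fin 3) ∘ ![2, 0, 0, 1, 0] = ![0, 2, 2, 1, 2] := by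
      funext i; fin_cases i <;> rfl
    rw [pullTensor_monomial hm, hc, jet1_01, jet1_12, hne'] at k0
    simp [hne] at k0

end CanonicalJets

/-! ### Jacobi and Bianchi identities -/

namespace FrameAlg

variable {A : Type*} [CommRing A] [Algebra ℝ A] (F : FrameAlg A)

/-- The structure functions, `[e_i, e_j] = c_{ij}^k e_k`. -/
def str (i j k : Fin 3) : A := F.U i k j - F.U j k i

theorem commutator (i j : Fin 3) (f : A) :
    F.D i (F.D j f) - F.D j (F.D i f) = ∑ k, F.str i j k * F.D k f := F.lie i j f

/-- The Jacobi identity for the structure functions. -/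
theorem jacobi (i j l m : Fin 3) :
    (F.D i (F.str j l m) + ∑ k, F.str j l k * F.str i k m)
    + (F.D j (F.str l i m) + ∑ k, F.str l i k * F.str j k m)
    + (F.D l (F.str i j m) + ∑ k, F.str i j k * F.str l k m) = 0 := by
  -- The double commutator [D_i, [D_j, D_l]] expanded in the frame. Its cyclic sum vanishes, and
  -- independence of the derivations yields the coefficients.
  have key : ∀ i j l f, ∑ m, (F.D i (F.str j l m) + ∑ k, F.str j l k * F.str i k m) * F.D m f
      = F.D i (F.D j (F.D l f)) - F.D i (F.D l (F.D j f))
        - F.D j (F.D l (F.D i f)) + F.D l (F.D j (F.D i f)) := by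
    intro i j l f
    have h1 : F.D i (F.D j (F.D l f)) - F.D i (F.D l (F.D j f))
        = ∑ k, (F.D i (F.str j l k) * F.D k f + F.str j l k * F.D i (F.D k f)) := by
      rw [← map_sub, F.commutator, F.D_sum_mul]
    have h2 : F.D j (F.D l (F.D i f)) - F.D l (F.D j (F.D i f))
        = ∑ k, F.str j l k * F.D k (F.D i f) := F.commutator _ _ _
    have h3 : ∑ m, (∑ k, F.str j l k * F.str i k m) * F.D m f
        = ∑ k, F.str j l k * (F.D i (F.D k f) - F.D k (F.D i f)) := by
      simp only [F.commutator, Finset.sum_mul, Finset.mul_sum]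
      rw [Finset.sum_comm]
      exact Finset.sum_congr rfl fun k _ => Finset.sum_congr rfl fun m _ => by ring
    simp only [add_mul, Finset.sum_add_distrib, mul_sub, Finset.sum_sub_distrib] at h1 h3 ⊢
    linear_combination h3 - h1 + h2
  refine congrFun (F.indep (fun m => (F.D i (F.str j l m) + ∑ k, F.str j l k * F.str i k m)
    + (F.D j (F.str l i m) + ∑ k, F.str l i k * F.str j k m)
    + (F.D l (F.str i j m) + ∑ k, F.str i j k * F.str l k m)) fun f => ?_) m
  have k1 := key i j l f
  have k2 := key j l i f
  have k3 := key l i j f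
  simp only [add_mul _ _ (F.D _ f), Finset.sum_add_distrib] at k1 k2 k3 ⊢
  linear_combination k1 + k2 + k3

theorem Rm_apply (c d a b : Fin 3) : F.Rm c d a b = F.D c (F.U d a b) - F.D d (F.U c a b)
    + (∑ f, F.U c a f * F.U d f b - ∑ f, F.U d a f * F.U c f b)
    - ∑ f, F.str c d f * F.U f a b := by
  simp only [Rm, str, Matrix.sub_apply, Matrix.add_apply, Matrix.map_apply, Matrix.mul_apply,
    Matrix.sum_apply, Matrix.smul_apply, smul_eq_mul]

/-- The first Bianchi identity. -/
theorem first_bianchi (a b c d : Fin 3) : F.Rm c d a b + F.Rm d b a c + F.Rm b c a d = 0 := by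
  -- For a torsion-free connection the structure functions are differences of connection
  -- coefficients; rewriting the Jacobi identity with them gives the Bianchi identity.
  have hJ := F.jacobi c d b a
  have e : ∀ i j k l, ∑ f, F.str i j f * F.str k f l
      = ∑ f, F.str i j f * F.U k l f - ∑ f, F.str i j f * F.U f l k := by
    intro i j k l
    rw [← Finset.sum_sub_distrib]
    exact Finset.sum_congr rfl fun f _ => by simp only [str]; ring
  have e2 : ∀ i j k l, ∑ f, F.str i j f * F.U k l f
      = ∑ f, F.U k l f * F.U i f j - ∑ f, F.U k l f * F.U j f i := by
    intro i j k l
    rw [← Finset.sum_sub_distrib]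
    exact Finset.sum_congr rfl fun f _ => by simp only [str]; ring
  rw [e, e, e, e2, e2, e2] at hJ
  have e3 : ∀ i j k l, F.D l (F.str i j k) = F.D l (F.U i k j) - F.D l (F.U j k i) := by
    intro i j k l; rw [str, map_sub]
  rw [e3, e3, e3] at hJ
  rw [Rm_apply, Rm_apply, Rm_apply]
  linear_combination hJ

/-- Infinitesimal isometries of η are preserved by derivatives of entries, commutators and linear
combinations, and the curvature is formed from the connection by these operations. -/
theorem etaA_Rm_antisymm (c d : Fin 3) : (etaA A * F.Rm c d)ᵀ = -(etaA A * F.Rm c d) := by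
  have h1 : ∀ c d, (etaA A * (F.U d).map (F.D c))ᵀ = -(etaA A * (F.U d).map (F.D c)) := by
    intro c d
    have := congrArg (fun Y => Matrix.map Y (F.D c)) (F.metric d)
    have h2 : (etaA A * F.U d).map (F.D c) = etaA A * (F.U d).map (F.D c) := by
      rw [map_D_mul, map_D_etaA, Matrix.zero_mul, zero_add]
    rw [← h2]
    refine Eq.trans ?_ (this.trans ?_)
    · rw [Matrix.transpose_map]
    · ext i j; simp
  have hU : ∀ c, (F.U c)ᵀ * etaA A = -(etaA A * F.U c) := by
    intro c
    rw [← F.metric c, Matrix.transpose_mul, etaA_transpose]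
  have h3 : ∀ c d, (etaA A * (F.U c * F.U d))ᵀ = etaA A * (F.U d * F.U c) := by
    intro c d
    rw [Matrix.transpose_mul, Matrix.transpose_mul, etaA_transpose, Matrix.mul_assoc, hU,
      Matrix.mul_neg, ← Matrix.mul_assoc, hU, Matrix.neg_mul, neg_neg, Matrix.mul_assoc]
  rw [Rm, Matrix.mul_sub, Matrix.mul_add, Matrix.mul_sub, Matrix.mul_sub, Matrix.mul_sum,
    Matrix.transpose_sub, Matrix.transpose_add, Matrix.transpose_sub, Matrix.transpose_sub,
    Matrix.transpose_sum, h1, h1, h3, h3]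
  have h4 : ∑ i, (etaA A * (F.U c i d - F.U d i c) • F.U i)ᵀ
      = -∑ i, etaA A * (F.U c i d - F.U d i c) • F.U i := by
    rw [← Finset.sum_neg_distrib]
    refine Finset.sum_congr rfl fun i _ => ?_
    rw [Matrix.mul_smul, Matrix.transpose_smul, F.metric, smul_neg]
  rw [h4]
  abel

end FrameAlg

/-! ### Symmetries of the curvature; constant tensors -/

section Geometry

variable {M : Type*} [TopologicalSpace M] [ChartedSpace E3 M] [IsManifold 𝓘(ℝ, E3) ∞ M]
variable {g : LorentzMetric M} {U : Set M} {e : Triad M}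

/-- An algebraic frame near a point of the domain of a null frame. -/
theorem IsNullFrame.exists_local (h : IsNullFrame g U e) {x : M} (hx : x ∈ U) :
    ∃ (W : Set M) (_ : x ∈ W) (_ : IsNullFrame g W e), W ⊆ U ∧ W ⊆ (chartAt E3 x).source :=
  ⟨U ∩ (chartAt E3 x).source, ⟨hx, mem_chart_source E3 x⟩,
    h.mono (h.isOpen.inter (chartAt E3 x).open_source) Set.inter_subset_left,
    Set.inter_subset_left, Set.inter_subset_right⟩

theorem riem_antisymm_right (g : LorentzMetric M) (e : Triad M) (x : M) (a b c d : Fin 3) :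
    riem g e x ![a, b, c, d] = -riem g e x ![a, b, d, c] := by
  simp only [riem, Matrix.cons_val]
  rw [← Finset.sum_neg_distrib]
  refine Finset.sum_congr rfl fun f _ => ?_
  simp only [riemUp, Finset.sum_sub_distrib, sub_mul]
  ring

theorem IsNullFrame.riem_antisymm_left (h : IsNullFrame g U e) {x : M} (hx : x ∈ U)
    (a b c d : Fin 3) : riem g e x ![a, b, c, d] = -riem g e x ![b, a, c, d] := by
  obtain ⟨W, hxW, hW, -, hs⟩ := h.exists_local hx
  have h1 := congrFun (congrFun ((hW.frameAlg hs).etaA_Rm_antisymm c d) b) a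
  have h2 := congrArg (evalAt (⟨x, hxW⟩ : W)) h1
  rw [Matrix.transpose_apply, Matrix.neg_apply, map_neg] at h2
  have h3 := hW.evalAt_riemL hs ![a, b, c, d] ⟨x, hxW⟩
  have h4 := hW.evalAt_riemL hs ![b, a, c, d] ⟨x, hxW⟩
  exact (h3.symm.trans h2).trans (congrArg Neg.neg h4)

theorem IsNullFrame.riem_bianchi (h : IsNullFrame g U e) {x : M} (hx : x ∈ U)
    (a b c d : Fin 3) : riem g e x ![a, b, c, d] + riem g e x ![a, c, d, b]
      + riem g e x ![a, d, b, c] = 0 := by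
  obtain ⟨W, hxW, hW, -, hs⟩ := h.exists_local hx
  have h2 : ∀ f, riemUp g e f b c d x + riemUp g e f c d b x + riemUp g e f d b c x = 0 := by
    intro f
    have := congrArg (evalAt (⟨x, hxW⟩ : W)) ((hW.frameAlg hs).first_bianchi f b c d)
    rwa [map_add, map_add, map_zero, hW.evalAt_Rm hs, hW.evalAt_Rm hs, hW.evalAt_Rm hs] at this
  simp only [riem, Matrix.cons_val, ← Finset.sum_add_distrib, ← mul_add, h2, mul_zero,
    Finset.sum_const_zero]

theorem ricci_eq (g : LorentzMetric M) (e : Triad M) (b d : Fin 3) (x : M) :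
    ricci g e b d x = -riem g e x ![2, b, 0, d] - riem g e x ![0, b, 2, d]
      + 2 * riem g e x ![1, b, 1, d] := by
  simp [ricci, riem, Fin.sum_univ_three, eta]
  ring

theorem IsNullFrame.commutator (h : IsNullFrame g U e) {x : M} (hx : x ∈ U) (i j : Fin 3)
    {f : M → ℝ} (hf : ContMDiffOn 𝓘(ℝ, E3) 𝓘(ℝ, ℝ) ∞ f U) :
    dirDeriv (e i) (dirDeriv (e j) f) x - dirDeriv (e j) (dirDeriv (e i) f) x
      = ∑ k, (connUp g e k j i x - connUp g e k i j x) * dirDeriv (e k) f x := by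
  obtain ⟨W, hxW, hW, hWU, hs⟩ := h.exists_local hx
  have h1 := congrArg (evalAt (⟨x, hxW⟩ : W)) ((hW.frameAlg hs).lie i j
    (toSmoothFun f (hf.mono hWU)))
  have hD : ∀ i (y : W), evalAt y ((hW.frameAlg hs).D i (toSmoothFun f (hf.mono hWU)))
      = dirDeriv (e i) f y := fun i y => hW.evalAt_D hs i _ (fun _ => rfl) y
  simpa only [map_sub, map_sum, map_mul, hW.evalAt_U hs, hD,
    hW.evalAt_D hs _ _ (hD _)] using h1

/-- The connection coefficients in terms of the three connection forms. -/
theorem connUp_eq_upConn (g : LorentzMetric M) (e : Triad M) (x : M) :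
    (fun a b c => connUp g e a b c x) = upConn (fun c => conn g e 0 1 c x)
      (fun c => conn g e 0 2 c x) (fun c => conn g e 1 2 c x) := by
  have hz : ∀ a c, conn g e a a c x = 0 := by
    intro a c
    have := conn_antisymm g e a a c x
    linarith
  funext a b c
  fin_cases a <;> fin_cases b <;>
    simp [connUp, upConn, Fin.sum_univ_three, etaInv, hz, conn_antisymm g e 1 0 c x,
      conn_antisymm g e 2 0 c x, conn_antisymm g e 2 1 c x]

/-- For constant components the covariant derivative is purely algebraic in the connection. This
turns statements about jets into statements about the connection coefficients. -/
theorem covDeriv_const (h : IsNullFrame g U e) {k : ℕ} {t : M → Tensor k} {s : Tensor k}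
    (ht : ∀ y ∈ U, t y = s) {x : M} (hx : x ∈ U) :
    covDeriv g e t x = covAct (fun a b c => connUp g e a b c x) s := by
  funext a
  have h1 : dirDeriv (e (a (Fin.last k))) (fun y => t y (Fin.init a)) x = 0 := by
    rw [dirDeriv_congr h.isOpen _ (h := fun _ => s (Fin.init a))
      (fun y hy => by simp only [ht y hy]) hx, dirDeriv_const]
  simp only [covDeriv, h1, ht x hx, covAct, zero_sub]

end Geometry

/-! ### Structure equations and frames with canonical first order jet -/

section Geometry

variable {M : Type*} [TopologicalSpace M] [ChartedSpace E3 M] [IsManifold 𝓘(ℝ, E3) ∞ M]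
variable {g : LorentzMetric M} {U : Set M} {e : Triad M}

theorem IsNullFrame.dirDeriv_const_mul (h : IsNullFrame g U e) {x : M} (hx : x ∈ U) (r : ℝ)
    {f : M → ℝ} (hf : ContMDiffOn 𝓘(ℝ, E3) 𝓘(ℝ, ℝ) ∞ f U)
    (v : (x : M) → TangentSpace 𝓘(ℝ, E3) x) :
    dirDeriv v (fun y => r * f y) x = r * dirDeriv v f x := by
  have := dirDeriv_mul h.isOpen v (f := fun _ => r) contMDiffOn_const hf hx
  rwa [dirDeriv_const, mul_zero, add_zero] at this

theorem IsNullFrame.dirDeriv_of_const (h : IsNullFrame g U e) {x : M} (hx : x ∈ U) {r : ℝ}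
    {f : M → ℝ} (hf : ∀ y ∈ U, f y = r) (v : (x : M) → TangentSpace 𝓘(ℝ, E3) x) :
    dirDeriv v f x = 0 := by
  rw [dirDeriv_congr h.isOpen v (h := fun _ => r) hf hx, dirDeriv_const]

theorem connUp_21 (g : LorentzMetric M) (e : Triad M) (d : Fin 3) :
    connUp g e 2 1 d = fun x => (-1) * conn g e 0 1 d x := by
  funext x
  have := congrFun (congrFun (congrFun (connUp_eq_upConn g e x) 2) 1) d
  rw [this]; simp [upConn]

theorem connUp_22 (g : LorentzMetric M) (e : Triad M) (d : Fin 3) :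
    connUp g e 2 2 d = fun x => (-1) * conn g e 0 2 d x := by
  funext x
  have := congrFun (congrFun (congrFun (connUp_eq_upConn g e x) 2) 2) d
  rw [this]; simp [upConn]

theorem connUp_12 (g : LorentzMetric M) (e : Triad M) (d : Fin 3) :
    connUp g e 1 2 d = fun x => 2 * conn g e 1 2 d x := by
  funext x
  have := congrFun (congrFun (congrFun (connUp_eq_upConn g e x) 1) 2) d
  rw [this]; simp [upConn]

/-- The coefficients of `[e_c, e_d]` in terms of the connection forms. -/
def lieCoeff (A E B : Fin 3 → ℝ) (k c d : Fin 3) : ℝ := upConn A E B k d c - upConn A E B k c d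

theorem connUp_sub_connUp (g : LorentzMetric M) (e : Triad M) (x : M) (k c d : Fin 3) :
    connUp g e k d c x - connUp g e k c d x = lieCoeff (fun c => conn g e 0 1 c x)
      (fun c => conn g e 0 2 c x) (fun c => conn g e 1 2 c x) k c d := by
  rw [lieCoeff, ← connUp_eq_upConn]

/-- Cartan's second structure equation for Γ_01; those for Γ_02 and Γ_12 follow. -/
theorem IsNullFrame.riem_01 (h : IsNullFrame g U e) {x : M} (hx : x ∈ U) (c d : Fin 3) :
    riem g e x ![0, 1, c, d] = dirDeriv (e c) (conn g e 0 1 d) x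
      - dirDeriv (e d) (conn g e 0 1 c) x
      - (conn g e 0 2 c x * conn g e 0 1 d x - conn g e 0 2 d x * conn g e 0 1 c x)
      - ∑ k, lieCoeff (fun c => conn g e 0 1 c x)
      (fun c => conn g e 0 2 c x) (fun c => conn g e 1 2 c x) k c d * conn g e 0 1 k x := by
  have hU := fun a b c => congrFun (congrFun (congrFun (connUp_eq_upConn g e x) a) b) c
  simp only [riem, riemUp, connUp_sub_connUp, Fin.sum_univ_three, Matrix.cons_val]
  rw [connUp_21 g e d, connUp_21 g e c, h.dirDeriv_const_mul hx _ (h.contMDiffOn_conn _ _ _),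
    h.dirDeriv_const_mul hx _ (h.contMDiffOn_conn _ _ _)]
  simp [hU, upConn, eta]
  ring

theorem IsNullFrame.riem_02 (h : IsNullFrame g U e) {x : M} (hx : x ∈ U) (c d : Fin 3) :
    riem g e x ![0, 2, c, d] = dirDeriv (e c) (conn g e 0 2 d) x
      - dirDeriv (e d) (conn g e 0 2 c) x
      + 2 * (conn g e 0 1 c x * conn g e 1 2 d x - conn g e 0 1 d x * conn g e 1 2 c x)
      - ∑ k, lieCoeff (fun c => conn g e 0 1 c x)
      (fun c => conn g e 0 2 c x) (fun c => conn g e 1 2 c x) k c d * conn g e 0 2 k x := by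
  have hU := fun a b c => congrFun (congrFun (congrFun (connUp_eq_upConn g e x) a) b) c
  simp only [riem, riemUp, connUp_sub_connUp, Fin.sum_univ_three, Matrix.cons_val]
  rw [connUp_22 g e d, connUp_22 g e c, h.dirDeriv_const_mul hx _ (h.contMDiffOn_conn _ _ _),
    h.dirDeriv_const_mul hx _ (h.contMDiffOn_conn _ _ _)]
  simp [hU, upConn, eta]
  ring

theorem IsNullFrame.riem_12 (h : IsNullFrame g U e) {x : M} (hx : x ∈ U) (c d : Fin 3) :
    riem g e x ![1, 2, c, d] = dirDeriv (e c) (conn g e 1 2 d) x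
      - dirDeriv (e d) (conn g e 1 2 c) x
      + (conn g e 0 2 c x * conn g e 1 2 d x - conn g e 0 2 d x * conn g e 1 2 c x)
      - ∑ k, lieCoeff (fun c => conn g e 0 1 c x)
      (fun c => conn g e 0 2 c x) (fun c => conn g e 1 2 c x) k c d * conn g e 1 2 k x := by
  have hU := fun a b c => congrFun (congrFun (congrFun (connUp_eq_upConn g e x) a) b) c
  simp only [riem, riemUp, connUp_sub_connUp, Fin.sum_univ_three, Matrix.cons_val]
  rw [connUp_12 g e d, connUp_12 g e c, h.dirDeriv_const_mul hx _ (h.contMDiffOn_conn _ _ _),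
    h.dirDeriv_const_mul hx _ (h.contMDiffOn_conn _ _ _)]
  simp [hU, upConn, eta]
  ring

/-- Tensors with the antisymmetries of the Riemann tensor are determined by nine components. -/
theorem tensor_four_ext {s t : Tensor 4} (hs : ∀ a b c d, s ![a, b, c, d] = -s ![b, a, c, d])
    (hs' : ∀ a b c d, s ![a, b, c, d] = -s ![a, b, d, c])
    (ht : ∀ a b c d, t ![a, b, c, d] = -t ![b, a, c, d])
    (ht' : ∀ a b c d, t ![a, b, c, d] = -t ![a, b, d, c])
    (h : ∀ i j : Fin 3, s ![![0, 0, 1] i, ![1, 2, 2] i, ![0, 0, 1] j, ![1, 2, 2] j]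
      = t ![![0, 0, 1] i, ![1, 2, 2] i, ![0, 0, 1] j, ![1, 2, 2] j]) : s = t := by
  have hpair : ∀ P : Fin 3 → Fin 3 → Prop, (∀ a b, P a b → P b a) → (∀ a, P a a) →
      (∀ i : Fin 3, P (![0, 0, 1] i) (![1, 2, 2] i)) → ∀ a b, P a b := by
    intro P h1 h2 h3 a b
    have h01 := h3 0
    have h02 := h3 1
    have h12 := h3 2
    simp only [Matrix.cons_val] at h01 h02 h12
    fin_cases a <;> fin_cases b
    exacts [h2 _, h01, h02, h1 _ _ h01, h2 _, h12, h1 _ _ h02, h1 _ _ h12, h2 _]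
  have key : ∀ a b c d, s ![a, b, c, d] = t ![a, b, c, d] := by
    intro a b
    refine hpair (fun a b => ∀ c d, s ![a, b, c, d] = t ![a, b, c, d]) ?_ ?_ ?_ a b
    · intro a b hab c d; rw [hs, ht, hab]
    · intro a c d
      have h1 := hs a a c d
      have h2 := ht a a c d
      linarith
    · intro i c d
      refine hpair (fun c d => s ![_, _, c, d] = t ![_, _, c, d]) ?_ ?_ (h i) c d
      · intro c d hcd; rw [hs', ht', hcd]
      · intro c
        have h1 := hs' (![0, 0, 1] i) (![1, 2, 2] i) c c
        have h2 := ht' (![0, 0, 1] i) (![1, 2, 2] i) c c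
        linarith
  funext a
  have ha : a = ![a 0, a 1, a 2, a 3] := by funext i; fin_cases i <;> rfl
  rw [ha]; exact key _ _ _ _

theorem knTensor_antisymm_left (c d : ℝ) (u : Fin 3 → ℝ) (i j k l : Fin 3) :
    knTensor c d u ![i, j, k, l] = -knTensor c d u ![j, i, k, l] := by
  simp only [knTensor, Matrix.cons_val]; ring

theorem knTensor_antisymm_right (c d : ℝ) (u : Fin 3 → ℝ) (i j k l : Fin 3) :
    knTensor c d u ![i, j, k, l] = -knTensor c d u ![i, j, l, k] := by
  simp only [knTensor, Matrix.cons_val]; ring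

theorem IsNullFrame.riem_eq_knTensor (h : IsNullFrame g U e) {x : M} (hx : x ∈ U) {c d : ℝ}
    {u : Fin 3 → ℝ}
    (hr : ∀ i j : Fin 3, riem g e x ![![0, 0, 1] i, ![1, 2, 2] i, ![0, 0, 1] j, ![1, 2, 2] j]
      = knTensor c d u ![![0, 0, 1] i, ![1, 2, 2] i, ![0, 0, 1] j, ![1, 2, 2] j]) :
    riem g e x = knTensor c d u :=
  tensor_four_ext (h.riem_antisymm_left hx) (riem_antisymm_right g e x)
    (knTensor_antisymm_left c d u) (knTensor_antisymm_right c d u) hr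

/-- A null frame in which the first order jet of the curvature has the canonical form. -/
def IsPreCanonical (g : LorentzMetric M) (T C : ℝ) (U : Set M) (e : Triad M) : Prop :=
  IsNullFrame g U e ∧ ∀ x ∈ U, nablaRiem g e 0 x = jet0 T C ∧ nablaRiem g e 1 x = jet1 T C

theorem dirDeriv_conn_020 (h : IsNullFrame g U e) {x : M} (hx : x ∈ U) (c : Fin 3) :
    dirDeriv (e c) (conn g e 0 2 0) x = 2 * dirDeriv (e c) (epsilon g e) x := by
  have h1 : conn g e 0 2 0 = fun y => 2 * epsilon g e y := by
    funext y; simp only [epsilon]; ring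
  have h2 : ContMDiffOn 𝓘(ℝ, E3) 𝓘(ℝ, ℝ) ∞ (epsilon g e) U := by
    have := (h.contMDiffOn_conn 0 2 0).div_const 2
    exact this
  rw [h1, h.dirDeriv_const_mul hx 2 h2]

/-- The canonical connection produces the canonical curvature jet. -/
theorem isPreCanonical_of_connection {T C : ℝ} (h : IsNullFrame g U e)
    (hA : ∀ x ∈ U, ∀ c, conn g e 0 1 c x = ![1, 0, T] c)
    (hB : ∀ x ∈ U, ∀ c, conn g e 1 2 c x = ![T, 0, 0] c)
    (hE1 : ∀ x ∈ U, conn g e 0 2 1 x = 0) (hE2 : ∀ x ∈ U, conn g e 0 2 2 x = 0)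
    (h1 : ∀ x ∈ U, dirDeriv (e 1) (epsilon g e) x = -T * epsilon g e x)
    (h2 : ∀ x ∈ U, dirDeriv (e 2) (epsilon g e) x = C) : IsPreCanonical g T C U e := by
  have hcU : ∀ x ∈ U, (fun a b c => connUp g e a b c x)
      = canonConn T + epsilon g e x • upConn 0 ![2, 0, 0] 0 := by
    intro x hx
    rw [connUp_eq_upConn, canonConn]
    have hE0 : conn g e 0 2 0 x = 2 * epsilon g e x := by simp only [epsilon]; ring
    funext a b c
    simp only [hA x hx, hB x hx]
    fin_cases a <;> fin_cases b <;> fin_cases c <;> simp [upConn, hE0, hE1 x hx, hE2 x hx] <;> ring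
  have h0 : ∀ x ∈ U, riem g e x = jet0 T C := by
    intro x hx
    have d1 := h1 x hx
    have d2 := h2 x hx
    have hdA : ∀ v c, dirDeriv v (conn g e 0 1 c) x = 0 := fun v c =>
      h.dirDeriv_of_const hx (fun y hy => hA y hy c) v
    have hdB : ∀ v c, dirDeriv v (conn g e 1 2 c) x = 0 := fun v c =>
      h.dirDeriv_of_const hx (fun y hy => hB y hy c) v
    have hdE1 : ∀ v, dirDeriv v (conn g e 0 2 1) x = 0 := fun v =>
      h.dirDeriv_of_const hx hE1 v
    have hdE2 : ∀ v, dirDeriv v (conn g e 0 2 2) x = 0 := fun v =>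
      h.dirDeriv_of_const hx hE2 v
    have hE0 : conn g e 0 2 0 x = 2 * epsilon g e x := by simp only [epsilon]; ring
    refine h.riem_eq_knTensor hx fun i j => ?_
    fin_cases i <;> fin_cases j <;>
      simp [h.riem_01 hx, h.riem_02 hx, h.riem_12 hx, hdA, hdB, hdE1, hdE2, hA x hx, hB x hx,
        hE1 x hx, hE2 x hx, hE0, Fin.sum_univ_three, lieCoeff, upConn, knTensor, eta, omega1,
        dirDeriv_conn_020 h hx, d1, d2] <;> ring
  refine ⟨h, fun x hx => ⟨h0 x hx, ?_⟩⟩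
  -- The part of the connection that contains ε is a boost and annihilates the boost invariant
  -- curvature.
  rw [show nablaRiem g e 1 x = covDeriv g e (riem g e) x from rfl,
    covDeriv_const h h0 hx, hcU x hx, covAct_add, covAct_smul, jet0,
    (knTensor_weightZero _ _).covAct_boost, smul_zero, add_zero]
  rfl

namespace IsPreCanonical

variable {T C : ℝ}

theorem mono (h : IsPreCanonical g T C U e) {W : Set M} (hW : IsOpen W) (hWU : W ⊆ U) :
    IsPreCanonical g T C W e := ⟨h.1.mono hW hWU, fun x hx => h.2 x (hWU hx)⟩

theorem covAct_jet0 (h : IsPreCanonical g T C U e) {x : M} (hx : x ∈ U) :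
    covAct (fun a b c => connUp g e a b c x) (jet0 T C) = jet1 T C := by
  rw [← (h.2 x hx).2]
  exact (covDeriv_const h.1 (fun y hy => (h.2 y hy).1) hx).symm

/-- The component (2,0,0,1,c) of ∇R is -2d Γ_{01c}, and d = -(C + 2T²) is invertible. The companion
lemma for Γ_12 uses (0,2,2,1,c). -/
theorem conn_01 (h : IsPreCanonical g T C U e) (hne : C + 2 * T ^ 2 ≠ 0) {x : M} (hx : x ∈ U)
    (c : Fin 3) : conn g e 0 1 c x = ![1, 0, T] c := by
  have h1 := congrFun (h.covAct_jet0 hx) ![2, 0, 0, 1, c]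
  rw [jet1_01, connUp_eq_upConn, jet0, covAct_knTensor_01] at h1
  have : (2 * (C + 2 * T ^ 2)) * (conn g e 0 1 c x - ![1, 0, T] c) = 0 := by
    linear_combination h1
  have := (mul_eq_zero.mp this).resolve_left (by simpa using hne)
  linarith

theorem conn_12 (h : IsPreCanonical g T C U e) (hne : C + 2 * T ^ 2 ≠ 0) {x : M} (hx : x ∈ U)
    (c : Fin 3) : conn g e 1 2 c x = ![T, 0, 0] c := by
  have h1 := congrFun (h.covAct_jet0 hx) ![0, 2, 2, 1, c]
  rw [jet1_12, connUp_eq_upConn, jet0, covAct_knTensor_12] at h1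
  have : (2 * (C + 2 * T ^ 2)) * (conn g e 1 2 c x - ![T, 0, 0] c) = 0 := by
    linear_combination -h1
  have := (mul_eq_zero.mp this).resolve_left (by simpa using hne)
  linarith

theorem dirDeriv_conn_01 (h : IsPreCanonical g T C U e) (hne : C + 2 * T ^ 2 ≠ 0) {x : M}
    (hx : x ∈ U) (v) (c : Fin 3) : dirDeriv v (conn g e 0 1 c) x = 0 :=
  h.1.dirDeriv_of_const hx (fun y hy => h.conn_01 hne hy c) v

/-- With Γ_01 and Γ_12 known and constant, R_0101 = 0 is an equation for Γ_{021} alone. In the same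
way R_0102 gives Γ_{022}, R_0201 gives δε and R_0202 gives Δε. -/
theorem conn_021 (h : IsPreCanonical g T C U e) (hne : C + 2 * T ^ 2 ≠ 0) {x : M}
    (hx : x ∈ U) : conn g e 0 2 1 x = 0 := by
  have h1 := congrFun (h.2 x hx).1 ![0, 1, 0, 1]
  rw [show nablaRiem g e 0 x = riem g e x from rfl, h.1.riem_01 hx] at h1
  simp [h.dirDeriv_conn_01 hne hx, h.conn_01 hne hx, h.conn_12 hne hx, Fin.sum_univ_three,
    lieCoeff, upConn, jet0, knTensor, eta, omega1] at h1
  linarith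

theorem conn_022 (h : IsPreCanonical g T C U e) (hne : C + 2 * T ^ 2 ≠ 0) {x : M}
    (hx : x ∈ U) : conn g e 0 2 2 x = 0 := by
  have h1 := congrFun (h.2 x hx).1 ![0, 1, 0, 2]
  rw [show nablaRiem g e 0 x = riem g e x from rfl, h.1.riem_01 hx] at h1
  simp [h.dirDeriv_conn_01 hne hx, h.conn_01 hne hx, h.conn_12 hne hx, Fin.sum_univ_three,
    lieCoeff, upConn, jet0, knTensor, eta, omega1] at h1
  linarith

theorem conn_020 (g : LorentzMetric M) (e : Triad M) (x : M) :
    conn g e 0 2 0 x = 2 * epsilon g e x := by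
  simp only [epsilon]; ring

theorem dirDeriv_epsilon_1 (h : IsPreCanonical g T C U e) (hne : C + 2 * T ^ 2 ≠ 0) {x : M}
    (hx : x ∈ U) : dirDeriv (e 1) (epsilon g e) x = -T * epsilon g e x := by
  have h1 := congrFun (h.2 x hx).1 ![0, 2, 0, 1]
  rw [show nablaRiem g e 0 x = riem g e x from rfl, h.1.riem_02 hx] at h1
  have hE1 := h.1.dirDeriv_of_const hx (fun y hy => h.conn_021 hne hy)
  simp [h.conn_01 hne hx, h.conn_12 hne hx, h.conn_021 hne hx, h.conn_022 hne hx,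
    dirDeriv_conn_020 h.1 hx, conn_020, hE1, Fin.sum_univ_three,
    lieCoeff, upConn, jet0, knTensor, eta, omega1] at h1
  linarith

theorem dirDeriv_epsilon_2 (h : IsPreCanonical g T C U e) (hne : C + 2 * T ^ 2 ≠ 0) {x : M}
    (hx : x ∈ U) : dirDeriv (e 2) (epsilon g e) x = C := by
  have h1 := congrFun (h.2 x hx).1 ![0, 2, 0, 2]
  rw [show nablaRiem g e 0 x = riem g e x from rfl, h.1.riem_02 hx] at h1
  have hE1 := h.1.dirDeriv_of_const hx (fun y hy => h.conn_022 hne hy)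
  simp [h.conn_01 hne hx, h.conn_12 hne hx, h.conn_021 hne hx, h.conn_022 hne hx,
    dirDeriv_conn_020 h.1 hx, conn_020, hE1, Fin.sum_univ_three,
    lieCoeff, upConn, jet0, knTensor, eta, omega1] at h1
  linarith

theorem connUp_eq (h : IsPreCanonical g T C U e) (hne : C + 2 * T ^ 2 ≠ 0) {x : M}
    (hx : x ∈ U) : (fun a b c => connUp g e a b c x)
      = canonConn T + epsilon g e x • upConn 0 ![2, 0, 0] 0 := by
  rw [connUp_eq_upConn, canonConn]
  funext a b c
  simp only [h.conn_01 hne hx, h.conn_12 hne hx]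
  fin_cases a <;> fin_cases b <;> fin_cases c <;>
    simp [upConn, conn_020, h.conn_021 hne hx, h.conn_022 hne hx] <;> ring

/-- ∇R is constant, so the next derivative is algebraic in the connection, whose only variable part
is the boost with coefficient ε. -/
theorem nablaRiem_two (h : IsPreCanonical g T C U e) (hne : C + 2 * T ^ 2 ≠ 0) {x : M}
    (hx : x ∈ U) : nablaRiem g e 2 x = jet2 T C (epsilon g e x) := by
  have := covDeriv_const h.1 (fun y hy => (h.2 y hy).2) hx
  rw [h.connUp_eq hne hx, covAct_add, covAct_smul] at this
  exact this

/-- The reflection preserves the canonical first order jet. -/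
theorem flip (h : IsPreCanonical g T C U e) : IsPreCanonical g T C U (e.act flipGL) := by
  refine ⟨h.1.act flipGL_mem, fun x hx => ⟨?_, ?_⟩⟩
  · rw [nablaRiem_act h.1 flipGL_mem hx, coe_flipGL, (h.2 x hx).1, pullTensor_flip_jet0]
  · rw [nablaRiem_act h.1 flipGL_mem hx, coe_flipGL, (h.2 x hx).2]
    exact pullTensor_flip_jet1 T C

theorem contMDiffOn_epsilon (h : IsPreCanonical g T C U e) :
    ContMDiffOn 𝓘(ℝ, E3) 𝓘(ℝ, ℝ) ∞ (epsilon g e) U := by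
  have := (h.1.contMDiffOn_conn 0 2 0).div_const 2
  exact this

variable {T' C' : ℝ} {U' : Set M} {e' : Triad M}

theorem epsilon_eq_of_jet2 {ε ε' : ℝ} (hne : C + 2 * T ^ 2 ≠ 0)
    (h : jet2 T C ε = jet2 T C ε') : ε = ε' := by
  have h1 := congrFun h ![2, 0, 0, 1, 0, 0]
  rw [jet2_apply, jet2_apply] at h1
  exact mul_left_cancel₀ (mul_ne_zero (by norm_num) hne) h1

/-- Two frames with canonical first order jets agree up to the reflection. -/
theorem unique (h : IsPreCanonical g T C U e) (h' : IsPreCanonical g T' C' U' e')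
    (hne : C + 2 * T ^ 2 ≠ 0) {x : M} (hx : x ∈ U) (hx' : x ∈ U') : T = T' ∧ C = C' ∧
      (((∀ a, e' a x = e a x) ∧ epsilon g e' x = epsilon g e x) ∨
        ((∀ a, e' a x = e.act flipGL a x) ∧ epsilon g e' x = -epsilon g e x)) := by
  obtain ⟨Y, hY, hYe⟩ := exists_frame_change h.1 h'.1 hx hx'
  have hj := fun j => nablaRiem_change h.1 h'.1 hx hx' hYe j
  have h0 := hj 0
  have h1 := hj 1
  have h2 := hj 2
  rw [(h.2 x hx).1, (h'.2 x hx').1] at h0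
  rw [(h.2 x hx).2, (h'.2 x hx').2] at h1
  obtain ⟨rfl, rfl, hY1⟩ := jet_stabilizer hY hne h0.symm h1.symm
  -- The first order jets leave only Y = 1 or the reflection; the second order jets then compare the
  -- values of ε.
  rw [h.nablaRiem_two hne hx, h'.nablaRiem_two hne hx'] at h2
  refine ⟨rfl, rfl, ?_⟩
  rcases hY1 with hY1 | hY1
  · left
    rw [hY1] at hYe h2
    have hid : ∀ a, e' a x = e a x := by
      intro a
      rw [hYe]
      simp [Matrix.one_apply]
    refine ⟨hid, epsilon_eq_of_jet2 hne (h2.trans ?_)⟩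
    rw [← h.nablaRiem_two hne hx]
    refine (nablaRiem_change h.1 h.1 hx hx (Y := 1) (fun b => ?_) 2).symm
    simp [Matrix.one_apply]
  · right
    rw [hY1] at hYe h2
    exact ⟨fun a => hYe a, epsilon_eq_of_jet2 hne (h2.trans (pullTensor_flip_jet2 _ _ _))⟩

/-- The sign is read off from ∇²R, where the reflection acts by ε ↦ -ε. -/
theorem epsilon_flip (h : IsPreCanonical g T C U e) (hne : C + 2 * T ^ 2 ≠ 0) {x : M}
    (hx : x ∈ U) : epsilon g (e.act flipGL) x = -epsilon g e x := by
  have h2 := nablaRiem_act h.1 flipGL_mem hx 2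
  rw [h.nablaRiem_two hne hx, h.flip.nablaRiem_two hne hx] at h2
  exact epsilon_eq_of_jet2 hne (h2.trans (pullTensor_flip_jet2 _ _ _))

/-- A frame with canonical first order jet and `ε > 0` is canonical. -/
theorem isCanonicalFrame (h : IsPreCanonical g T C U e) (hne : C + 2 * T ^ 2 ≠ 0)
    (hpos : ∀ x ∈ U, 0 < epsilon g e x) : IsCanonicalFrame g T C U e := by
  refine ⟨h.1, fun x hx => ?_, fun x hx => ?_, fun x hx =>
    ⟨h.dirDeriv_epsilon_1 hne hx, h.dirDeriv_epsilon_2 hne hx, hpos x hx⟩⟩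
  · have hr : riem g e x = jet0 T C := (h.2 x hx).1
    have hR : scalarCurv g e x = 4 * (C - T ^ 2) := by
      simp [scalarCurv, ricci_eq, hr, jet0, knTensor, eta, etaInv, omega1, Fin.sum_univ_three]
      ring
    refine ⟨?_, ?_, ?_, ?_, ?_, hR⟩ <;>
      simp [Psi0, Psi1, Psi2, Psi3, Psi4, tfRicci, hR, ricci_eq, hr, jet0, knTensor, eta,
        omega1] <;> ring
  · have hA := h.conn_01 hne hx
    have hB := h.conn_12 hne hx
    have h1 := h.conn_021 hne hx
    have h2 := h.conn_022 hne hx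
    refine ⟨?_, ?_, ?_, ?_, ?_, ?_, ?_, ?_⟩ <;>
      simp [sigma, alpha, gamma, lam, nu, varpi, tau, kappa, hA, hB, h1, h2]

end IsPreCanonical

/-- By the structure equations the connection and the derivatives of ε already determine R and ∇R.
-/
theorem IsCanonicalFrame.isPreCanonical {T C : ℝ} (h : IsCanonicalFrame g T C U e) :
    IsPreCanonical g T C U e := by
  refine isPreCanonical_of_connection h.isNullFrame ?_ ?_ ?_ ?_ (fun x hx => (h.derivatives x hx).1)
    (fun x hx => (h.derivatives x hx).2.1)
  all_goals
    intro x hx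
    obtain ⟨h1, h2, h3, h4, h5, h6, h7, h8⟩ := h.connection x hx
    simp only [sigma, alpha, gamma, lam, nu, varpi, tau, kappa] at *
  · intro c; fin_cases c <;> simp [*]
  · intro c; fin_cases c <;> simp [*]
  · linarith
  · linarith

theorem IsCanonicalFrame.epsilon_pos {T C : ℝ} (h : IsCanonicalFrame g T C U e) {x : M}
    (hx : x ∈ U) : 0 < epsilon g e x := (h.derivatives x hx).2.2

/-- Uniqueness of the constants and of the canonical frame. -/
theorem IsCanonicalFrame.unique {T C T' C' : ℝ} {U' : Set M} {e' : Triad M}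
    (h : IsCanonicalFrame g T C U e) (h' : IsCanonicalFrame g T' C' U' e')
    (hne : C + 2 * T ^ 2 ≠ 0) {x : M} (hx : x ∈ U) (hx' : x ∈ U') :
    T = T' ∧ C = C' ∧ ∀ a, e' a x = e a x := by
  obtain ⟨h1, h2, ⟨h3, -⟩ | ⟨-, h3⟩⟩ := h.isPreCanonical.unique h'.isPreCanonical hne hx hx'
  · exact ⟨h1, h2, h3⟩
  · have := h.epsilon_pos hx
    have := h'.epsilon_pos hx'
    linarith

end Geometry

/-! ### Explicit normalizing cross-sections -/

section CrossSection

theorem tensorAct_mul {k : ℕ} (X Y : GL (Fin 3) ℝ) (t : Tensor k) :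
    tensorAct (X * Y) t = tensorAct X (tensorAct Y t) := by
  funext a
  simp only [tensorAct, mul_inv_rev, Units.val_mul, Finset.mul_sum]
  rw [Finset.sum_comm]
  refine Finset.sum_congr rfl fun c _ => ?_
  simp only [← mul_assoc, ← Finset.sum_mul, Matrix.mul_apply]
  rw [Finset.prod_univ_sum, Fintype.piFinset_univ]
  congr 1
  refine Finset.sum_congr rfl fun b _ => ?_
  rw [Finset.prod_mul_distrib, mul_comm]

theorem tensorAct_one {k : ℕ} (t : Tensor k) : tensorAct 1 t = t := by
  have h := tensorAct_inv (1 : GL (Fin 3) ℝ) t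
  rw [inv_one] at h
  rw [h]
  funext a
  rw [pullTensor_monomial (f := id) (d := fun _ => 1) (fun p q => by
    simp [Matrix.one_apply])]
  simp

theorem jetAct_mul {p : ℕ} (X Y : GL (Fin 3) ℝ) (s : CurvJet p) :
    jetAct (X * Y) s = jetAct X (jetAct Y s) := by
  funext j; exact tensorAct_mul X Y (s j)

theorem jetAct_one {p : ℕ} (s : CurvJet p) : jetAct 1 s = s := by
  funext j; exact tensorAct_one (s j)

/-- The pointwise stabilizer in `O(η)` of a set of curvature jets. -/
def jetFixer {p : ℕ} (S : Set (CurvJet p)) : Subgroup (GL (Fin 3) ℝ) where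
  carrier := {X | X ∈ Oeta ∧ ∀ s ∈ S, jetAct X s = s}
  mul_mem' := by
    rintro X Y ⟨hX, hX'⟩ ⟨hY, hY'⟩
    exact ⟨Oeta.mul_mem hX hY, fun s hs => by rw [jetAct_mul, hY' s hs, hX' s hs]⟩
  one_mem' := ⟨Oeta.one_mem, fun s _ => jetAct_one s⟩
  inv_mem' := by
    rintro X ⟨hX, hX'⟩
    refine ⟨Oeta.inv_mem hX, fun s hs => ?_⟩
    conv_lhs => rw [← hX' s hs]
    rw [← jetAct_mul, inv_mul_cancel, jetAct_one]

/-- A translation straightens an open piece of an affine subspace. -/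
theorem isSubmanifold_affine {F : Type*} [NormedAddCommGroup F] [NormedSpace ℝ F]
    (L : Submodule ℝ F) (c : F) {O : Set F} (hO : IsOpen O) :
    IsSubmanifold {s | s - c ∈ L ∧ s ∈ O} := by
  refine ⟨L, fun s hs => ?_⟩
  let φ : OpenPartialHomeomorph F F :=
    ((Homeomorph.addRight (-c)).toOpenPartialHomeomorph).restrOpen O hO
  have hsrc : φ.source = O := by simp [φ]
  have happ : ∀ y, φ y = y - c := fun y => by simp [φ, sub_eq_add_neg]
  have hsymm : ∀ y, φ.symm y = y + c := fun y =>
    (show φ.symm y = y + -(-c) from rfl).trans (by rw [neg_neg])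
  refine ⟨φ, by rw [hsrc]; exact hs.2, ?_, ?_, ?_⟩
  · exact ((contDiff_id.sub contDiff_const).contDiffOn).congr fun y _ => happ y
  · exact ((contDiff_id.add contDiff_const).contDiffOn).congr fun y _ => hsymm y
  · ext y
    constructor
    · rintro ⟨z, ⟨hz, hz'⟩, rfl⟩
      exact ⟨by rw [happ]; exact hz.1, φ.map_source hz'⟩
    · rintro ⟨hy, hy'⟩
      have h1 := φ.map_target hy'
      refine ⟨φ.symm y, ⟨⟨?_, hsrc ▸ h1⟩, h1⟩, φ.right_inv hy'⟩
      rw [hsymm, add_sub_cancel_right]; exact hy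

/-- The constant components of the canonical curvature jets. -/
def constJet (T C : ℝ) : (j : ℕ) → Tensor (4 + j)
  | 0 => jet0 T C
  | 1 => jet1 T C
  | _ + 2 => 0

/-- The sign condition on the second derivative of the curvature that orients the frame. -/
def jetSign (T C : ℝ) : (j : ℕ) → Set (Tensor (4 + j))
  | 0 => Set.univ
  | 1 => Set.univ
  | 2 => {t | 0 < -(C + 2 * T ^ 2) * t ![2, 0, 0, 1, 0, 0]}
  | _ + 3 => Set.univ

theorem isOpen_jetSign (T C : ℝ) (j : ℕ) : IsOpen (jetSign T C j) := by
  match j with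
  | 0 => exact isOpen_univ
  | 1 => exact isOpen_univ
  | 2 => exact isOpen_lt continuous_const (continuous_const.mul (continuous_apply _))
  | _ + 3 => exact isOpen_univ

/-- The normalizing cross-sections of the canonical configuration. -/
def crossSection (T C : ℝ) (p : ℕ) : Set (CurvJet p) :=
  {s | (∀ j : Fin (p + 1), (j : ℕ) ≤ 1 → s j = constJet T C j) ∧
    ∀ j : Fin (p + 1), s j ∈ jetSign T C j}

theorem isSubmanifold_crossSection (T C : ℝ) (p : ℕ) : IsSubmanifold (crossSection T C p) := by
  let L : Submodule ℝ (CurvJet p) :=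
    { carrier := {s | ∀ j : Fin (p + 1), (j : ℕ) ≤ 1 → s j = 0}
      add_mem' := fun {s t} hs ht j hj => by rw [Pi.add_apply, hs j hj, ht j hj, add_zero]
      zero_mem' := fun j _ => rfl
      smul_mem' := fun r s hs j hj => by rw [Pi.smul_apply, hs j hj, smul_zero] }
  have hO : IsOpen {s : CurvJet p | ∀ j : Fin (p + 1), s j ∈ jetSign T C j} := by
    rw [Set.ofPred_forall]
    exact isOpen_iInter_of_finite fun j =>
      (isOpen_jetSign T C j).preimage (continuous_apply j)
  have := isSubmanifold_affine L (fun j => constJet T C j) hO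
  convert this using 1
  ext s
  refine and_congr (forall_congr' fun j => forall_congr' fun _ => ?_) Iff.rfl
  exact sub_eq_zero.symm

/-- For p < 2 the cross-section is a single point. For p ≥ 2 the first order jet leaves only the
identity and the reflection, and the reflection violates the sign condition on ∇²R. Jets of order
above two need no restriction. -/
theorem crossSection_fix {T C : ℝ} (hne : C + 2 * T ^ 2 ≠ 0) (p : ℕ) {X : GL (Fin 3) ℝ}
    (hX : X ∈ Oeta) {s : CurvJet p} (hs : s ∈ crossSection T C p)
    (hXs : jetAct X s ∈ crossSection T C p) : ∀ t ∈ crossSection T C p, jetAct X t = t := by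
  intro t ht
  rcases Nat.lt_or_ge p 2 with hp | hp
  · have hsub : ∀ u ∈ crossSection T C p, u = t := by
      intro u hu
      funext j
      have hj : (j : ℕ) ≤ 1 := by have := j.2; omega
      rw [hu.1 j hj, ht.1 j hj]
    have h1 := hsub _ hXs
    rwa [hsub s hs] at h1
  · have hact : ∀ j, jetAct X s j
        = pullTensor ((X⁻¹ : GL (Fin 3) ℝ) : Matrix (Fin 3) (Fin 3) ℝ) (s j) := by
      intro j
      rw [← tensorAct_inv, inv_inv]; rfl
    have e0 := hXs.1 ⟨0, by omega⟩ (by simp)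
    have e1 := hXs.1 ⟨1, by omega⟩ (by simp)
    have e2 := hXs.2 ⟨2, by omega⟩
    have f2 := hs.2 ⟨2, by omega⟩
    rw [hact, hs.1 _ (by simp)] at e0 e1
    rw [hact] at e2
    obtain ⟨-, -, h | h⟩ := jet_stabilizer (mem_Oeta.mp (Oeta.inv_mem hX)) hne e0 e1
    · have hX1 : X⁻¹ = 1 := Units.ext h
      rw [inv_eq_one.mp hX1, jetAct_one]
    · exfalso
      rw [h] at e2
      have e2' : 0 < -(C + 2 * T ^ 2) * pullTensor flipMatrix (s ⟨2, by omega⟩)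
        ![2, 0, 0, 1, 0, 0] := e2
      have f2' : 0 < -(C + 2 * T ^ 2) * s ⟨2, by omega⟩ ![2, 0, 0, 1, 0, 0] := f2
      rw [pullTensor_flip] at e2'
      have hp : ∏ i, flipSign ((![2, 0, 0, 1, 0, 0] : Fin 6 → Fin 3) i) = -1 := by
        simp [Fin.prod_univ_succ, flipSign]
      have hp' : ∏ i : Fin (4 + 2), flipSign ((![2, 0, 0, 1, 0, 0] : Fin 6 → Fin 3) i) = -1 := hp
      rw [hp'] at e2'
      linarith

theorem finrank_range_toSpanSingleton_comp {V F : Type*} [AddCommGroup V] [Module ℝ V]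
    [AddCommGroup F] [Module ℝ F] {w : F} (hw : w ≠ 0) {φ : V →ₗ[ℝ] ℝ} (hφ : φ ≠ 0) :
    Module.finrank ℝ (LinearMap.range ((LinearMap.toSpanSingleton ℝ F w) ∘ₗ φ)) = 1 := by
  rw [LinearMap.range_comp_of_range_eq_top _ (LinearMap.range_eq_top.mpr
    (LinearMap.surjective hφ)), LinearMap.range_toSpanSingleton, finrank_span_singleton hw]

end CrossSection

/-! ### The converse: ranks and Petrov type of the canonical configuration -/

section Geometry

variable {M : Type*} [TopologicalSpace M] [ChartedSpace E3 M] [IsManifold 𝓘(ℝ, E3) ∞ M]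
variable {g : LorentzMetric M} {U : Set M} {e : Triad M} {T C : ℝ}

theorem IsCanonicalFrame.curvJet_mem (h : IsCanonicalFrame g T C U e)
    (hne : C + 2 * T ^ 2 ≠ 0) (p : ℕ) {x : M} (hx : x ∈ U) :
    curvJet g e p x ∈ crossSection T C p := by
  have hp := h.isPreCanonical
  constructor
  · rintro ⟨j, hj⟩ hj1
    change nablaRiem g e j x = constJet T C j
    change j ≤ 1 at hj1
    interval_cases j
    · exact (hp.2 x hx).1
    · exact (hp.2 x hx).2
  · rintro ⟨j, hj⟩
    change nablaRiem g e j x ∈ jetSign T C j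
    match j with
    | 0 => trivial
    | 1 => trivial
    | 2 =>
      have h1 : nablaRiem g e 2 x ![2, 0, 0, 1, 0, 0]
          = -8 * (C + 2 * T ^ 2) * epsilon g e x := by
        rw [hp.nablaRiem_two hne hx]; exact jet2_apply _ _ _
      change 0 < -(C + 2 * T ^ 2) * nablaRiem g e 2 x ![2, 0, 0, 1, 0, 0]
      rw [h1]
      -- The quantity in the sign condition equals 8(C + 2T²)² ε, whatever the sign of C + 2T².
      have h2 := mul_pos (sq_pos_of_ne_zero hne) (h.epsilon_pos hx)
      linarith
    | _ + 3 => trivial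

/-- Frames normalized by the canonical cross-sections have the canonical first order jet. -/
theorem IsNormalizedFrame.isPreCanonical {p : ℕ} (hp : 1 ≤ p)
    (h : IsNormalizedFrame g p (crossSection T C p) U e) : IsPreCanonical g T C U e :=
  ⟨h.1, fun x hx => ⟨(h.2 x hx).1 ⟨0, by omega⟩ (by simp), (h.2 x hx).1 ⟨1, by omega⟩ (by simp)⟩⟩

theorem IsNormalizedFrame.epsilon_pos (hne : C + 2 * T ^ 2 ≠ 0)
    (h : IsNormalizedFrame g 2 (crossSection T C 2) U e) {x : M} (hx : x ∈ U) :
    0 < epsilon g e x := by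
  have hp := h.isPreCanonical (by norm_num)
  have h2 : 0 < -(C + 2 * T ^ 2) * nablaRiem g e 2 x ![2, 0, 0, 1, 0, 0] :=
    (h.2 x hx).2 ⟨2, by omega⟩
  have h1 : nablaRiem g e 2 x ![2, 0, 0, 1, 0, 0]
      = -8 * (C + 2 * T ^ 2) * epsilon g e x := by
    rw [hp.nablaRiem_two hne hx]; exact jet2_apply _ _ _
  rw [h1] at h2
  have h3 := sq_pos_of_ne_zero hne
  by_contra hn
  have h4 := mul_nonneg h3.le (neg_nonneg.mpr (not_lt.mp hn))
  linarith

theorem isNormalizingCrossSection_crossSection (hne : C + 2 * T ^ 2 ≠ 0)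
    (hcan : ∀ x : M, ∃ (U : Set M) (e : Triad M), x ∈ U ∧ IsCanonicalFrame g T C U e) (p : ℕ) :
    IsNormalizingCrossSection g p (crossSection T C p) := by
  refine ⟨isSubmanifold_crossSection T C p, ⟨jetFixer (crossSection T C p),
    fun X hX => hX.1, fun X hX s hs => hX.2 s hs, ?_⟩, fun x => ?_⟩
  · rintro X hX ⟨_, ⟨s, hs, rfl⟩, hs'⟩
    exact ⟨hX, crossSection_fix hne p hX hs hs'⟩
  · obtain ⟨U, e, hx, h⟩ := hcan x
    exact ⟨U, e, hx, h.isNullFrame, fun y hy => h.curvJet_mem hne p hy⟩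

/-- The first order cross-section is one point, so R^{(1)} is constant in normalized frames. -/
theorem hasHorizontalRank_one (hne : C + 2 * T ^ 2 ≠ 0)
    (hcan : ∀ x : M, ∃ (U : Set M) (e : Triad M), x ∈ U ∧ IsCanonicalFrame g T C U e) :
    HasHorizontalRank g 1 0 := by
  refine ⟨_, isNormalizingCrossSection_crossSection hne hcan 1, fun U e h x hx => ?_⟩
  have h1 : curvJet g e 1 =ᶠ[nhds x] fun _ j => constJet T C j := by
    filter_upwards [h.1.isOpen.mem_nhds hx] with y hy
    funext j
    exact (h.2 y hy).1 j (by omega)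
  rw [h1.mfderiv_eq, mfderiv_const]
  exact (congrArg (fun L : Submodule ℝ (CurvJet 1) => Module.finrank ℝ L)
    LinearMap.range_zero).trans (finrank_bot ℝ _)

/-- In normalized frames R^{(2)} = S + ε w' with constant S and w' ≠ 0, so its differential is dε
times w' and the rank is one if dε ≠ 0. -/
theorem hasHorizontalRank_two (hne : C + 2 * T ^ 2 ≠ 0)
    (hcan : ∀ x : M, ∃ (U : Set M) (e : Triad M), x ∈ U ∧ IsCanonicalFrame g T C U e) :
    HasHorizontalRank g 2 1 := by
  refine ⟨_, isNormalizingCrossSection_crossSection hne hcan 2, fun U e h x hx => ?_⟩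
  have hp := h.isPreCanonical (by norm_num)
  let s : (j : ℕ) → Tensor (4 + j)
    | 0 => jet0 T C
    | 1 => jet1 T C
    | 2 => covAct (canonConn T) (jet1 T C)
    | _ + 3 => 0
  let w : (j : ℕ) → Tensor (4 + j)
    | 0 => 0
    | 1 => 0
    | 2 => covAct (upConn 0 ![2, 0, 0] 0) (jet1 T C)
    | _ + 3 => 0
  let S : CurvJet 2 := fun j => s j
  let w' : CurvJet 2 := fun j => w j
  have hw : w' ≠ 0 := by
    intro h0
    have h1 : covAct (upConn 0 ![2, 0, 0] 0) (jet1 T C) = 0 := congrFun h0 2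
    have h2 := congrFun (show jet2 T C 1 = jet2 T C 0 by rw [jet2, jet2, h1, smul_zero, smul_zero])
      ![2, 0, 0, 1, 0, 0]
    rw [jet2_apply, jet2_apply] at h2
    apply hne; linarith
  have h1 : curvJet g e 2 =ᶠ[nhds x] fun y => S + epsilon g e y • w' := by
    filter_upwards [h.1.isOpen.mem_nhds hx] with y hy
    funext j
    fin_cases j
    · exact ((hp.2 y hy).1).trans (by simp [S, w', s, w])
    · exact ((hp.2 y hy).2).trans (by simp [S, w', s, w])
    · exact hp.nablaRiem_two hne hy
  have hε : MDifferentiableAt 𝓘(ℝ, E3) 𝓘(ℝ, ℝ) (epsilon g e) x :=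
    smoothFun_mdifferentiableAt h.1.isOpen hp.contMDiffOn_epsilon hx
  have hF : HasFDerivAt (fun r : ℝ => S + r • w')
      (ContinuousLinearMap.toSpanSingleton ℝ w') (epsilon g e x) := by
    have := ((ContinuousLinearMap.toSpanSingleton ℝ w').hasFDerivAt
      (x := epsilon g e x)).const_add S
    simpa using this
  have hd := (hF.hasMFDerivAt.comp x hε.hasMFDerivAt).mfderiv
  rw [h1.mfderiv_eq]
  -- dε = 0 would give C = Δε = 0 and, since ε > 0, also T = 0.
  have hne1 : (mfderiv 𝓘(ℝ, E3) 𝓘(ℝ, ℝ) (epsilon g e) x).toLinearMap ≠ 0 := by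
    intro h0
    have hz : ∀ a, dirDeriv (e a) (epsilon g e) x = 0 := fun a =>
      congrFun (congrArg DFunLike.coe h0) (e a x)
    have k1 := hp.dirDeriv_epsilon_1 hne hx
    have k2 := hp.dirDeriv_epsilon_2 hne hx
    rw [hz] at k1 k2
    have k3 : T = 0 := by
      have := h.epsilon_pos hne hx
      have h4 : T * epsilon g e x = 0 := by linarith
      exact (mul_eq_zero.mp h4).resolve_right this.ne'
    rw [← k2, k3] at hne
    norm_num at hne
  exact (congrArg (fun L : E3 →L[ℝ] CurvJet 2 => Module.finrank ℝ (LinearMap.range L.toLinearMap))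
    hd).trans (finrank_range_toSpanSingleton_comp hw hne1)

/-- The canonical frame has Ψ₄ = 0, so it is first turned by a null rotation about ℓ. Then u = (0,
1, 2) and u(v_z) = 2z(z + 1), with roots 0 and -1. -/
theorem isTypeD_of_canonical (hne : C + 2 * T ^ 2 ≠ 0)
    (hcan : ∀ x : M, ∃ (U : Set M) (e : Triad M), x ∈ U ∧ IsCanonicalFrame g T C U e) :
    IsTypeD g := by
  intro x
  obtain ⟨U, e, hx, h⟩ := hcan x
  have hX : (!![1, 1, 1; 0, 1, 2; 0, 0, 1] : Matrix (Fin 3) (Fin 3) ℝ)ᵀ * eta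
      * !![1, 1, 1; 0, 1, 2; 0, 0, 1] = eta := by
    ext i j; fin_cases i <;> fin_cases j <;>
      simp [eta, Matrix.mul_apply, Fin.sum_univ_three] <;> norm_num
  have hu : (!![1, 1, 1; 0, 1, 2; 0, 0, 1] : Matrix (Fin 3) (Fin 3) ℝ)ᵀ *ᵥ omega1
      = ![0, 1, 2] := by
    ext i; fin_cases i <;> simp [omega1, Matrix.mulVec, dotProduct, Fin.sum_univ_three]
  have hr := nablaRiem_act h.isNullFrame (orthogonalGL_mem _ hX) hx 0
  rw [(h.isPreCanonical.2 x hx).1] at hr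
  have hr' : riem g (e.act (orthogonalGL _ hX)) x
      = knTensor (2 * C + 2 * T ^ 2) (-(C + 2 * T ^ 2)) ![0, 1, 2] := by
    refine Eq.trans hr ?_
    exact (pullTensor_knTensor hX _ _ omega1).trans (by rw [hu])
  refine ⟨U, e.act (orthogonalGL _ hX), hx, h.isNullFrame.act (orthogonalGL_mem _ hX), ?_, 0, -1,
    by norm_num, fun z => ?_⟩
  · simp [Psi4, tfRicci, scalarCurv, ricci_eq, hr', knTensor, eta, etaInv, Fin.sum_univ_three]
    intro h0
    apply hne; linarith
  · simp [Psi0, Psi1, Psi2, Psi3, Psi4, tfRicci, scalarCurv, ricci_eq, hr', knTensor, eta, etaInv,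
      Fin.sum_univ_three]
    ring

end Geometry

/-! ### Adapted frames: integrability conditions and the case distinction -/

section Geometry

variable {M : Type*} [TopologicalSpace M] [ChartedSpace E3 M] [IsManifold 𝓘(ℝ, E3) ∞ M]
variable {g : LorentzMetric M} {U : Set M} {e : Triad M}

theorem Triad.act_mul (e : Triad M) (X Y : GL (Fin 3) ℝ) :
    e.act (X * Y) = (e.act X).act Y := by
  funext b x
  simp only [Triad.act, Units.val_mul, Matrix.mul_apply, Finset.sum_smul, Finset.smul_sum,
    smul_smul]
  rw [Finset.sum_comm]
  simp only [mul_comm]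

/-- A null frame in which the curvature has the canonical form of type D and, apart from the
boost part, the connection is constant. -/
structure IsAdapted (g : LorentzMetric M) (c d k s t ϖ l n : ℝ) (U : Set M) (e : Triad M) :
    Prop where
  isNullFrame : IsNullFrame g U e
  riem_eq : ∀ x ∈ U, riem g e x = knTensor c d omega1
  conn_01 : ∀ x ∈ U, ∀ i, conn g e 0 1 i x = ![k, s, t] i
  conn_12 : ∀ x ∈ U, ∀ i, conn g e 1 2 i x = ![ϖ, l, n] i

namespace IsAdapted

variable {c d k s t ϖ l n : ℝ}

theorem dirDeriv_conn_01 (h : IsAdapted g c d k s t ϖ l n U e) {x : M} (hx : x ∈ U) (v) (i) :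
    dirDeriv v (conn g e 0 1 i) x = 0 :=
  h.isNullFrame.dirDeriv_of_const hx (fun y hy => h.conn_01 y hy i) v

theorem dirDeriv_conn_12 (h : IsAdapted g c d k s t ϖ l n U e) {x : M} (hx : x ∈ U) (v) (i) :
    dirDeriv v (conn g e 1 2 i) x = 0 :=
  h.isNullFrame.dirDeriv_of_const hx (fun y hy => h.conn_12 y hy i) v

/-- The algebraic part of the structure equations. -/
theorem algebraic_equations (h : IsAdapted g c d k s t ϖ l n U e) {x : M} (hx : x ∈ U) :
    2 * k * conn g e 0 2 1 x - s * conn g e 0 2 0 x - ϖ * k + k * t - 2 * s ^ 2 = 0 ∧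
    2 * k * conn g e 0 2 2 x - 2 * s * (ϖ + t) = 0 ∧
    s * conn g e 0 2 2 x + n * k - 2 * l * s - t ^ 2 - (c / 2 + d) = 0 ∧
    l * conn g e 0 2 0 x - ϖ ^ 2 - 2 * s * l + k * n - (c / 2 + d) = 0 ∧
    2 * n * conn g e 0 2 0 x - 2 * l * (ϖ + t) = 0 ∧
    2 * n * conn g e 0 2 1 x - l * conn g e 0 2 2 x + n * ϖ - 2 * l ^ 2 - t * n = 0 := by
  -- Γ_01 and Γ_12 are constant, so no derivatives survive and Γ_02 enters linearly.
  have r := fun i j => congrFun (h.riem_eq x hx) ![0, 1, i, j]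
  have r' := fun i j => congrFun (h.riem_eq x hx) ![1, 2, i, j]
  simp only [h.isNullFrame.riem_01 hx, h.isNullFrame.riem_12 hx, h.dirDeriv_conn_01 hx,
    h.dirDeriv_conn_12 hx, h.conn_01 x hx, h.conn_12 x hx] at r r'
  have r1 := r 0 1
  have r2 := r 0 2
  have r3 := r 1 2
  have r4 := r' 0 1
  have r5 := r' 0 2
  have r6 := r' 1 2
  simp [Fin.sum_univ_three, lieCoeff, upConn, knTensor, eta, omega1] at r1 r2 r3 r4 r5 r6
  refine ⟨?_, ?_, ?_, ?_, ?_, ?_⟩ <;> linarith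

/-- The differential part of the structure equations. -/
theorem differential_equations (h : IsAdapted g c d k s t ϖ l n U e) {x : M} (hx : x ∈ U) :
    dirDeriv (e 0) (conn g e 0 2 1) x - dirDeriv (e 1) (conn g e 0 2 0) x
      = -2 * (k * l - s * ϖ) + (ϖ - conn g e 0 2 1 x) * conn g e 0 2 0 x
        + 2 * s * conn g e 0 2 1 x - k * conn g e 0 2 2 x ∧
    dirDeriv (e 0) (conn g e 0 2 2) x - dirDeriv (e 2) (conn g e 0 2 0) x
      = -c - 2 * (k * n - t * ϖ) - 2 * conn g e 0 2 0 x * conn g e 0 2 2 x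
        + 2 * (ϖ + t) * conn g e 0 2 1 x ∧
    dirDeriv (e 1) (conn g e 0 2 2) x - dirDeriv (e 2) (conn g e 0 2 1) x
      = -2 * (s * n - t * l) - n * conn g e 0 2 0 x + 2 * l * conn g e 0 2 1 x
        + (t - conn g e 0 2 1 x) * conn g e 0 2 2 x := by
  have r := fun i j => congrFun (h.riem_eq x hx) ![0, 2, i, j]
  simp only [h.isNullFrame.riem_02 hx, h.conn_01 x hx, h.conn_12 x hx] at r
  have r1 := r 0 1
  have r2 := r 0 2
  have r3 := r 1 2
  simp [Fin.sum_univ_three, lieCoeff, upConn, knTensor, eta, omega1] at r1 r2 r3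
  refine ⟨?_, ?_, ?_⟩ <;> linarith

theorem dirDeriv_linear (h : IsNullFrame g U e) {x : M} (hx : x ∈ U) {a b r : ℝ} {i j : Fin 3}
    (hab : ∀ y ∈ U, a * conn g e 0 2 i y + b * conn g e 0 2 j y = r)
    (v : (x : M) → TangentSpace 𝓘(ℝ, E3) x) :
    a * dirDeriv v (conn g e 0 2 i) x + b * dirDeriv v (conn g e 0 2 j) x = 0 := by
  have hi := h.contMDiffOn_conn 0 2 i
  have hj := h.contMDiffOn_conn 0 2 j
  rw [← h.dirDeriv_const_mul hx a hi, ← h.dirDeriv_const_mul hx b hj]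
  exact (dirDeriv_add h.isOpen v (contMDiffOn_const.mul hi) (contMDiffOn_const.mul hj)
    hx).symm.trans (h.dirDeriv_of_const hx hab v)

/-- The principal null directions are geodesic up to the flag: `σ = λ = 0`. -/
theorem shear_free (h : IsAdapted g c d k s t ϖ l n U e) (hd : d ≠ 0) {x : M} (hx : x ∈ U) :
    s = 0 ∧ l = 0 := by
  obtain ⟨h1, h2, h3, h4, h5, h6⟩ := h.algebraic_equations hx
  obtain ⟨k1, k2, k3⟩ := h.differential_equations hx
  have hN := h.isNullFrame
  -- Each algebraic equation is differentiated along a direction such that the derivatives of Γ_02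
  -- combine to the curls known from the differential equations.
  have d1 := dirDeriv_linear hN hx (a := 2 * k) (b := -s) (i := 1) (j := 0)
    (r := ϖ * k - k * t + 2 * s ^ 2) (fun y hy => by
      obtain ⟨h1, -⟩ := h.algebraic_equations hy; linarith) (e 2)
  have d2 := dirDeriv_linear hN hx (a := 2 * k) (b := 0) (i := 2) (j := 0)
    (r := 2 * s * (ϖ + t)) (fun y hy => by
      obtain ⟨-, h2, -⟩ := h.algebraic_equations hy; linarith) (e 1)
  have d3 := dirDeriv_linear hN hx (a := s) (b := 0) (i := 2) (j := 0)
    (r := -n * k + 2 * l * s + t ^ 2 + (c / 2 + d)) (fun y hy => by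
      obtain ⟨-, -, h3, -⟩ := h.algebraic_equations hy; linarith) (e 0)
  have d4 := dirDeriv_linear hN hx (a := l) (b := 0) (i := 0) (j := 0)
    (r := ϖ ^ 2 + 2 * s * l - k * n + (c / 2 + d)) (fun y hy => by
      obtain ⟨-, -, -, h4, -⟩ := h.algebraic_equations hy; linarith) (e 2)
  have d5 := dirDeriv_linear hN hx (a := 2 * n) (b := 0) (i := 0) (j := 0)
    (r := 2 * l * (ϖ + t)) (fun y hy => by
      obtain ⟨-, -, -, -, h5, -⟩ := h.algebraic_equations hy; linarith) (e 1)
  have d6 := dirDeriv_linear hN hx (a := 2 * n) (b := -l) (i := 1) (j := 2)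
    (r := -n * ϖ + 2 * l ^ 2 + t * n) (fun y hy => by
      obtain ⟨-, -, -, -, -, h6⟩ := h.algebraic_equations hy; linarith) (e 0)
  constructor
  -- In d1 - d2 + d3 the derivatives form s times one curl minus 2κ times another. The equations k2
  -- and k3 remove them, and the algebraic equations reduce the rest to 2σd.
  · have : s * (2 * d) = 0 := by
      linear_combination d3 - d2 + d1 - s * k2 + 2 * k * k3 + 2 * l * h1
        - 2 * conn g e 0 2 2 x * h1 + 2 * t * h2 - ϖ * h2 + conn g e 0 2 1 x * h2 - 4 * s * h3
        + 2 * s * h4 - k * h5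
    simpa [hd] using this
  -- The mirror computation, with ℓ and n exchanged; here k1 and k2 remove the curls.
  · have : l * (2 * d) = 0 := by
      linear_combination -(d6 - d5 + d4 - 2 * n * k1 + l * k2 + n * h2 - 2 * l * h3 + 4 * l * h4
        + t * h5 - 2 * ϖ * h5 - conn g e 0 2 1 x * h5 - 2 * s * h6 + 2 * conn g e 0 2 0 x * h6)
    simpa [hd] using this

theorem connUp_eq (h : IsAdapted g c d k s t ϖ l n U e) {x : M} (hx : x ∈ U) :
    (fun i j m => connUp g e i j m x) = upConn ![k, s, t] 0 ![ϖ, l, n]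
      + upConn 0 (fun i => conn g e 0 2 i x) 0 := by
  rw [connUp_eq_upConn]
  funext i j m
  simp only [h.conn_01 x hx, h.conn_12 x hx]
  fin_cases i <;> fin_cases j <;> simp [upConn]

theorem nablaRiem_one (h : IsAdapted g c d k s t ϖ l n U e) {x : M} (hx : x ∈ U) :
    nablaRiem g e 1 x = covAct (upConn ![k, s, t] 0 ![ϖ, l, n]) (knTensor c d omega1) := by
  refine (covDeriv_const h.isNullFrame h.riem_eq hx).trans ?_
  rw [h.connUp_eq hx, covAct_add, (knTensor_weightZero c d).covAct_boost, add_zero]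

theorem nablaRiem_two (h : IsAdapted g c d k s t ϖ l n U e) {x : M} (hx : x ∈ U) :
    nablaRiem g e 2 x = covAct (fun i j m => connUp g e i j m x)
      (covAct (upConn ![k, s, t] 0 ![ϖ, l, n]) (knTensor c d omega1)) :=
  covDeriv_const h.isNullFrame (fun _ hy => h.nablaRiem_one hy) hx

/-- The second derivative of the curvature is constant if the null directions are geodesic and
shear-free. -/
theorem nablaRiem_two_const (h : IsAdapted g c d 0 0 t ϖ 0 0 U e) :
    ∃ r, ∀ x ∈ U, nablaRiem g e 2 x = r := by
  refine ⟨covAct (upConn ![0, 0, t] 0 ![ϖ, 0, 0])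
    (covAct (upConn ![0, 0, t] 0 ![ϖ, 0, 0]) (knTensor c d omega1)), fun x hx => ?_⟩
  -- Of the connection only τ and π remain, and their boost weights balance. So ∇R is again boost
  -- invariant and Γ_02 drops out of ∇²R.
  have hw : WeightZero (covAct (upConn ![0, 0, t] 0 ![ϖ, 0, 0]) (knTensor c d omega1)) := by
    refine (knTensor_weightZero c d).covAct fun i j m => ?_
    fin_cases i <;> fin_cases j <;> fin_cases m <;> simp [wt, upConn]
  rw [h.nablaRiem_two hx, h.connUp_eq hx, covAct_add, hw.covAct_boost, add_zero]

/-- The reflection that interchanges `ℓ` and `n`. -/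
def swapGL : GL (Fin 3) ℝ := orthogonalGL !![0, 0, 1; 0, 1, 0; 1, 0, 0] (by
  ext i j; fin_cases i <;> fin_cases j <;> simp [eta, Matrix.mul_apply, Fin.sum_univ_three])

theorem swapGL_mem : swapGL ∈ Oeta := orthogonalGL_mem _ _

theorem coe_swapGL : (swapGL : Matrix (Fin 3) (Fin 3) ℝ) = !![0, 0, 1; 0, 1, 0; 1, 0, 0] := rfl

/-- X preserves ω¹ up to sign, and ω¹ enters the tensor quadratically. -/
theorem riem_act_eq (h : IsAdapted g c d k s t ϖ l n U e) {X : GL (Fin 3) ℝ} (hX : X ∈ Oeta)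
    (h0 : (X : Matrix (Fin 3) (Fin 3) ℝ) 1 0 = 0) (h2 : (X : Matrix (Fin 3) (Fin 3) ℝ) 1 2 = 0)
    {x : M} (hx : x ∈ U) : riem g (e.act X) x = knTensor c d omega1 := by
  have h1 : (X : Matrix (Fin 3) (Fin 3) ℝ) 1 1 ^ 2 = 1 := by
    obtain ⟨A, σ, -, hs, hm | hm⟩ := monomial_of_orthogonal hX h0 h2 <;> rw [hm] <;> simpa using hs
  have hr := nablaRiem_act h.isNullFrame hX hx 0
  have hr0 : nablaRiem g e 0 x = knTensor c d omega1 := h.riem_eq x hx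
  rw [hr0, pullTensor_knTensor hX] at hr
  refine Eq.trans hr ?_
  have hu : (X : Matrix (Fin 3) (Fin 3) ℝ)ᵀ *ᵥ omega1
      = ![0, (X : Matrix (Fin 3) (Fin 3) ℝ) 1 1, 0] := by
    ext i; fin_cases i <;> simp [Matrix.mulVec, dotProduct, Fin.sum_univ_three, omega1, h0, h2]
  rw [hu]
  set σ := (X : Matrix (Fin 3) (Fin 3) ℝ) 1 1
  have hv : ∀ i j, ![0, σ, 0] i * ![0, σ, 0] j = omega1 i * omega1 j := by
    intro i j
    fin_cases i <;> fin_cases j <;> simp [omega1, ← sq, h1]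
  funext a
  simp only [knTensor, hv]

theorem swap (h : IsAdapted g c d k s t ϖ l n U e) :
    IsAdapted g c d (-n) (-l) (-ϖ) (-t) (-s) (-k) U (e.act swapGL) where
  isNullFrame := h.isNullFrame.act swapGL_mem
  riem_eq x hx := h.riem_act_eq swapGL_mem (by simp [coe_swapGL]) (by simp [coe_swapGL]) hx
  conn_01 x hx i := by
    rw [conn_act h.isNullFrame swapGL_mem hx]
    fin_cases i <;> simp [coe_swapGL, Fin.sum_univ_three, conn_antisymm g e 2 1, h.conn_12 x hx]
  conn_12 x hx i := by
    rw [conn_act h.isNullFrame swapGL_mem hx]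
    fin_cases i <;> simp [coe_swapGL, Fin.sum_univ_three, conn_antisymm g e 1 0, h.conn_01 x hx]

/-- The canonical configuration, if exactly one of the null directions is geodesic. -/
theorem exists_isPreCanonical (h : IsAdapted g c d k 0 t ϖ 0 0 U e) (hd : d ≠ 0) (hk : k ≠ 0)
    {x₀ : M} (hx₀ : x₀ ∈ U) : ∃ X ∈ Oeta, ∃ T C : ℝ, C + 2 * T ^ 2 ≠ 0 ∧
      IsPreCanonical g T C U (e.act X) := by
  have hN := h.isNullFrame
  have hE2 : ∀ x ∈ U, conn g e 0 2 2 x = 0 := by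
    intro x hx
    obtain ⟨-, h2, -⟩ := h.algebraic_equations hx
    have : k * conn g e 0 2 2 x = 0 := by linarith
    exact (mul_eq_zero.mp this).resolve_left hk
  have hE1 : ∀ x ∈ U, conn g e 0 2 1 x = (ϖ - t) / 2 := by
    intro x hx
    obtain ⟨h1, -⟩ := h.algebraic_equations hx
    have : k * (2 * conn g e 0 2 1 x - ϖ + t) = 0 := by linarith
    have := (mul_eq_zero.mp this).resolve_left hk
    linarith
  have htt : -t ^ 2 = c / 2 + d ∧ -ϖ ^ 2 = c / 2 + d := by
    obtain ⟨-, -, h3, h4, -⟩ := h.algebraic_equations hx₀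
    constructor <;> linarith
  have hdE1 : ∀ x ∈ U, ∀ v, dirDeriv v (conn g e 0 2 1) x = 0 := fun x hx v =>
    hN.dirDeriv_of_const hx hE1 v
  have hdE2 : ∀ x ∈ U, ∀ v, dirDeriv v (conn g e 0 2 2) x = 0 := fun x hx v =>
    hN.dirDeriv_of_const hx hE2 v
  have hD : ∀ x ∈ U, dirDeriv (e 1) (conn g e 0 2 0) x
        = -((ϖ + t) / 2) * conn g e 0 2 0 x ∧
      dirDeriv (e 2) (conn g e 0 2 0) x = c - 2 * t * ϖ - (ϖ ^ 2 - t ^ 2) := by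
    intro x hx
    obtain ⟨k1, k2, -⟩ := h.differential_equations hx
    rw [hdE1 x hx, hE1 x hx, hE2 x hx] at k1
    rw [hdE2 x hx, hE1 x hx, hE2 x hx] at k2
    constructor <;> linarith
  -- The algebraic equations give only π² = τ². If π = -τ ≠ τ, then δΓ_{020} = 0 and ΔΓ_{020} = c +
  -- 2τ² = -2d, and the commutator [δ, Δ] yields 2τ·(-2d) = 0, which is impossible.
  have hϖ : ϖ = t := by
    by_contra hne
    have h0 : ϖ = -t := by
      have : (ϖ - t) * (ϖ + t) = 0 := by linarith [htt.1, htt.2]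
      have := (mul_eq_zero.mp this).resolve_left (sub_ne_zero.mpr hne)
      linarith
    have hcomm := hN.commutator hx₀ 1 2 (hN.contMDiffOn_conn 0 2 0)
    have c1 : dirDeriv (e 1) (dirDeriv (e 2) (conn g e 0 2 0)) x₀ = 0 :=
      hN.dirDeriv_of_const hx₀ (fun y hy => (hD y hy).2) _
    have c2 : dirDeriv (e 2) (dirDeriv (e 1) (conn g e 0 2 0)) x₀ = 0 :=
      hN.dirDeriv_of_const hx₀ (r := 0) (fun y hy => by rw [(hD y hy).1, h0]; ring) _
    rw [c1, c2] at hcomm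
    simp only [connUp_sub_connUp, h.conn_01 x₀ hx₀, h.conn_12 x₀ hx₀] at hcomm
    simp [Fin.sum_univ_three, lieCoeff, upConn, hE1 x₀ hx₀, (hD x₀ hx₀).2] at hcomm
    rw [h0] at hcomm hne
    rcases hcomm with h1 | h1
    · apply hne; linarith
    · apply hd; linarith [htt.1]
  subst hϖ
  -- The boost A and the reflection σ of m multiply κ by A²σ, so this choice makes κ equal to 1.
  set A : ℝ := (Real.sqrt |k|)⁻¹ with hA
  set σ : ℝ := ((SignType.sign k : SignType) : ℝ) with hσ
  have hk' : 0 < Real.sqrt |k| := Real.sqrt_pos.mpr (abs_pos.mpr hk)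
  have hA0 : A ≠ 0 := inv_ne_zero hk'.ne'
  have hσ2 : σ * σ = 1 := by
    rcases lt_or_gt_of_ne hk with h | h <;> simp [hσ, h]
  have hAk : A * A * (σ * k) = 1 := by
    rw [hσ, sign_mul_self, hA, ← mul_inv, Real.mul_self_sqrt (abs_nonneg k),
      inv_mul_cancel₀ (abs_ne_zero.mpr hk)]
  have hX : (!![A, 0, 0; 0, σ, 0; 0, 0, A⁻¹] : Matrix (Fin 3) (Fin 3) ℝ)ᵀ * eta
      * !![A, 0, 0; 0, σ, 0; 0, 0, A⁻¹] = eta := by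
    ext i j; fin_cases i <;> fin_cases j <;>
      simp [eta, Matrix.mul_apply, Fin.sum_univ_three, hA0]
    linarith
  set X := orthogonalGL _ hX with hXdef
  have hXm : X ∈ Oeta := orthogonalGL_mem _ hX
  have hXc : (X : Matrix (Fin 3) (Fin 3) ℝ) = !![A, 0, 0; 0, σ, 0; 0, 0, A⁻¹] := rfl
  have hconn := fun x (hx : x ∈ U) => conn_act hN hXm hx
  have hε : ∀ x ∈ U, epsilon g (e.act X) x = A / 2 * conn g e 0 2 0 x := by
    intro x hx
    rw [epsilon, hconn x hx]
    simp [hXc, Fin.sum_univ_three]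
    field_simp
  have hdε : ∀ x ∈ U, ∀ v, dirDeriv v (epsilon g (e.act X)) x
      = A / 2 * dirDeriv v (conn g e 0 2 0) x := by
    intro x hx v
    rw [dirDeriv_congr hN.isOpen v hε hx,
      hN.dirDeriv_const_mul hx _ (hN.contMDiffOn_conn 0 2 0)]
  -- π is boost invariant and changes sign with m, which gives T. C is the new Δε: the factor A of ε
  -- cancels against A⁻¹ of n.
  refine ⟨X, hXm, σ * ϖ, (c - 2 * ϖ ^ 2) / 2, ?_, ?_⟩
  · rw [mul_pow, sq σ, hσ2]
    intro h0; apply hd; linarith [htt.1]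
  refine isPreCanonical_of_connection (hN.act hXm) ?_ ?_ ?_ ?_ ?_ ?_
  · intro x hx i
    rw [hconn x hx]
    fin_cases i
    · simp [hXc, Fin.sum_univ_three, h.conn_01 x hx]; linarith
    · simp [hXc, Fin.sum_univ_three, h.conn_01 x hx]
    · simp [hXc, Fin.sum_univ_three, h.conn_01 x hx]; left; field_simp
  · intro x hx i
    rw [hconn x hx]
    fin_cases i
    · simp [hXc, Fin.sum_univ_three, h.conn_12 x hx]; left; field_simp
    · simp [hXc, Fin.sum_univ_three, h.conn_12 x hx]
    · simp [hXc, Fin.sum_univ_three, h.conn_12 x hx]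
  · intro x hx
    rw [hconn x hx]
    simp [hXc, Fin.sum_univ_three, hE1 x hx]
  · intro x hx
    rw [hconn x hx]
    simp [hXc, Fin.sum_univ_three, hE2 x hx]
  · intro x hx
    rw [hdε x hx, dirDeriv_act, hε x hx]
    simp [hXc, Fin.sum_univ_three, (hD x hx).1]
    ring
  · intro x hx
    rw [hdε x hx, dirDeriv_act]
    simp [hXc, Fin.sum_univ_three, (hD x hx).2]
    field_simp

/-- Adapted frames have a constant second order jet or can be made canonical. -/
theorem dichotomy (h : IsAdapted g c d k s t ϖ l n U e) (hd : d ≠ 0) {x₀ : M} (hx₀ : x₀ ∈ U) :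
    (∃ r, ∀ x ∈ U, nablaRiem g e 2 x = r) ∨ ∃ X ∈ Oeta, ∃ T C : ℝ, C + 2 * T ^ 2 ≠ 0 ∧
      IsPreCanonical g T C U (e.act X) := by
  obtain ⟨rfl, rfl⟩ := h.shear_free hd hx₀
  -- κ and ν are the obstructions to the null directions being geodesic; only the mixed cases allow
  -- a nonconstant second order jet.
  by_cases hk : k = 0
  · subst hk
    by_cases hn : n = 0
    · subst hn; exact Or.inl h.nablaRiem_two_const
    · right
      have h' := h.swap
      rw [neg_zero] at h'
      obtain ⟨X, hX, T, C, hne, hP⟩ := h'.exists_isPreCanonical hd (neg_ne_zero.mpr hn) hx₀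
      refine ⟨swapGL * X, Oeta.mul_mem swapGL_mem hX, T, C, hne, ?_⟩
      rwa [Triad.act_mul]
  · by_cases hn : n = 0
    · subst hn; exact Or.inr (h.exists_isPreCanonical hd hk hx₀)
    -- For κ and ν both nonzero the algebraic equations determine all three components of Γ_02 as
    -- constants.
    · left
      have hE : ∀ x ∈ U, ∀ i, conn g e 0 2 i x = ![0, (ϖ - t) / 2, 0] i := by
        intro x hx i
        obtain ⟨h1, h2, -, -, h5, -⟩ := h.algebraic_equations hx
        have e1 : k * (2 * conn g e 0 2 1 x - ϖ + t) = 0 := by linarith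
        have e2 : k * conn g e 0 2 2 x = 0 := by linarith
        have e5 : n * conn g e 0 2 0 x = 0 := by linarith
        have e1' := (mul_eq_zero.mp e1).resolve_left hk
        have e2' := (mul_eq_zero.mp e2).resolve_left hk
        have e5' := (mul_eq_zero.mp e5).resolve_left hn
        fin_cases i
        · simpa using e5'
        · simp; linarith
        · simpa using e2'
      refine ⟨covAct (upConn ![k, 0, t] ![0, (ϖ - t) / 2, 0] ![ϖ, 0, n])
        (covAct (upConn ![k, 0, t] 0 ![ϖ, 0, n]) (knTensor c d omega1)), fun x hx => ?_⟩
      rw [h.nablaRiem_two hx, connUp_eq_upConn]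
      simp only [hE x hx, h.conn_01 x hx, h.conn_12 x hx]

end IsAdapted

end Geometry

/-! ### Normal form of type D curvature; jets of rank zero -/

section Geometry

variable {M : Type*} [TopologicalSpace M] [ChartedSpace E3 M] [IsManifold 𝓘(ℝ, E3) ∞ M]
variable {g : LorentzMetric M} {U : Set M} {e : Triad M}

/-- The usual consequence of the two antisymmetries and four instances of the first Bianchi
identity. -/
theorem IsNullFrame.riem_pair_symm (h : IsNullFrame g U e) {x : M} (hx : x ∈ U)
    (a b c d : Fin 3) : riem g e x ![a, b, c, d] = riem g e x ![c, d, a, b] := by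
  have hl := h.riem_antisymm_left hx
  have hr := riem_antisymm_right g e x
  have h1 := h.riem_bianchi hx a b c d
  have h2 := h.riem_bianchi hx b c d a
  have h3 := h.riem_bianchi hx c d a b
  have h4 := h.riem_bianchi hx d a b c
  linarith [hl b a c d, hl d c a b, hl c a b d, hr a c b d, hl d b c a, hr b d c a,
    hl d a b c, hl c b d a]

/-- The Riemann tensor of a type D point in the adapted frame. -/
theorem riem_of_quartic (h : IsNullFrame g U e) {x : M} (hx : x ∈ U) {a b : ℝ}
    (hq : ∀ z : ℝ, Psi0 g e x + 4 * Psi1 g e x * z + 6 * Psi2 g e x * z ^ 2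
      + 4 * Psi3 g e x * z ^ 3 + Psi4 g e x * z ^ 4
        = Psi4 g e x * (z - a) ^ 2 * (z - b) ^ 2) :
    riem g e x = knTensor (scalarCurv g e x / 6 - Psi4 g e x * (a - b) ^ 2 / 3) (Psi4 g e x)
      ![a * b, -(a + b) / 2, 1] := by
  -- Both quartics have leading coefficient Ψ₄, so four values of z determine the remaining
  -- coefficients.
  have q0 := hq 0
  have q1 := hq 1
  have q2 := hq (-1)
  have q3 := hq 2
  have e0 : Psi0 g e x = Psi4 g e x * (a ^ 2 * b ^ 2) := by linarith
  have e1 : 4 * Psi1 g e x = Psi4 g e x * (-2 * a * b * (a + b)) := by linarith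
  have e2 : 6 * Psi2 g e x = Psi4 g e x * ((a + b) ^ 2 + 2 * a * b) := by linarith
  have e3 : 4 * Psi3 g e x = Psi4 g e x * (-2 * (a + b)) := by linarith
  set ψ := Psi4 g e x with hψ
  have hl := h.riem_antisymm_left hx
  have hr := riem_antisymm_right g e x
  have hp := h.riem_pair_symm hx
  have hz : ∀ i j k, riem g e x ![i, i, j, k] = 0 := fun i j k => by linarith [hl i i j k]
  have hz' : ∀ i j k, riem g e x ![i, j, k, k] = 0 := fun i j k => by linarith [hr i j k k]
  -- In dimension three the Ricci components determine the Riemann components; these relations are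
  -- inverted at the end.
  have r00 : ricci g e 0 0 x = 2 * riem g e x ![0, 1, 0, 1] := by
    rw [ricci_eq]; linarith [hz' 2 0 0, hz 0 2 0, hl 1 0 1 0, hr 0 1 1 0]
  have r01 : ricci g e 0 1 x = riem g e x ![0, 1, 0, 2] := by
    rw [ricci_eq]; linarith [hl 2 0 0 1, hp 0 2 0 1, hz 0 2 1, hz' 1 0 1]
  have r12 : ricci g e 1 2 x = riem g e x ![0, 2, 1, 2] := by
    rw [ricci_eq]; linarith [hl 2 1 0 2, hp 1 2 0 2, hz' 0 1 2, hz 1 1 2]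
  have r22 : ricci g e 2 2 x = 2 * riem g e x ![1, 2, 1, 2] := by
    rw [ricci_eq]; linarith [hz 2 0 2, hz' 0 2 2]
  have r11 : ricci g e 1 1 x = 2 * riem g e x ![0, 1, 1, 2] := by
    rw [ricci_eq]; linarith [hl 2 1 0 1, hp 1 2 0 1, hr 0 1 2 1, hz 1 1 1]
  have r02 : ricci g e 0 2 x = riem g e x ![0, 2, 0, 2] - 2 * riem g e x ![0, 1, 1, 2] := by
    rw [ricci_eq]; linarith [hl 2 0 0 2, hz' 0 0 2, hl 1 0 1 2]
  have r20 : ricci g e 2 0 x = ricci g e 0 2 x := by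
    rw [ricci_eq, ricci_eq]
    linarith [hz 2 0 0, hr 0 2 2 0, hz' 0 0 2, hl 2 0 0 2, hp 1 2 1 0, hl 1 0 1 2]
  have hR : scalarCurv g e x = 2 * ricci g e 1 1 x - 2 * ricci g e 0 2 x := by
    simp [scalarCurv, Fin.sum_univ_three, etaInv, r20]; ring
  set R := scalarCurv g e x with hRdef
  have s0 : Psi0 g e x = ricci g e 0 0 x := by simp [Psi0, tfRicci, eta]
  have s1 : Psi1 g e x = ricci g e 0 1 x := by simp [Psi1, tfRicci, eta]
  have s2 : Psi2 g e x = ricci g e 1 1 x - R / 6 := by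
    simp [Psi2, tfRicci, eta, ← hRdef]; ring
  have s3 : Psi3 g e x = ricci g e 1 2 x := by simp [Psi3, tfRicci, eta]
  have s4 : ψ = ricci g e 2 2 x := by simp [hψ, Psi4, tfRicci, eta]
  have p1 := hp 0 2 0 1
  have p2 := hp 1 2 0 1
  have p3 := hp 1 2 0 2
  refine h.riem_eq_knTensor hx fun i j => ?_
  fin_cases i <;> fin_cases j <;> simp [knTensor, eta] <;> linarith

/-- The new ℓ and n are taken along v_a and v_b, where v_z = ℓ + 2z m + z² n. The covector u
vanishes on both, so it becomes a multiple of ω¹. -/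
theorem exists_riem_normal_form (h : IsNullFrame g U e) {x : M} (hx : x ∈ U)
    (hψ : Psi4 g e x ≠ 0) {a b : ℝ} (hab : a ≠ b)
    (hq : ∀ z : ℝ, Psi0 g e x + 4 * Psi1 g e x * z + 6 * Psi2 g e x * z ^ 2
      + 4 * Psi3 g e x * z ^ 3 + Psi4 g e x * z ^ 4
        = Psi4 g e x * (z - a) ^ 2 * (z - b) ^ 2) :
    ∃ X ∈ Oeta, ∃ c d : ℝ, d ≠ 0 ∧ riem g (e.act X) x = knTensor c d omega1 := by
  have hr := riem_of_quartic h hx hq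
  have hba : b - a ≠ 0 := sub_ne_zero.mpr hab.symm
  obtain ⟨y, hy⟩ : ∃ y, y = (b - a)⁻¹ := ⟨_, rfl⟩
  have hyb : y * (b - a) = 1 := by rw [hy, inv_mul_cancel₀ hba]
  -- The columns with indices 0 and 2 are v_a and y² v_b, the latter rewritten by yb = 1 + ya. In
  -- this form orthogonality is an identity in a and y.
  have hX : (!![1, y, y ^ 2; 2 * a, 1 + 2 * a * y, 2 * y + 2 * a * y ^ 2;
      a ^ 2, a + a ^ 2 * y, (1 + y * a) ^ 2] : Matrix (Fin 3) (Fin 3) ℝ)ᵀ * eta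
      * !![1, y, y ^ 2; 2 * a, 1 + 2 * a * y, 2 * y + 2 * a * y ^ 2;
      a ^ 2, a + a ^ 2 * y, (1 + y * a) ^ 2] = eta := by
    ext i j; fin_cases i <;> fin_cases j <;>
      simp [eta, Matrix.mul_apply, Fin.sum_univ_three] <;> ring
  have hu : (!![1, y, y ^ 2; 2 * a, 1 + 2 * a * y, 2 * y + 2 * a * y ^ 2;
      a ^ 2, a + a ^ 2 * y, (1 + y * a) ^ 2] : Matrix (Fin 3) (Fin 3) ℝ)ᵀ *ᵥ
      ![a * b, -(a + b) / 2, 1] = ![0, (a - b) / 2, 0] := by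
    ext i; fin_cases i <;> simp [Matrix.mulVec, dotProduct, Fin.sum_univ_three]
    · ring
    · linear_combination 0 * hyb
    · linear_combination (-1 : ℝ) * hyb
  refine ⟨orthogonalGL _ hX, orthogonalGL_mem _ hX,
    scalarCurv g e x / 6 - Psi4 g e x * (a - b) ^ 2 / 3, Psi4 g e x * ((a - b) / 2) ^ 2,
    mul_ne_zero hψ (pow_ne_zero 2 (div_ne_zero (sub_ne_zero.mpr hab) two_ne_zero)), ?_⟩
  have h1 := nablaRiem_act h (orthogonalGL_mem _ hX) hx 0
  have h2 : nablaRiem g e 0 x = _ := hr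
  rw [h2] at h1
  refine (Eq.trans h1 (pullTensor_knTensor hX _ _ _)).trans ?_
  rw [hu]
  have hv : ∀ i j, ![0, (a - b) / 2, 0] i * ![0, (a - b) / 2, 0] j
      = ((a - b) / 2) ^ 2 * (omega1 i * omega1 j) := by
    intro i j
    fin_cases i <;> fin_cases j <;> simp [omega1, sq]
  funext i
  simp only [knTensor, hv]
  ring

/-- V is the preimage of a coordinate ball and is chosen before f, so one neighbourhood serves all
components of a jet. -/
theorem eq_const_of_mfderiv_eq_zero (hU : IsOpen U) {x : M} (hx : x ∈ U) :
    ∃ V : Set M, IsOpen V ∧ x ∈ V ∧ V ⊆ U ∧ ∀ f : M → ℝ,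
      ContMDiffOn 𝓘(ℝ, E3) 𝓘(ℝ, ℝ) ∞ f U → (∀ y ∈ U, mfderiv 𝓘(ℝ, E3) 𝓘(ℝ, ℝ) f y = 0) →
      ∀ y ∈ V, f y = f x := by
  set φ := extChartAt 𝓘(ℝ, E3) x with hφ
  have hO : IsOpen (φ.target ∩ φ.symm ⁻¹' U) :=
    (continuousOn_extChartAt_symm x).isOpen_inter_preimage (isOpen_extChartAt_target x) hU
  have hxO : φ x ∈ φ.target ∩ φ.symm ⁻¹' U :=
    ⟨mem_extChartAt_target x, by rw [Set.mem_preimage, extChartAt_to_inv]; exact hx⟩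
  obtain ⟨r, hr, hB⟩ := Metric.isOpen_iff.mp hO _ hxO
  have hin : ∀ y ∈ φ.source ∩ φ ⁻¹' Metric.ball (φ x) r, y ∈ U := by
    intro y hy
    have := (hB hy.2).2
    rwa [Set.mem_preimage, φ.left_inv hy.1] at this
  refine ⟨φ.source ∩ φ ⁻¹' Metric.ball (φ x) r, isOpen_extChartAt_preimage' x Metric.isOpen_ball,
    ⟨mem_extChartAt_source x, Metric.mem_ball_self hr⟩, hin, fun f hf hdf y hy => ?_⟩
  have hd : ∀ z ∈ Metric.ball (φ x) r, DifferentiableAt ℝ (f ∘ φ.symm) z ∧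
      fderiv ℝ (f ∘ φ.symm) z = 0 := by
    intro z hz
    have hzt := (hB hz).1
    have hzU : φ.symm z ∈ U := (hB hz).2
    have h1 := smoothFun_mdifferentiableAt hU hf hzU
    have h2 := mdifferentiableWithinAt_extChartAt_symm (I := 𝓘(ℝ, E3)) hzt
    simp only [modelWithCornersSelf_coe, Set.range_id, mdifferentiableWithinAt_univ] at h2
    refine ⟨mdifferentiableAt_iff_differentiableAt.mp (h1.comp z h2), ?_⟩
    ext ξ
    rw [fderiv_comp_extChartAt_symm_apply x hzt h1, hdf _ hzU]
    rfl
  have h1 := Metric.isOpen_ball.is_const_of_fderiv_eq_zero (convex_ball (φ x) r).isPreconnected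
    (fun z hz => (hd z hz).1.differentiableWithinAt) (fun z hz => (hd z hz).2) hy.2
    (Metric.mem_ball_self hr)
  simp only [Function.comp] at h1
  rwa [φ.left_inv hy.1, φ.left_inv (mem_extChartAt_source x)] at h1

theorem contMDiffOn_curvJet (h : IsNullFrame g U e) (p : ℕ) :
    ContMDiffOn 𝓘(ℝ, E3) 𝓘(ℝ, CurvJet p) ∞ (curvJet g e p) U := by
  rw [contMDiffOn_pi_space]
  intro j
  rw [contMDiffOn_pi_space]
  exact fun a => contMDiffOn_nablaRiem h j a

theorem eq_zero_of_finrank_range {F : Type*} [NormedAddCommGroup F] [NormedSpace ℝ F]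
    {D : E3 →L[ℝ] F} (h : Module.finrank ℝ (LinearMap.range D.toLinearMap) = 0) : D = 0 := by
  have h1 := Submodule.finrank_eq_zero.mp h
  ext1 v
  have : D v ∈ (⊥ : Submodule ℝ F) := h1 ▸ LinearMap.mem_range_self D.toLinearMap v
  exact this

/-- If the jet of the curvature has rank zero, it is locally constant. -/
theorem exists_curvJet_const (h : IsNullFrame g U e) {p : ℕ} {x : M} (hx : x ∈ U)
    (hr : ∀ y ∈ U, Module.finrank ℝ (LinearMap.range
        (mfderiv 𝓘(ℝ, E3) 𝓘(ℝ, CurvJet p) (curvJet g e p) y).toLinearMap) = 0) :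
    ∃ V : Set M, IsOpen V ∧ x ∈ V ∧ V ⊆ U ∧ ∀ y ∈ V, curvJet g e p y = curvJet g e p x := by
  obtain ⟨V, hV, hxV, hVU, hc⟩ := eq_const_of_mfderiv_eq_zero h.isOpen hx
  refine ⟨V, hV, hxV, hVU, fun y hy => ?_⟩
  funext j a
  refine hc (fun y => curvJet g e p y j a) (contMDiffOn_nablaRiem h j a) (fun z hz => ?_) y hy
  have h1 : MDifferentiableAt 𝓘(ℝ, E3) 𝓘(ℝ, CurvJet p) (curvJet g e p) z :=
    ((contMDiffOn_curvJet h p z hz).contMDiffAt (h.isOpen.mem_nhds hz)).mdifferentiableAt (by simp)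
  let L : CurvJet p →L[ℝ] ℝ :=
    (ContinuousLinearMap.proj (R := ℝ) (φ := fun _ : Fin (4 + (j : ℕ)) → Fin 3 => ℝ) a).comp
      (ContinuousLinearMap.proj (R := ℝ) (φ := fun i : Fin (p + 1) => Tensor (4 + (i : ℕ))) j)
  have h2 := (L.hasMFDerivAt (x := curvJet g e p z)).comp z h1.hasMFDerivAt
  have h3 : mfderiv 𝓘(ℝ, E3) 𝓘(ℝ, ℝ) (fun y => curvJet g e p y j a) z = _ := h2.mfderiv
  rw [h3]
  have h4 : mfderiv 𝓘(ℝ, E3) 𝓘(ℝ, CurvJet p) (curvJet g e p) z = 0 :=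
    eq_zero_of_finrank_range (F := CurvJet p)
      (D := mfderiv 𝓘(ℝ, E3) 𝓘(ℝ, CurvJet p) (curvJet g e p) z) (hr z hz)
  rw [h4]
  exact L.comp_zero

end Geometry

/-! ### Local existence, global constants and conjugacy -/

section Geometry

variable {M : Type*} [TopologicalSpace M] [ChartedSpace E3 M] [IsManifold 𝓘(ℝ, E3) ∞ M]
variable {g : LorentzMetric M} {U V : Set M} {e f : Triad M}

/-- If the curvature jet is constant in some frame, it is constant in normalized frames. -/
theorem IsNormalizingCrossSection.curvJet_eq {p : ℕ} {S : Set (CurvJet p)}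
    (hS : IsNormalizingCrossSection g p S) (he : IsNormalizedFrame g p S U e)
    (hf : IsNullFrame g V f) {s : CurvJet p} (hs : ∀ y ∈ V, curvJet g f p y = s) {x y : M}
    (hx : x ∈ U ∩ V) (hy : y ∈ U ∩ V) : curvJet g e p y = curvJet g e p x := by
  obtain ⟨-, ⟨G, hG, hfix, hmem⟩, -⟩ := hS
  obtain ⟨X, hX, hXe⟩ := exists_frame_change hf he.1 hx.2 hx.1
  obtain ⟨Y, hY, hYe⟩ := exists_frame_change hf he.1 hy.2 hy.1
  have h1 := curvJet_change hf he.1 hx.2 hx.1 hXe p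
  have h2 := curvJet_change hf he.1 hy.2 hy.1 hYe p
  rw [hs x hx.2] at h1
  rw [hs y hy.2] at h2
  -- The two values in S lie on one orbit of O(η). The connecting element belongs to G, which fixes
  -- S pointwise, so they coincide.
  have h3 : jetAct (Y⁻¹ * X) (curvJet g e p x) = curvJet g e p y := by
    rw [h1, h2, ← jetAct_mul, mul_inv_cancel_right]
  have hZ := hmem (Y⁻¹ * X) (Oeta.mul_mem (Oeta.inv_mem hY) hX)
    ⟨_, ⟨_, he.2 x hx.1, h3⟩, he.2 y hy.1⟩
  rw [← h3, hfix _ hZ _ (he.2 x hx.1)]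

/-- By `curvJet_eq`, constancy in one frame passes to the normalized frames, where the rank would be
zero. -/
theorem HasHorizontalRank.not_const {p t : ℕ} (h : HasHorizontalRank g p t) (ht : 0 < t)
    (hf : IsNullFrame g V f) {x : M} (hx : x ∈ V) (s : CurvJet p) :
    ¬ ∀ y ∈ V, curvJet g f p y = s := by
  intro hs
  obtain ⟨S, hS, hr⟩ := h
  obtain ⟨U, e, hxU, he⟩ := hS.2.2 x
  have h1 : curvJet g e p =ᶠ[nhds x] fun _ => curvJet g e p x := by
    filter_upwards [(he.1.isOpen.inter hf.isOpen).mem_nhds ⟨hxU, hx⟩] with y hy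
    exact hS.curvJet_eq he hf hs ⟨hxU, hx⟩ hy
  have h2 := hr U e he x hxU
  rw [h1.mfderiv_eq, mfderiv_const] at h2
  have h3 : Module.finrank ℝ (LinearMap.range (0 : E3 →ₗ[ℝ] CurvJet p)) = t := h2
  rw [LinearMap.range_zero, finrank_bot] at h3
  omega

theorem HasHorizontalRank.nablaRiem_two_not_const {t : ℕ} (h : HasHorizontalRank g 2 t)
    (ht : 0 < t) (hf : IsNullFrame g V f) {x : M} (hx : x ∈ V) {r0 : Tensor 4} {r1 : Tensor 5}
    {r2 : Tensor 6} (h0 : ∀ y ∈ V, nablaRiem g f 0 y = r0) (h1 : ∀ y ∈ V, nablaRiem g f 1 y = r1)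
    (h2 : ∀ y ∈ V, nablaRiem g f 2 y = r2) : False := by
  refine h.not_const ht hf hx (curvJet g f 2 x) fun y hy => ?_
  funext j
  fin_cases j
  · exact (h0 y hy).trans (h0 x hx).symm
  · exact (h1 y hy).trans (h1 x hx).symm
  · exact (h2 y hy).trans (h2 x hx).symm

/-- The second order jet distinguishes the canonical frame from its reflection. -/
theorem IsPreCanonical.epsilon_ne_zero {T C : ℝ} {t : ℕ} (hr : HasHorizontalRank g 2 t)
    (ht : 0 < t) (h : IsPreCanonical g T C V f) (hne : C + 2 * T ^ 2 ≠ 0) {x : M} (hx : x ∈ V) :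
    epsilon g f x ≠ 0 := by
  intro hε
  have hr' := hr
  obtain ⟨S, hS, -⟩ := hr'
  obtain ⟨-, ⟨G, hG, hfix, hmem⟩, hcov⟩ := hS
  obtain ⟨U, e, hxU, he⟩ := hcov x
  obtain ⟨Y, hY, hYe⟩ := exists_frame_change h.1 he.1 hx hxU
  have h1 := curvJet_change h.1 he.1 hx hxU hYe 2
  -- At a zero of ε the reflection fixes the whole second order jet.
  have hflip : jetAct flipGL⁻¹ (curvJet g f 2 x) = curvJet g f 2 x := by
    funext j
    rw [jetAct, tensorAct_inv, coe_flipGL]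
    fin_cases j
    · have := (h.2 x hx).1
      change pullTensor flipMatrix (nablaRiem g f 0 x) = nablaRiem g f 0 x
      rw [this, pullTensor_flip_jet0]
    · have := (h.2 x hx).2
      change pullTensor flipMatrix (nablaRiem g f 1 x) = nablaRiem g f 1 x
      rw [this]; exact pullTensor_flip_jet1 T C
    · have := h.nablaRiem_two hne hx
      change pullTensor flipMatrix (nablaRiem g f 2 x) = nablaRiem g f 2 x
      rw [this, hε]
      exact (pullTensor_flip_jet2 T C 0).trans (by rw [neg_zero])
  -- The reflection expressed in the normalized frame at x. It fixes a point of S, hence belongs to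
  -- G and fixes every point of S.
  set Z := Y⁻¹ * flipGL⁻¹ * Y with hZdef
  have hZO : Z ∈ Oeta :=
    Oeta.mul_mem (Oeta.mul_mem (Oeta.inv_mem hY) (Oeta.inv_mem flipGL_mem)) hY
  have hZfix : jetAct Z (curvJet g e 2 x) = curvJet g e 2 x := by
    rw [h1, ← jetAct_mul, hZdef, mul_inv_cancel_right, jetAct_mul, hflip]
  have hZG : Z ∈ G := hmem Z hZO ⟨_, ⟨_, he.2 x hxU, hZfix⟩, he.2 x hxU⟩
  -- Carried back to f at y, Z becomes an isotropy W of the jet. It is conjugate to the reflection,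
  -- hence not the identity, so W⁻¹ is the reflection by `jet_stabilizer`. It sends ε to -ε, which
  -- forces ε = 0.
  have hzero : ∀ y ∈ U ∩ V, epsilon g f y = 0 := by
    intro y hy
    obtain ⟨Y', hY', hYe'⟩ := exists_frame_change h.1 he.1 hy.2 hy.1
    have h2 := curvJet_change h.1 he.1 hy.2 hy.1 hYe' 2
    have h3 := hfix Z hZG _ (he.2 y hy.1)
    rw [h2, ← jetAct_mul] at h3
    have h4 := congrArg (jetAct Y') h3
    rw [← jetAct_mul, ← jetAct_mul, mul_inv_cancel, jetAct_one] at h4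
    set W := Y' * (Z * Y'⁻¹) with hW
    have hWO : W ∈ Oeta := Oeta.mul_mem hY' (Oeta.mul_mem hZO (Oeta.inv_mem hY'))
    have h5 : ∀ j : Fin 3, pullTensor ((W⁻¹ : GL (Fin 3) ℝ) : Matrix (Fin 3) (Fin 3) ℝ)
        (nablaRiem g f j y) = nablaRiem g f j y := by
      intro j
      rw [← tensorAct_inv, inv_inv]
      exact congrFun h4 j
    have k0 := h5 0
    have k1 := h5 1
    have k2 := h5 2
    change pullTensor _ (nablaRiem g f 0 y) = nablaRiem g f 0 y at k0
    change pullTensor _ (nablaRiem g f 1 y) = nablaRiem g f 1 y at k1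
    change pullTensor _ (nablaRiem g f 2 y) = nablaRiem g f 2 y at k2
    rw [(h.2 y hy.2).1] at k0
    rw [(h.2 y hy.2).2] at k1
    rw [h.nablaRiem_two hne hy.2] at k2
    obtain ⟨-, -, k | k⟩ := jet_stabilizer (mem_Oeta.mp (Oeta.inv_mem hWO)) hne k0 k1
    · exfalso
      have hW1 : W = 1 := inv_eq_one.mp (Units.ext k)
      have hF : flipGL = 1 := by
        have : W = (Y' * Y⁻¹) * flipGL⁻¹ * (Y' * Y⁻¹)⁻¹ := by rw [hW, hZdef]; group
        rw [hW1] at this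
        exact inv_eq_one.mp (conj_eq_one_iff.mp this.symm)
      have := congrFun (congrFun (congrArg (fun X : GL (Fin 3) ℝ =>
        (X : Matrix (Fin 3) (Fin 3) ℝ)) hF) 0) 0
      simp [coe_flipGL, flipMatrix] at this
      norm_num at this
    · rw [k] at k2
      have := epsilon_eq_of_jet2 hne (((pullTensor_flip_jet2 _ _ _).symm).trans k2)
      linarith
  have hV := h.mono (he.1.isOpen.inter h.1.isOpen) Set.inter_subset_right
  refine hr.nablaRiem_two_not_const ht hV.1 ⟨hxU, hx⟩ (fun y hy => (hV.2 y hy).1)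
    (fun y hy => (hV.2 y hy).2) (r2 := jet2 T C 0) fun y hy => ?_
  rw [hV.nablaRiem_two hne hy, hzero y hy]

/-- Type D together with a locally constant first order jet gives adapted frames. -/
theorem exists_isAdapted (hD : IsTypeD g) (hr : HasHorizontalRank g 1 0) (x : M) :
    ∃ (V : Set M) (f : Triad M) (c d k s t ϖ l n : ℝ), x ∈ V ∧ d ≠ 0 ∧
      IsAdapted g c d k s t ϖ l n V f := by
  obtain ⟨S, hS, hrank⟩ := hr
  obtain ⟨U, e, hxU, he⟩ := hS.2.2 x
  obtain ⟨V, hV, hxV, hVU, hc⟩ := exists_curvJet_const he.1 hxU (hrank U e he)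
  obtain ⟨U', e', hx', he', hψ, a, b, hab, hq⟩ := hD x
  obtain ⟨X, hX, c, d, hd, hrX⟩ := exists_riem_normal_form he' hx' hψ hab hq
  have heV := he.1.mono hV hVU
  -- Y brings e to normal form at x only. Since the first order jet is constant on V, the constant
  -- matrix Y does so on all of V.
  obtain ⟨Y, hY, hYe⟩ := exists_frame_change heV (he'.act hX) hxV hx'
  have hf := heV.act hY
  have hj : ∀ j : Fin 2, ∀ y ∈ V, nablaRiem g (e.act Y) j y = nablaRiem g (e.act Y) j x := by
    intro j y hy
    rw [nablaRiem_act heV hY hy, nablaRiem_act heV hY hxV]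
    exact congrArg _ (congrFun (hc y hy) j)
  have hx0 : nablaRiem g (e.act Y) 0 x = knTensor c d omega1 := by
    rw [nablaRiem_act heV hY hxV, ← nablaRiem_change heV (he'.act hX) hxV hx' hYe]
    exact hrX
  have h0 : ∀ y ∈ V, riem g (e.act Y) y = knTensor c d omega1 := fun y hy =>
    (hj 0 y hy).trans hx0
  have h1 : ∀ y ∈ V, nablaRiem g (e.act Y) 1 y
      = covAct (fun a b c => connUp g (e.act Y) a b c y) (knTensor c d omega1) := fun y hy =>
    covDeriv_const hf h0 hy
  have hA : ∀ y ∈ V, ∀ i, conn g (e.act Y) 0 1 i y = conn g (e.act Y) 0 1 i x := by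
    intro y hy i
    have k1 : nablaRiem g (e.act Y) 1 y = nablaRiem g (e.act Y) 1 x := hj 1 y hy
    rw [h1 y hy, h1 x hxV, connUp_eq_upConn, connUp_eq_upConn] at k1
    have k2 := congrFun k1 ![2, 0, 0, 1, i]
    rw [covAct_knTensor_01, covAct_knTensor_01] at k2
    exact mul_left_cancel₀ (neg_ne_zero.mpr (mul_ne_zero two_ne_zero hd)) k2
  have hB : ∀ y ∈ V, ∀ i, conn g (e.act Y) 1 2 i y = conn g (e.act Y) 1 2 i x := by
    intro y hy i
    have k1 : nablaRiem g (e.act Y) 1 y = nablaRiem g (e.act Y) 1 x := hj 1 y hy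
    rw [h1 y hy, h1 x hxV, connUp_eq_upConn, connUp_eq_upConn] at k1
    have k2 := congrFun k1 ![0, 2, 2, 1, i]
    rw [covAct_knTensor_12, covAct_knTensor_12] at k2
    exact mul_left_cancel₀ (mul_ne_zero two_ne_zero hd) k2
  refine ⟨V, e.act Y, c, d, conn g (e.act Y) 0 1 0 x, conn g (e.act Y) 0 1 1 x,
    conn g (e.act Y) 0 1 2 x, conn g (e.act Y) 1 2 0 x, conn g (e.act Y) 1 2 1 x,
    conn g (e.act Y) 1 2 2 x, hxV, hd, hf, h0, fun y hy i => ?_, fun y hy i => ?_⟩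
  · rw [hA y hy]; fin_cases i <;> rfl
  · rw [hB y hy]; fin_cases i <;> rfl

/-- Local existence of the canonical frame. -/
theorem exists_isCanonicalFrame (hD : IsTypeD g) (h1 : HasHorizontalRank g 1 0) {t : ℕ}
    (ht : 0 < t) (h2 : HasHorizontalRank g 2 t) (x : M) :
    ∃ (T C : ℝ) (V : Set M) (f : Triad M), C + 2 * T ^ 2 ≠ 0 ∧ x ∈ V ∧
      IsCanonicalFrame g T C V f := by
  obtain ⟨V, f, c, d, k, s, t, ϖ, l, n, hx, hd, h⟩ := exists_isAdapted hD h1 x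
  rcases h.dichotomy hd hx with ⟨r, hr⟩ | ⟨X, hX, T, C, hne, hP⟩
  · exact (h2.nablaRiem_two_not_const ht h.isNullFrame hx h.riem_eq
      (fun _ hy => h.nablaRiem_one hy) hr).elim
  · have key : ∃ f', IsPreCanonical g T C V f' ∧ 0 < epsilon g f' x := by
      rcases lt_or_gt_of_ne (hP.epsilon_ne_zero h2 ht hne hx) with hε | hε
      · refine ⟨_, hP.flip, ?_⟩
        rw [hP.epsilon_flip hne hx]; linarith
      · exact ⟨_, hP, hε⟩
    obtain ⟨f', hP', hε⟩ := key
    have hO : IsOpen (V ∩ epsilon g f' ⁻¹' Set.Ioi 0) :=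
      hP'.contMDiffOn_epsilon.continuousOn.isOpen_inter_preimage hP'.1.isOpen isOpen_Ioi
    exact ⟨T, C, V ∩ epsilon g f' ⁻¹' Set.Ioi 0, f', hne, ⟨hx, hε⟩,
      (hP'.mono hO Set.inter_subset_left).isCanonicalFrame hne fun y hy => hy.2⟩

/-- Canonical frames overlapping at a point have equal constants, so T and C are locally constant
functions on a connected space. -/
theorem exists_constants [ConnectedSpace M]
    (h : ∀ x : M, ∃ (T C : ℝ) (V : Set M) (f : Triad M), C + 2 * T ^ 2 ≠ 0 ∧ x ∈ V ∧
      IsCanonicalFrame g T C V f) :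
    ∃ T C : ℝ, C + 2 * T ^ 2 ≠ 0 ∧ ∀ x : M, ∃ (U : Set M) (e : Triad M),
      x ∈ U ∧ IsCanonicalFrame g T C U e := by
  choose T C V f hne hx hc using h
  have hT : IsLocallyConstant fun x => (T x, C x) := by
    rw [IsLocallyConstant.iff_exists_open]
    refine fun x => ⟨V x, (hc x).isNullFrame.isOpen, hx x, fun y hy => ?_⟩
    obtain ⟨h1, h2, -⟩ := (hc y).unique (hc x) (hne y) (hx y) hy
    rw [h1, h2]
  obtain ⟨x₀⟩ := (inferInstance : Nonempty M)
  refine ⟨T x₀, C x₀, hne x₀, fun x => ⟨V x, f x, hx x, ?_⟩⟩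
  have h1 := hT.apply_eq_of_preconnectedSpace x x₀
  rw [Prod.mk.injEq] at h1
  rw [← h1.1, ← h1.2]
  exact hc x

theorem IsNullFrame.act_injective (h : IsNullFrame g U e) {x : M} (hx : x ∈ U)
    {X Y : GL (Fin 3) ℝ} (hXY : ∀ b, e.act X b x = e.act Y b x) : X = Y := by
  refine Units.ext (Matrix.ext fun a b => ?_)
  exact congrFun (h.eq_of_sum_eq hx (c := fun a => (X : Matrix (Fin 3) (Fin 3) ℝ) a b)
    (d := fun a => (Y : Matrix (Fin 3) (Fin 3) ℝ) a b) (hXY b)) a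

/-- Frames with constant first order jet are conjugate to the canonical frame. -/
theorem HasConstantFirstJet.existsUnique_act {T C : ℝ} (hne : C + 2 * T ^ 2 ≠ 0)
    (hcan : ∀ x : M, ∃ (U : Set M) (e : Triad M), x ∈ U ∧ IsCanonicalFrame g T C U e)
    (hU : IsConnected U) (h : HasConstantFirstJet g U e) :
    ∃! X : Oeta, IsCanonicalFrame g T C U (e.act X) := by
  obtain ⟨he, s, hs⟩ := h
  obtain ⟨x₀, hx₀⟩ := hU.nonempty
  obtain ⟨V, f, hxV, hf⟩ := hcan x₀
  obtain ⟨Y, hY, hYe⟩ := exists_frame_change he hf.isNullFrame hx₀ hxV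
  -- Y matches a canonical frame at one point; constancy of the first order jet extends the
  -- canonical form to U.
  have hP : IsPreCanonical g T C U (e.act Y) := by
    refine ⟨he.act hY, fun x hx => ?_⟩
    have hj : ∀ j : Fin 2, nablaRiem g (e.act Y) j x = nablaRiem g f j x₀ := by
      intro j
      rw [nablaRiem_act he hY hx, nablaRiem_change he hf.isNullFrame hx₀ hxV hYe]
      exact congrArg _ (congrFun ((hs x hx).trans (hs x₀ hx₀).symm) j)
    exact ⟨(hj 0).trans (hf.isPreCanonical.2 x₀ hxV).1,
      (hj 1).trans (hf.isPreCanonical.2 x₀ hxV).2⟩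
  -- At every point a canonical frame agrees with this one up to the reflection, so ε is nonzero;
  -- its sign is then constant on the connected set U.
  have hε : ∀ x ∈ U, epsilon g (e.act Y) x ≠ 0 := by
    intro x hx
    obtain ⟨V', f', hx', hf'⟩ := hcan x
    have hpos := hf'.epsilon_pos hx'
    obtain ⟨-, -, ⟨-, h1⟩ | ⟨-, h1⟩⟩ := hf'.isPreCanonical.unique hP hne hx' hx
    · rw [h1]; exact hpos.ne'
    · rw [h1]; exact neg_ne_zero.mpr hpos.ne'
  have key : ∃ X ∈ Oeta, IsPreCanonical g T C U (e.act X) ∧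
      ∀ x ∈ U, 0 < epsilon g (e.act X) x := by
    have hcont := hP.contMDiffOn_epsilon.continuousOn
    have hsign : ∀ x ∈ U, ∀ y ∈ U, epsilon g (e.act Y) x < 0 → 0 < epsilon g (e.act Y) y →
        False := by
      intro x hx y hy h1 h2
      obtain ⟨z, hz, hz0⟩ := hU.isPreconnected.intermediate_value hx hy hcont ⟨h1.le, h2.le⟩
      exact hε z hz hz0
    rcases lt_or_gt_of_ne (hε x₀ hx₀) with h0 | h0
    · refine ⟨Y * flipGL, Oeta.mul_mem hY flipGL_mem, ?_⟩
      rw [Triad.act_mul]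
      refine ⟨hP.flip, fun x hx => ?_⟩
      rw [hP.epsilon_flip hne hx, neg_pos]
      exact (lt_or_gt_of_ne (hε x hx)).resolve_right fun h1 => hsign x₀ hx₀ x hx h0 h1
    · exact ⟨Y, hY, hP, fun x hx =>
        (lt_or_gt_of_ne (hε x hx)).resolve_left fun h1 => hsign x hx x₀ hx₀ h1 h0⟩
  obtain ⟨X, hX, hXP, hXε⟩ := key
  have hXc := hXP.isCanonicalFrame hne hXε
  refine ⟨⟨X, hX⟩, hXc, fun X' hX' => Subtype.ext ?_⟩
  exact he.act_injective hx₀ (hXc.unique hX' hne hx₀ hx₀).2.2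

end Geometry

/-! ### Canonical frames from commutation relations -/

section Geometry

variable {M : Type*} [TopologicalSpace M] [ChartedSpace E3 M] [IsManifold 𝓘(ℝ, E3) ∞ M]
variable {g : LorentzMetric M} {U : Set M} {e : Triad M}

theorem brk_swap (g : LorentzMetric M) (e : Triad M) (a b c : Fin 3) (x : M) :
    brk g e a b c x = -brk g e b a c x := by
  rw [brk, VectorField.mlieBracket_swap_apply, map_neg]
  rfl

theorem IsNullFrame.brk_eq (h : IsNullFrame g U e) {x : M} (hx : x ∈ U) {a b : Fin 3}
    {k : Fin 3 → ℝ}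
    (hk : VectorField.mlieBracket 𝓘(ℝ, E3) (e a) (e b) x = ∑ i, k i • e i x) (c : Fin 3) :
    brk g e a b c x = ∑ i, k i * eta i c := by
  rw [brk, hk]
  simp only [map_sum, map_smul, sum_apply, smul_apply, h.orthonormal x hx, smul_eq_mul]

/-- A null frame with the commutation relations of the canonical configuration is canonical. -/
theorem IsNullFrame.isCanonicalFrame_of_brackets (h : IsNullFrame g U e) {T C : ℝ}
    (hne : C + 2 * T ^ 2 ≠ 0) {ε : M → ℝ}
    (h01 : ∀ x ∈ U, VectorField.mlieBracket 𝓘(ℝ, E3) (e 0) (e 1) x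
      = ∑ i, ![T, 0, -1] i • e i x)
    (h02 : ∀ x ∈ U, VectorField.mlieBracket 𝓘(ℝ, E3) (e 0) (e 2) x
      = ∑ i, ![0, 4 * T, -2 * ε x] i • e i x)
    (h12 : ∀ x ∈ U, VectorField.mlieBracket 𝓘(ℝ, E3) (e 1) (e 2) x
      = ∑ i, ![0, 0, T] i • e i x)
    (h1 : ∀ x ∈ U, dirDeriv (e 1) ε x = -T * ε x) (h2 : ∀ x ∈ U, dirDeriv (e 2) ε x = C)
    (hpos : ∀ x ∈ U, 0 < ε x) : IsCanonicalFrame g T C U e := by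
  have hz : ∀ a c x, brk g e a a c x = 0 := fun a c x => by linarith [brk_swap g e a a c x]
  have b01 := fun x hx => h.brk_eq hx (h01 x hx)
  have b02 := fun x hx => h.brk_eq hx (h02 x hx)
  have b12 := fun x hx => h.brk_eq hx (h12 x hx)
  have b10 : ∀ x ∈ U, ∀ c, brk g e 1 0 c x = -∑ i, ![T, 0, -1] i * eta i c := fun x hx c => by
    rw [brk_swap, b01 x hx]
  have b20 : ∀ x ∈ U, ∀ c, brk g e 2 0 c x = -∑ i, ![0, 4 * T, -2 * ε x] i * eta i c :=
    fun x hx c => by rw [brk_swap, b02 x hx]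
  have b21 : ∀ x ∈ U, ∀ c, brk g e 2 1 c x = -∑ i, ![0, 0, T] i * eta i c := fun x hx c => by
    rw [brk_swap, b12 x hx]
  have hε : ∀ x ∈ U, epsilon g e x = ε x := by
    intro x hx
    simp [epsilon, conn, hz, b02 x hx, b20 x hx, Fin.sum_univ_three, eta]
  have hP : IsPreCanonical g T C U e := by
    refine isPreCanonical_of_connection h ?_ ?_ ?_ ?_ ?_ ?_
    · intro x hx c
      fin_cases c <;> simp [conn, hz, b01 x hx, b10 x hx, b20 x hx, b21 x hx,
        Fin.sum_univ_three, eta] <;> ring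
    · intro x hx c
      fin_cases c <;> simp [conn, hz, b01 x hx, b02 x hx, b12 x hx, b21 x hx,
        Fin.sum_univ_three, eta] <;> ring
    · intro x hx
      simp [conn, b10 x hx, b12 x hx, b20 x hx, Fin.sum_univ_three, eta]
      ring
    · intro x hx
      simp [conn, hz, b20 x hx, Fin.sum_univ_three, eta]
    · intro x hx
      rw [dirDeriv_congr h.isOpen _ hε hx, h1 x hx, hε x hx]
    · intro x hx
      rw [dirDeriv_congr h.isOpen _ hε hx, h2 x hx]
  exact hP.isCanonicalFrame hne fun x hx => by rw [hε x hx]; exact hpos x hx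

end Geometry

/-! ### Bilinear forms and Lie brackets on a vector space -/

section VectorSpace

variable {F : Type*} [NormedAddCommGroup F] [NormedSpace ℝ F]

/-- The trivializations of the tangent bundle of a vector space are the identity, so a section is as
smooth as the underlying map. -/
theorem contMDiff_bilinearForm
    {B : (x : F) → TangentSpace 𝓘(ℝ, F) x →L[ℝ] TangentSpace 𝓘(ℝ, F) x →L[ℝ] ℝ}
    (hB : ContDiff (E := F) (F := F →L[ℝ] F →L[ℝ] ℝ) ℝ ∞ B) :
    ContMDiff 𝓘(ℝ, F) (𝓘(ℝ, F).prod 𝓘(ℝ, F →L[ℝ] F →L[ℝ] ℝ)) ∞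
      (fun x => TotalSpace.mk' (F →L[ℝ] F →L[ℝ] ℝ)
        (E := fun x => TangentSpace 𝓘(ℝ, F) x →L[ℝ] TangentSpace 𝓘(ℝ, F) x →L[ℝ] ℝ) x (B x)) := by
  intro x
  rw [contMDiffAt_section]
  refine hB.contMDiff.contMDiffAt.congr_of_eventuallyEq (Filter.Eventually.of_forall fun y => ?_)
  dsimp only
  rw [hom_trivializationAt_apply]
  ext v w
  simp [ContinuousLinearMap.inCoordinates]
  have hy : y ∈ (trivializationAt (F →L[ℝ] ℝ)
      (fun x : F => TangentSpace 𝓘(ℝ, F) x →L[ℝ] ℝ) x).baseSet := by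
    rw [hom_trivializationAt_baseSet]; simp [chartAt_self_eq]
  rw [Trivialization.coe_linearMapAt_of_mem _ hy]
  dsimp only
  erw [hom_trivializationAt_apply]
  simp [ContinuousLinearMap.inCoordinates]
  rfl

theorem mlieBracket_eq_lieBracket (v w : (x : F) → TangentSpace 𝓘(ℝ, F) x) (x : F) :
    VectorField.mlieBracket 𝓘(ℝ, F) v w x = VectorField.lieBracket ℝ v w x := by
  rw [← VectorField.mlieBracketWithin_univ, VectorField.mlieBracketWithin_eq_lieBracketWithin]
  exact congrFun VectorField.lieBracketWithin_univ x

end VectorSpace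

/-! ### Explicit models on ℝ³ -/

section Model

/-- The coordinate functionals. -/
abbrev coordL (i : Fin 3) : E3 →L[ℝ] ℝ := EuclideanSpace.proj i

/-- The triangular frame `α ∂₀ + b ∂₁ + F ∂₂`, `∂₁ + γ ∂₂`, `β ∂₂`. -/
def modelFrame (α b F γ β : E3 → ℝ) : Fin 3 → E3 → E3 := fun a x =>
  WithLp.toLp 2 (![![α x, b x, F x], ![0, 1, γ x], ![0, 0, β x]] a)

/-- The coframe dual to the triangular frame. -/
def modelCoframe (α b F γ β : E3 → ℝ) : Fin 3 → E3 → (E3 →L[ℝ] ℝ) := fun a x =>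
  ![(α x)⁻¹ • coordL 0, coordL 1 - b x • (α x)⁻¹ • coordL 0,
    (β x)⁻¹ • (coordL 2 - γ x • (coordL 1 - b x • (α x)⁻¹ • coordL 0)
      - F x • (α x)⁻¹ • coordL 0)] a

variable {α b F γ β : E3 → ℝ}

theorem modelCoframe_modelFrame {x : E3} (hα : α x ≠ 0) (hβ : β x ≠ 0) (i j : Fin 3) :
    modelCoframe α b F γ β i x (modelFrame α b F γ β j x) = if i = j then 1 else 0 := by
  fin_cases i <;> fin_cases j <;> simp [modelCoframe, modelFrame, hα, hβ]

theorem contDiff_modelCoframe (hα : ContDiff ℝ ∞ α) (hb : ContDiff ℝ ∞ b) (hF : ContDiff ℝ ∞ F)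
    (hγ : ContDiff ℝ ∞ γ) (hβ : ContDiff ℝ ∞ β) (hα0 : ∀ x, α x ≠ 0) (hβ0 : ∀ x, β x ≠ 0)
    (i : Fin 3) : ContDiff ℝ ∞ (modelCoframe α b F γ β i) := by
  have h0 : ContDiff ℝ ∞ fun x => (α x)⁻¹ • coordL 0 := (hα.inv hα0).smul contDiff_const
  have h1 : ContDiff ℝ ∞ fun x => coordL 1 - b x • (α x)⁻¹ • coordL 0 :=
    contDiff_const.sub (hb.smul h0)
  fin_cases i
  · exact h0
  · exact h1
  · exact (hβ.inv hβ0).smul ((contDiff_const.sub (hγ.smul h1)).sub (hF.smul h0))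

theorem contDiff_modelFrame (hα : ContDiff ℝ ∞ α) (hb : ContDiff ℝ ∞ b) (hF : ContDiff ℝ ∞ F)
    (hγ : ContDiff ℝ ∞ γ) (hβ : ContDiff ℝ ∞ β)
    (i : Fin 3) : ContDiff ℝ ∞ (modelFrame α b F γ β i) := by
  rw [contDiff_euclidean]
  intro j
  fin_cases i <;> fin_cases j <;> simp [modelFrame] <;> first | assumption | exact contDiff_const

/-- The bilinear form `η_{ab} ω^a ω^b`. -/
def modelForm (α b F γ β : E3 → ℝ) (x : E3) : E3 →L[ℝ] E3 →L[ℝ] ℝ :=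
  ∑ i, ∑ j, (eta i j • modelCoframe α b F γ β i x).smulRight (modelCoframe α b F γ β j x)

theorem modelForm_apply (x v w : E3) : modelForm α b F γ β x v w
    = ∑ i, ∑ j, eta i j * (modelCoframe α b F γ β i x v * modelCoframe α b F γ β j x w) := by
  simp [modelForm, sum_apply, mul_assoc]

theorem modelForm_modelFrame {x : E3} (hα : α x ≠ 0) (hβ : β x ≠ 0) (i j : Fin 3) :
    modelForm α b F γ β x (modelFrame α b F γ β i x) (modelFrame α b F γ β j x) = eta i j := by
  rw [modelForm_apply]
  simp [modelCoframe_modelFrame hα hβ]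

theorem contDiff_modelForm (hα : ContDiff ℝ ∞ α) (hb : ContDiff ℝ ∞ b) (hF : ContDiff ℝ ∞ F)
    (hγ : ContDiff ℝ ∞ γ) (hβ : ContDiff ℝ ∞ β) (hα0 : ∀ x, α x ≠ 0) (hβ0 : ∀ x, β x ≠ 0) :
    ContDiff ℝ ∞ (modelForm α b F γ β) := by
  have h := contDiff_modelCoframe hα hb hF hγ hβ hα0 hβ0
  unfold modelForm
  exact ContDiff.sum fun i _ => ContDiff.sum fun j _ =>
    ContDiff.smulRight ((contDiff_const (c := eta i j)).smul (h i)) (h j)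

theorem exists_modelForm_basis {x : E3} (hα : α x ≠ 0) (hβ : β x ≠ 0) :
    ∃ B : Module.Basis (Fin 3) ℝ E3, ∀ i j, modelForm α b F γ β x (B i) (B j) = eta i j := by
  have hli : LinearIndependent ℝ fun i => modelFrame α b F γ β i x := by
    rw [Fintype.linearIndependent_iff]
    intro k hk i
    have := congrArg (modelCoframe α b F γ β i x) hk
    simpa [modelCoframe_modelFrame hα hβ] using this
  refine ⟨basisOfLinearIndependentOfCardEqFinrank hli (by simp), fun i j => ?_⟩
  simp only [coe_basisOfLinearIndependentOfCardEqFinrank]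
  exact modelForm_modelFrame hα hβ i j

/-- The Lorentzian metric for which the triangular frame is a null frame. -/
def modelMetric (hα : ContDiff ℝ ∞ α) (hb : ContDiff ℝ ∞ b) (hF : ContDiff ℝ ∞ F)
    (hγ : ContDiff ℝ ∞ γ) (hβ : ContDiff ℝ ∞ β) (hα0 : ∀ x, α x ≠ 0) (hβ0 : ∀ x, β x ≠ 0) :
    LorentzMetric E3 where
  val x := modelForm α b F γ β x
  symm x v w := by
    refine (modelForm_apply x v w).trans (Eq.trans ?_ (modelForm_apply x w v).symm)
    rw [Finset.sum_comm]
    refine Finset.sum_congr rfl fun i _ => Finset.sum_congr rfl fun j _ => ?_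
    rw [eta_comm, mul_comm (modelCoframe α b F γ β j x v)]
  signature x := exists_modelForm_basis (hα0 x) (hβ0 x)
  contMDiff := contMDiff_bilinearForm (contDiff_modelForm hα hb hF hγ hβ hα0 hβ0)

/-- The components of the Lie bracket. -/
theorem lieBracket_apply {v w : E3 → E3} (hv : ContDiff ℝ ∞ v) (hw : ContDiff ℝ ∞ w) (x : E3)
    (i : Fin 3) : VectorField.lieBracket ℝ v w x i
      = fderiv ℝ (fun y => w y i) x (v x) - fderiv ℝ (fun y => v y i) x (w x) := by
  have h : ∀ {u : E3 → E3}, ContDiff ℝ ∞ u → ∀ ξ, fderiv ℝ (fun y => u y i) x ξ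
      = fderiv ℝ u x ξ i := by
    intro u hu ξ
    have h1 := ((coordL i).hasFDerivAt (x := u x)).comp x
      (hu.differentiable (by simp) x).hasFDerivAt
    have h2 : fderiv ℝ (fun y => u y i) x = _ := h1.fderiv
    rw [h2]; rfl
  rw [h hv, h hw]
  rfl

theorem isNullFrame_modelFrame (hα : ContDiff ℝ ∞ α) (hb : ContDiff ℝ ∞ b)
    (hF : ContDiff ℝ ∞ F) (hγ : ContDiff ℝ ∞ γ) (hβ : ContDiff ℝ ∞ β) (hα0 : ∀ x, α x ≠ 0)
    (hβ0 : ∀ x, β x ≠ 0) : IsNullFrame (modelMetric hα hb hF hγ hβ hα0 hβ0) Set.univ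
      (modelFrame α b F γ β) where
  isOpen := isOpen_univ
  smooth a := contMDiffOn_vectorSpace_iff_contDiffOn.mpr
    (contDiff_modelFrame hα hb hF hγ hβ a).contDiffOn
  orthonormal x _ := modelForm_modelFrame (hα0 x) (hβ0 x)

/-- A triangular frame whose coefficients satisfy the structure equations of the canonical
configuration. -/
theorem exists_canonical_metric {T C : ℝ} (hne : C + 2 * T ^ 2 ≠ 0) {ε : E3 → ℝ}
    (hα : ContDiff ℝ ∞ α) (hb : ContDiff ℝ ∞ b)
    (hF : ContDiff ℝ ∞ F) (hγ : ContDiff ℝ ∞ γ) (hβ : ContDiff ℝ ∞ β) (hα0 : ∀ x, α x ≠ 0)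
    (hβ0 : ∀ x, β x ≠ 0) (hε : ∀ x, 0 < ε x)
    (D : Fin 3 → (E3 → ℝ) → E3 → ℝ)
    (hD : ∀ a f x, D a f x = fderiv ℝ f x (modelFrame α b F γ β a x))
    (h01 : ∀ x, D 1 α x = -T * α x ∧ D 1 b x = -T * b x ∧
      D 0 γ x - D 1 F x = T * F x - β x)
    (h02 : ∀ x, D 2 α x = 0 ∧ D 2 b x = -4 * T ∧
      D 0 β x - D 2 F x = 4 * T * γ x - 2 * ε x * β x)
    (h12 : ∀ x, D 1 β x - D 2 γ x = T * β x)
    (h1 : ∀ x, D 1 ε x = -T * ε x) (h2 : ∀ x, D 2 ε x = C) :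
    ∃ g : LorentzMetric E3, ∀ x : E3, ∃ (U : Set E3) (e : Triad E3),
      x ∈ U ∧ IsCanonicalFrame g T C U e := by
  have hs := contDiff_modelFrame hα hb hF hγ hβ
  -- Brackets are compared coordinate by coordinate; the hypotheses are the coordinate components of
  -- [ℓ,m] = Tℓ - n, [ℓ,n] = 4Tm - 2εn and [m,n] = Tn.
  have hbr : ∀ (i j : Fin 3) (k : Fin 3 → ℝ) (x : E3),
      (∀ l, fderiv ℝ (fun y => modelFrame α b F γ β j y l) x (modelFrame α b F γ β i x)
        - fderiv ℝ (fun y => modelFrame α b F γ β i y l) x (modelFrame α b F γ β j x)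
          = ∑ m, k m * modelFrame α b F γ β m x l) →
      VectorField.mlieBracket 𝓘(ℝ, E3) (modelFrame α b F γ β i : (x : E3) → TangentSpace 𝓘(ℝ, E3) x)
        (modelFrame α b F γ β j : (x : E3) → TangentSpace 𝓘(ℝ, E3) x) x
        = ∑ m, k m • modelFrame α b F γ β m x := by
    intro i j k x h
    refine (mlieBracket_eq_lieBracket _ _ x).trans (PiLp.ext fun l => ?_)
    refine (lieBracket_apply (hs i) (hs j) x l).trans ((h l).trans ?_)
    simp
  refine ⟨modelMetric hα hb hF hγ hβ hα0 hβ0, fun x => ⟨Set.univ, modelFrame α b F γ β, trivial,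
    (isNullFrame_modelFrame hα hb hF hγ hβ hα0 hβ0).isCanonicalFrame_of_brackets hne (ε := ε)
      (fun x _ => hbr 0 1 _ x ?_) (fun x _ => hbr 0 2 _ x ?_) (fun x _ => hbr 1 2 _ x ?_)
      (fun x _ => ?_) (fun x _ => ?_) fun x _ => hε x⟩⟩
  all_goals
    obtain ⟨a1, a2, a3⟩ := h01 x
    obtain ⟨c1, c2, c3⟩ := h02 x
    have d3 := h12 x
    have k1 := h1 x
    have k2 := h2 x
    simp only [hD] at a1 a2 a3 c1 c2 c3 d3 k1 k2
  · intro l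
    fin_cases l <;>
      simp [modelFrame, Fin.sum_univ_three] at a1 a2 a3 ⊢ <;> linarith
  · intro l
    fin_cases l <;>
      simp [modelFrame, Fin.sum_univ_three] at c1 c2 c3 ⊢ <;> linarith
  · intro l
    fin_cases l <;>
      simp [modelFrame, Fin.sum_univ_three] at d3 ⊢ <;> linarith
  · exact Eq.trans (congrArg (fun L : E3 →L[ℝ] ℝ => L (modelFrame α b F γ β 1 x))
      mfderiv_eq_fderiv) k1
  · exact Eq.trans (congrArg (fun L : E3 →L[ℝ] ℝ => L (modelFrame α b F γ β 2 x))
      mfderiv_eq_fderiv) k2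

/-- Derivatives of functions of the coordinates. -/
theorem fderiv_of_hasFDerivAt {f : E3 → ℝ} {x ξ : E3} {f' : E3 →L[ℝ] ℝ} {r : ℝ}
    (h : HasFDerivAt f f' x) (hr : f' ξ = r) : fderiv ℝ f x ξ = r := by rw [h.fderiv, hr]

theorem contDiff_coord (i : Fin 3) : ContDiff ℝ ∞ fun x : E3 => x i := (coordL i).contDiff

theorem hasFDerivAt_coord (i : Fin 3) (x : E3) : HasFDerivAt (fun x : E3 => x i) (coordL i) x :=
  (coordL i).hasFDerivAt

/-- A global solution suffices; for T ≠ 0 the equilibrium serves. It is the inhomogeneous part of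
the coefficient F, produced by the term -n in [ℓ,m]. -/
theorem exists_solution (T : ℝ) : ∃ S : ℝ → ℝ, ContDiff ℝ ∞ S ∧
    ∀ y, HasDerivAt S (1 - 2 * T * S y) y := by
  by_cases hT : T = 0
  · exact ⟨id, contDiff_id, fun y => by simpa [hT] using hasDerivAt_id y⟩
  · refine ⟨fun _ => (2 * T)⁻¹, contDiff_const, fun y => ?_⟩
    rw [mul_inv_cancel₀ (by simpa using hT), sub_self]
    exact hasDerivAt_const y _

theorem exists_canonical_of_ne_zero {T C : ℝ} (hne : C + 2 * T ^ 2 ≠ 0) (hC : C ≠ 0) :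
    ∃ g : LorentzMetric E3, ∀ x : E3, ∃ (U : Set E3) (e : Triad E3),
      x ∈ U ∧ IsCanonicalFrame g T C U e := by
  obtain ⟨S, hS, hS'⟩ := exists_solution T
  have hE2 : ContDiff ℝ ∞ fun x : E3 => Real.exp (x 2) := (contDiff_coord 2).exp
  have hE2' : ContDiff ℝ ∞ fun x : E3 => Real.exp (-x 2) := (contDiff_coord 2).neg.exp
  have hSx : ContDiff ℝ ∞ fun x : E3 => S (x 1) := hS.comp (contDiff_coord 1)
  have dα : ∀ x ξ : E3, fderiv ℝ (fun x : E3 => Real.exp (-T * x 1)) x ξ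
      = -T * Real.exp (-T * x 1) * ξ 1 := fun x ξ =>
    fderiv_of_hasFDerivAt ((hasFDerivAt_coord 1 x).const_mul (-T)).exp (by simp; ring)
  have dE : ∀ x ξ : E3, fderiv ℝ (fun x : E3 => Real.exp (x 2)) x ξ = Real.exp (x 2) * ξ 2 :=
    fun x ξ => fderiv_of_hasFDerivAt (hasFDerivAt_coord 2 x).exp (by simp)
  have db : ∀ x ξ : E3, fderiv ℝ (fun x : E3 => -4 * T / C * Real.exp (x 2)) x ξ
      = -4 * T / C * (Real.exp (x 2) * ξ 2) :=
    fun x ξ => fderiv_of_hasFDerivAt ((hasFDerivAt_coord 2 x).exp.const_mul _) (by simp)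
  have dβ : ∀ x ξ : E3, fderiv ℝ (fun x : E3 => C * Real.exp (-x 2)) x ξ
      = -C * (Real.exp (-x 2) * ξ 2) :=
    fun x ξ => fderiv_of_hasFDerivAt ((hasFDerivAt_coord 2 x).neg.exp.const_mul _) (by simp)
  have dF : ∀ x ξ : E3, fderiv ℝ (fun x : E3 => (2 * T ^ 2 + C) / C * Real.exp (x 2)
      + C * Real.exp (-x 2) * S (x 1)) x ξ = (2 * T ^ 2 + C) / C * (Real.exp (x 2) * ξ 2)
        - C * (Real.exp (-x 2) * ξ 2) * S (x 1)
        + C * Real.exp (-x 2) * ((1 - 2 * T * S (x 1)) * ξ 1) := fun x ξ =>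
    fderiv_of_hasFDerivAt (((hasFDerivAt_coord 2 x).exp.const_mul _).add
      (((hasFDerivAt_coord 2 x).neg.exp.const_mul C).mul
        ((hS' (x 1)).comp_hasFDerivAt x (hasFDerivAt_coord 1 x)))) (by simp; ring)
  -- The coordinate x₂ is log ε. Then δε = -Tε and Δε = C force γ = -T and β = C exp(-x₂), which
  -- needs C ≠ 0; the other coefficients are integrated from the commutators.
  refine exists_canonical_metric (T := T) (C := C) (ε := fun x => Real.exp (x 2))
    (α := fun x => Real.exp (-T * x 1)) (b := fun x => -4 * T / C * Real.exp (x 2))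
    (F := fun x => (2 * T ^ 2 + C) / C * Real.exp (x 2) + C * Real.exp (-x 2) * S (x 1))
    (γ := fun _ => -T) (β := fun x => C * Real.exp (-x 2)) hne
    (contDiff_const.mul (contDiff_coord 1)).exp (contDiff_const.mul hE2)
    ((contDiff_const.mul hE2).add ((contDiff_const.mul hE2').mul hSx)) contDiff_const
    (contDiff_const.mul hE2') (fun x => (Real.exp_pos _).ne')
    (fun x => mul_ne_zero hC (Real.exp_pos _).ne') (fun x => Real.exp_pos _) _
    (fun _ _ _ => rfl) ?_ ?_ ?_ ?_ ?_
  all_goals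
    intro x
    have hexp : Real.exp (x 2) * Real.exp (-x 2) = 1 := by rw [← Real.exp_add]; simp
    have hCC : C⁻¹ * C = 1 := inv_mul_cancel₀ hC
    try refine ⟨?_, ?_, ?_⟩
  all_goals
    simp only [dα, dE, db, dβ, dF, fderiv_fun_const]
    simp [modelFrame]
  · ring
  · ring
  · linear_combination (-4 * T * (Real.exp (x 2) * Real.exp (-x 2))) * hCC - 4 * T * hexp
  · linear_combination (-2 * (2 * T ^ 2 + C) * (Real.exp (x 2) * Real.exp (-x 2))) * hCC
      - 4 * T ^ 2 * hexp
  · ring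
  · ring
  · linear_combination C * hexp

theorem exists_canonical_of_eq_zero {T : ℝ} (hT : T ≠ 0) :
    ∃ g : LorentzMetric E3, ∀ x : E3, ∃ (U : Set E3) (e : Triad E3),
      x ∈ U ∧ IsCanonicalFrame g T 0 U e := by
  have hα : ContDiff ℝ ∞ fun x : E3 => Real.exp (-T * x 1) :=
    (contDiff_const.mul (contDiff_coord 1)).exp
  have dα : ∀ x ξ : E3, fderiv ℝ (fun x : E3 => Real.exp (-T * x 1)) x ξ
      = -T * Real.exp (-T * x 1) * ξ 1 := fun x ξ =>
    fderiv_of_hasFDerivAt ((hasFDerivAt_coord 1 x).const_mul (-T)).exp (by simp; ring)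
  have dl : ∀ (r : ℝ) (x ξ : E3), fderiv ℝ (fun x : E3 => r * x 2) x ξ = r * ξ 2 :=
    fun r x ξ => fderiv_of_hasFDerivAt ((hasFDerivAt_coord 2 x).const_mul r) (by simp)
  have dF : ∀ x ξ : E3, fderiv ℝ (fun x : E3 => 2 * T ^ 2 * (x 2 * x 2)
      + 2 * (Real.exp (-T * x 1) * x 2) + (2 * T)⁻¹) x ξ
        = 4 * T ^ 2 * x 2 * ξ 2 + 2 * (Real.exp (-T * x 1) * ξ 2)
          - 2 * T * (Real.exp (-T * x 1) * x 2 * ξ 1) := fun x ξ =>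
    fderiv_of_hasFDerivAt (((((hasFDerivAt_coord 2 x).mul
      (hasFDerivAt_coord 2 x)).const_mul _).add
      ((((hasFDerivAt_coord 1 x).const_mul (-T)).exp.mul (hasFDerivAt_coord 2 x)).const_mul
        2)).add_const _) (by simp; ring)
  -- Now Δε = 0, so ε is taken as a function of x₁ and β = 1. The constant 1/(2T) in F is the
  -- equilibrium of S' = 1 - 2TS.
  refine exists_canonical_metric (T := T) (C := 0) (ε := fun x => Real.exp (-T * x 1))
    (α := fun x => Real.exp (-T * x 1)) (b := fun x => -4 * T * x 2)
    (F := fun x => 2 * T ^ 2 * (x 2 * x 2) + 2 * (Real.exp (-T * x 1) * x 2) + (2 * T)⁻¹)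
    (γ := fun x => -T * x 2) (β := fun _ => 1) (by simpa using hT) hα
    (contDiff_const.mul (contDiff_coord 2))
    (((contDiff_const.mul ((contDiff_coord 2).mul (contDiff_coord 2))).add
      (contDiff_const.mul (hα.mul (contDiff_coord 2)))).add contDiff_const)
    (contDiff_const.mul (contDiff_coord 2)) contDiff_const (fun x => (Real.exp_pos _).ne')
    (fun _ => one_ne_zero) (fun x => Real.exp_pos _) _ (fun _ _ _ => rfl) ?_ ?_ ?_ ?_ ?_
  all_goals
    intro x
    have hTT : T⁻¹ * T = 1 := inv_mul_cancel₀ hT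
    try refine ⟨?_, ?_, ?_⟩
  all_goals
    simp only [dα, dl, dF, fderiv_fun_const]
    simp [modelFrame]
  · ring
  · linear_combination (-1 : ℝ) * hTT
  · ring

end Model

end Lorentz3

end

/-! ### Assembly of the three statements -/

theorem mainTheorem2 :
    -- every type D, properly `CH₁` geometry has the canonical configuration, which is unique,
    -- and to which all its first-order normalized frames are conjugate
    (∀ (M : Type*) [TopologicalSpace M] [ChartedSpace Lorentz3.E3 M]
        [IsManifold 𝓘(ℝ, Lorentz3.E3) ∞ M] [ConnectedSpace M] (g : Lorentz3.LorentzMetric M),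
      Lorentz3.IsTypeD g → Lorentz3.ProperlyCH g 1 →
      ∃ T C : ℝ, C + 2 * T ^ 2 ≠ 0 ∧
        (∀ x : M, ∃ (U : Set M) (e : Lorentz3.Triad M),
          x ∈ U ∧ Lorentz3.IsCanonicalFrame g T C U e) ∧
        (∀ (T' C' : ℝ) (U U' : Set M) (e e' : Lorentz3.Triad M),
          Lorentz3.IsCanonicalFrame g T C U e → Lorentz3.IsCanonicalFrame g T' C' U' e' →
          (U'.Nonempty → T' = T ∧ C' = C) ∧ ∀ x ∈ U ∩ U', ∀ a, e' a x = e a x) ∧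
        (∀ (U : Set M) (e : Lorentz3.Triad M), IsConnected U →
          Lorentz3.HasConstantFirstJet g U e →
          ∃! X : Lorentz3.Oeta, Lorentz3.IsCanonicalFrame g T C U (e.act X))) ∧
    -- conversely, the canonical configuration is type D and properly `CH₁`
    (∀ (M : Type*) [TopologicalSpace M] [ChartedSpace Lorentz3.E3 M]
        [IsManifold 𝓘(ℝ, Lorentz3.E3) ∞ M] [ConnectedSpace M] (g : Lorentz3.LorentzMetric M)
        (T C : ℝ), C + 2 * T ^ 2 ≠ 0 →
      (∀ x : M, ∃ (U : Set M) (e : Lorentz3.Triad M),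
        x ∈ U ∧ Lorentz3.IsCanonicalFrame g T C U e) →
      Lorentz3.IsTypeD g ∧ Lorentz3.ProperlyCH g 1) ∧
    -- and it occurs for all admissible values of the constants
    (∀ T C : ℝ, C + 2 * T ^ 2 ≠ 0 →
      ∃ (M : Type) (_ : TopologicalSpace M) (_ : ChartedSpace Lorentz3.E3 M)
        (_ : IsManifold 𝓘(ℝ, Lorentz3.E3) ∞ M) (_ : ConnectedSpace M) (_ : T2Space M)
        (_ : SecondCountableTopology M) (g : Lorentz3.LorentzMetric M),
        ∀ x : M, ∃ (U : Set M) (e : Lorentz3.Triad M),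
          x ∈ U ∧ Lorentz3.IsCanonicalFrame g T C U e) := by
  refine ⟨?_, ?_, ?_⟩
  · intro M _ _ _ _ g hD hCH
    obtain ⟨-, h1, t, ht, h2⟩ := hCH
    obtain ⟨T, C, hne, hcan⟩ := Lorentz3.exists_constants
      (Lorentz3.exists_isCanonicalFrame hD h1 ht h2)
    refine ⟨T, C, hne, hcan, fun T' C' U U' e e' h h' => ⟨?_, fun x hx => ?_⟩,
      fun U e hU he => he.existsUnique_act hne hcan hU⟩
    -- An empty domain carries canonical frames for all constants, so a point is needed; there a
    -- canonical frame with constants T, C exists for comparison.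
    · rintro ⟨x, hx'⟩
      obtain ⟨V, f, hx, hf⟩ := hcan x
      obtain ⟨h1, h2, -⟩ := hf.unique h' hne hx hx'
      exact ⟨h1.symm, h2.symm⟩
    · exact (h.unique h' hne hx.1 hx.2).2.2
  · intro M _ _ _ _ g T C hne hcan
    exact ⟨Lorentz3.isTypeD_of_canonical hne hcan,
      fun p => ⟨_, Lorentz3.isNormalizingCrossSection_crossSection hne hcan p⟩,
      Lorentz3.hasHorizontalRank_one hne hcan, 1, one_pos,
      Lorentz3.hasHorizontalRank_two hne hcan⟩
  · intro T C hne
    have h : ∃ g : Lorentz3.LorentzMetric Lorentz3.E3, ∀ x : Lorentz3.E3,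
        ∃ (U : Set Lorentz3.E3) (e : Lorentz3.Triad Lorentz3.E3),
          x ∈ U ∧ Lorentz3.IsCanonicalFrame g T C U e := by
      by_cases hC : C = 0
      · subst hC
        exact Lorentz3.exists_canonical_of_eq_zero (by rintro rfl; simp at hne)
      · exact Lorentz3.exists_canonical_of_ne_zero hne hC
    obtain ⟨g, hg⟩ := h
    exact ⟨Lorentz3.E3, _, _, inferInstance, inferInstance, inferInstance, inferInstance, g, hg⟩
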